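/- **Setting.** Let $M$ be an open set in a finite-dimensional real vector space (phase space), $\gamma_{gc}$ a smooth one-form on $M$ with nonsingular $\omega_{gc}=d\gamma_{gc}$, $H_{gc}$ a smooth Hamiltonian, and $\dot z$ its Hamiltonian vector field ($i_0\omega_{gc}=-dH_{gc}$, where $i_0$ is the interior product with $\dot z$), with complete flow $\varphi_t$. Write $\dot S=i_0dS$, and let $\langle f\rangle(z)=\lim_{T\to\infty}\frac1T\int_0^Tf(\varphi_tz)\,dt$ be the average along unperturbed orbits. A function is *oscillatory* if it is bounded along each orbit and has average $0$. Let $\gamma_{gc}+\lambda\gamma_w$ be a perturbed action one-form with $\gamma_w$ smooth, and put $\omega_w=d\gamma_w$. Apply the Lie transform $\exp(-\lambda^2\mathcal L_{g_2})\exp(-\lambda\mathcal L_{g_1})$ to the action one-form and to $H_{gc}$, and add exact one-forms to the transformed action one-form. Let $S_1,S_2$ be the gauge functions that remain when the exact parts of the Lie derivatives are split off, so that at orders $\lambda$ and $\lambda^2$ $$\Gamma_1=\gamma_w-i_1\omega_{gc}+dS_1,\qquad \Gamma_2=-i_2\omega_{gc}-\tfrac12 i_1(\omega_w+d\Gamma_1)+dS_2,$$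 where $i_n=i_{g_n}$; and let $K_n$ be the order-$\lambda^n$ part of the transformed Hamiltonian. The *second-order oscillation-center transform* (resonances neglected) requires $\Gamma_1=\Gamma_2=0$, $K_1=0$, $S_1$ and $S_2$ oscillatory, and $K_2$ averaged ($\langle K_2\rangle=K_2$). **(1) Ponderomotive Hamiltonian.** For every such transform, $i_1\omega_{gc}=\gamma_w+dS_1$, $i_2\omega_{gc}=-\frac12i_1\omega_w+dS_2$, $\dot S_1=-i_0\gamma_w$, $K_2=\frac12i_0i_1\omega_w-\dot S_2$, and $$K_2=\left\langle\tfrac12\,i_0i_1\omega_w\right\rangle .$$ Conversely, suppose smooth oscillatory $S_1,S_2$ satisfy $\dot S_1=-i_0\gamma_w$ and $\dot S_2=\frac12i_0i_1\omega_w-\langle\frac12i_0i_1\omega_w\rangle$ (the average existing), with $g_1$ given by $i_1\omega_{gc}=\gamma_w+dS_1$. Then there is a $g_2$ that makes them an oscillation-center transform with $K_2=\langle\frac12i_0i_1\omega_w\rangle$. **(2) Gauge invariance.** Let $\gamma'_w=\gamma_w+dS_T$ with $S_T$ smooth. Then $(g_1,g_2,S_1,S_2,K_2)$ satisfies the equations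 $\Gamma_1=\Gamma_2=0$, $K_1=0$ and the formula for $K_2$ for $\gamma_w$ if and only if $(g_1,g_2,S_1-S_T,S_2,K_2)$ does for $\gamma'_w$. If $S_T$ is oscillatory and $(g_1,g_2,S_1,S_2,K_2)$ is an oscillation-center transform for $\gamma_w$, then $(g_1,g_2,S_1-S_T,S_2,K_2)$ is one for $\gamma'_w$, and it is the only one: every transform for $\gamma'_w$ has $S_1'=S_1-S_T$, $g_1'=g_1$, $S_2'=S_2$, $g_2'=g_2$, $K_2'=K_2$ on $M$. **(3) Explicit forms.** Use the Minkowski metric $\mathrm{diag}(-1,1,1,1)$ and $X:Y=X_{\mu\nu}Y^{\mu\nu}$. Let $m,c>0$, $e\ne0$. Let $F_0$ be a field tensor with an orthonormal tetrad $\hat e_0,\dots,\hat e_3$ such that $F_0\hat e_0=F_0\hat e_1=0$, $F_0\hat e_2=-\lambda_B\hat e_3$, $F_0\hat e_3=\lambda_B\hat e_2$, $\lambda_B>0$. Put $P_\parallel=1+F_0^2/\lambda_B^2$, $\Omega_B=e\lambda_B/mc$, $\hat e_\pm=(\hat e_2\pm i\hat e_3)/\sqrt2$. Let $\tilde A\in\mathbb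 C^4$ and let $k=k_\parallel-k_\perp(\hat e_2\sin\alpha+\hat e_3\cos\alpha)$, with $k_\parallel=P_\parallel k$ and $k_\perp\ge0$, be a real wavevector; $\tilde F=i(k\tilde A-\tilde Ak)$. Let $U$ be in the span of $\hat e_0,\hat e_1$, let $\mu\Omega_B>0$, and let $\rho=w/\Omega_B$ with $\mu=mw^2/2\Omega_B$, $w>0$. Put $J_\ell=J_\ell(k_\perp\rho)$, $\mathcal J^\pm_\ell=\hat e_+e^{i\alpha}J_{\ell-1}\pm\hat e_-e^{-i\alpha}J_{\ell+1}$, $D_\ell=k\cdot U+\ell\Omega_B$, $V_\ell=UJ_\ell+\frac{i\rho\Omega_B}{\sqrt2}\mathcal J_\ell^-$, $H_{1\ell}=-\frac ecV_\ell\cdot\tilde A$. If $D_\ell\neq0$ for all $\ell\in\mathbb Z$, the following three series converge and the three expressions are equal: $$\begin{aligned}\text{(A)}\quad&\frac{e^2}{2mc^2}\Big(\tilde A^*\!\cdot P_\parallel\cdot\tilde A+\frac{i}{\lambda_B\Omega_B}k\cdot U\,\tilde A^*\!\cdot F_0\cdot\tilde A+\text{c.c.}\Big)+\sum_\ell\Big[\frac{eH_{1\ell}^*}{mcD_\ell}\Big\{k\cdot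 P_\parallel\cdot\tilde A\,J_\ell\\&\quad-\frac{ik\cdot U}{\rho\Omega_B}\Big[-\frac{ik_\perp U}{2\Omega_B}(J_{\ell-1}-J_{\ell+1})-\frac{k\cdot U}{\sqrt2\,\Omega_B}\mathcal J_\ell^++\frac{\rho}{\lambda_B}F_0\cdot k\,J_\ell\Big]\cdot\tilde A\Big\}+\frac{|H_{1\ell}|^2}{2mD_\ell^2}k\cdot P_\parallel\cdot k+\text{c.c.}\Big],\\ \text{(B)}\quad&\sum_\ell\Big[\frac{ie^2}{2mc^2D_\ell^2}V_\ell\cdot\tilde F\cdot\Big(\frac{F_0D_\ell}{\lambda_B\Omega_B}+iP_\parallel\Big)\cdot\tilde F^*\!\cdot V_\ell^*\\&\quad+\frac{e^2\rho}{2\sqrt2\,mc^2D_\ell}\,\tilde F:(\mathcal J_\ell^-U)\ \tilde F^*\!:\Big[\frac1{\lambda_B}F_0\cdot\Big(\mathbf 1J_\ell+\frac{\sqrt2\,i}{\rho\Omega_B}\mathcal J_\ell^-U\Big)^{*}\Big]+\text{c.c.}\Big],\\ \text{(C)}\quad&\frac{e^2}{2mc^2}\tilde A\cdot\tilde A^*-\frac12\sum_\ell\Big(\frac1mk_\parallel\cdot\frac{\partial}{\partial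 U}+\ell\frac{\partial}{\partial\mu}\Big)\frac{|H_{1\ell}|^2}{D_\ell}+\text{c.c.}\end{aligned}$$ **(4) They are $K_2$.** Let, moreover, $\epsilon>0$, and take the leading-order guiding-center system with coordinates $(R,U,\mu,\theta)$, in which the slowly varying background and wave amplitude and wavevector are frozen at their local values: $\gamma_{gc}=(\frac e{\epsilon c}A_0+mU)\cdot dR+\epsilon\mu\,d\theta$ with $A_0=-\frac12F_0\cdot R$, $H_{gc}=\frac m2U^2+\mu\Omega_B$, and $\gamma_w=\frac ec\tilde A\cdot dr\,e^{ik\cdot r/\epsilon}+\text{c.c.}$ with $r=R+\epsilon\rho\hat a$, $\hat a=\hat e_2\cos\theta-\hat e_3\sin\theta$. Let $M$ be the nonresonant region $\mu\Omega_B>0$, $2k\cdot U+n\Omega_B\ne0$ for all $n\in\mathbb Z$. This is a Hamiltonian system as in the setting. On it $\langle (e^{i\Psi_\ell/\epsilon})^*e^{i\Psi_{\ell'}/\epsilon}\rangle=\delta_{\ell\ell'}$ for $\Psi_\ell=k\cdot R+\epsilon\ell(\theta-\alpha)$, and $$S_T=-\frac{\epsilon e}{c}\rho\,\hat a\cdot\tilde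 A\,\frac{e^{i\rho\hat a\cdot k}-1}{i\rho\hat a\cdot k}\,e^{ik\cdot R/\epsilon}+\text{c.c.}$$ is smooth and oscillatory. There are $g_1,g_2,S_1,S_2$ such that $(g_1,g_2,S_1,S_2)$ is an oscillation-center transform for $\gamma_w$ with $K_2=$ (A), and $(g_1,g_2,S_1-S_T,S_2)$ is one for $\gamma_w+dS_T$ with $K_2'=$ (B). -/

import Mathlib

open Filter Topology Matrix
open scoped ContDiff

noncomputable section

namespace OscCenter

/-! ### Exterior calculus on (an open set of) a phase space -/

section Abstract

variable {E : Type*} [NormedAddCommGroup E] [NormedSpace ℝ E]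

/-- The exterior derivative `ω = dγ` of a one-form,
`ω(u, v) = (∂_u γ)(v) - (∂_v γ)(u)`, i.e. `ω_{μν} = γ_{ν,μ} - γ_{μ,ν}`. -/
def dForm (γ : E → (E →L[ℝ] ℝ)) (z : E) : E →L[ℝ] E →L[ℝ] ℝ :=
  fderiv ℝ γ z - (fderiv ℝ γ z).flip

/-- Interior product `i_g γ` of a vector field with a one-form. -/
def intForm (g : E → E) (γ : E → (E →L[ℝ] ℝ)) (z : E) : ℝ := γ z (g z)

/-- Lie derivative of a scalar field. -/
def lieFun (g : E → E) (f : E → ℝ) (z : E) : ℝ := fderiv ℝ f z (g z)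

/-- Lie derivative of a one-form, `(L_g γ)_ν = g^μ γ_{ν,μ} + γ_μ g^μ_{,ν}`. -/
def lieForm (g : E → E) (γ : E → (E →L[ℝ] ℝ)) (z : E) : E →L[ℝ] ℝ :=
  fderiv ℝ γ z (g z) + (γ z).comp (fderiv ℝ g z)

/-- Coefficient of `λ` in `exp(-λ² L₂) exp(-λ L₁) (t₀ + λ t₁ + λ² t₂)`. -/
def lieOrder1 {X : Type*} [AddCommGroup X] (L₁ : X → X) (t₀ t₁ : X) : X :=
  t₁ - L₁ t₀

/-- Coefficient of `λ²` in `exp(-λ² L₂) exp(-λ L₁) (t₀ + λ t₁ + λ² t₂)`. -/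
def lieOrder2 {X : Type*} [AddCommGroup X] [Module ℝ X] (L₁ L₂ : X → X) (t₀ t₁ t₂ : X) : X :=
  t₂ - L₂ t₀ - L₁ t₁ + (1 / 2 : ℝ) • L₁ (L₁ t₀)

/-- The data of an unperturbed system in phase space: the phase space `M` (a set in `E`), the
action one-form `γ`, the Hamiltonian `H`, the phase velocity `ż` and its flow. The laws that
relate them are in `PhaseSystem.IsHamiltonian`. -/
structure PhaseSystem (E : Type*) [NormedAddCommGroup E] [NormedSpace ℝ E] where
  M : Set E
  γ : E → (E →L[ℝ] ℝ)
  H : E → ℝ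
  vel : E → E
  flow : ℝ → E → E

namespace PhaseSystem

/-- `(γ, H)` is a smooth Hamiltonian system on the open set `M` with nonsingular Lagrangian
two-form `ω = dγ`, `ż` is its Hamiltonian vector field (`i_ż ω = -dH`), and `flow` is the
(complete) flow of `ż`. -/
structure IsHamiltonian (P : PhaseSystem E) : Prop where
  isOpen : IsOpen P.M
  smooth_γ : ContDiffOn ℝ ∞ P.γ P.M
  smooth_H : ContDiffOn ℝ ∞ P.H P.M
  nondegenerate : ∀ z ∈ P.M, Function.Bijective (dForm P.γ z)
  hamilton : ∀ z ∈ P.M, dForm P.γ z (P.vel z) = -fderiv ℝ P.H z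
  flow_mem : ∀ z ∈ P.M, ∀ t, P.flow t z ∈ P.M
  flow_zero : ∀ z ∈ P.M, P.flow 0 z = z
  flow_add : ∀ z ∈ P.M, ∀ s t, P.flow (s + t) z = P.flow s (P.flow t z)
  flow_deriv : ∀ z ∈ P.M, ∀ t,
    HasDerivAt (fun s => P.flow s z) (P.vel (P.flow t z)) t

/-- The average of `f` along the unperturbed orbit through `z` exists and equals `a`. -/
def HasOrbitAverage (P : PhaseSystem E) {F : Type*} [NormedAddCommGroup F] [NormedSpace ℝ F]
    (f : E → F) (z : E) (a : F) : Prop :=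
  Tendsto (fun T : ℝ => T⁻¹ • ∫ t in (0 : ℝ)..T, f (P.flow t z)) atTop (𝓝 a)

/-- `f` is purely oscillatory: along every unperturbed orbit it has no secular growth and its
average vanishes. -/
def IsOscillatory (P : PhaseSystem E) (f : E → ℝ) : Prop :=
  ∀ z ∈ P.M, (∃ C, ∀ t, |f (P.flow t z)| ≤ C) ∧ P.HasOrbitAverage f z 0

/-- Time derivative along unperturbed orbits, `Ṡ = i₀ dS`. -/
def dot (P : PhaseSystem E) (S : E → ℝ) (z : E) : ℝ := fderiv ℝ S z (P.vel z)

/-- The scalar `½ i₀ i₁ ω_w`, where `ω_w = dγ_w`, `i₁` is the interior product with `g₁` and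
`i₀` the interior product with the unperturbed phase velocity. -/
def halfI0I1 (P : PhaseSystem E) (γw : E → (E →L[ℝ] ℝ)) (g₁ : E → E) (z : E) : ℝ :=
  (1 / 2) * dForm γw z (g₁ z) (P.vel z)

/-- The gauge function added to the transformed action one-form at first order. The exact
one-form that the Lie derivative produces is split off, so that `Γ₁ = γ_w - i₁ ω + dS₁`. -/
def gauge1 (P : PhaseSystem E) (g₁ : E → E) (S₁ : E → ℝ) (z : E) : ℝ :=
  S₁ z + intForm g₁ P.γ z

/-- The gauge function added to the transformed action one-form at second order. The exact
one-forms that the Lie derivatives produce are split off, so that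
`Γ₂ = -i₂ ω - ½ i₁ (ω_w + dΓ₁) + dS₂`. -/
def gauge2 (P : PhaseSystem E) (γw : E → (E →L[ℝ] ℝ)) (g₁ g₂ : E → E) (S₂ : E → ℝ)
    (z : E) : ℝ :=
  S₂ z + intForm g₂ P.γ z + intForm g₁ γw z
    - (1 / 2) * lieFun g₁ (intForm g₁ P.γ) z

/-- The Lie transform with generators `g₁, g₂` and gauge functions given by `S₁, S₂` removes the
perturbation `λ γ_w` from the action one-form through order `λ²`, leaves no first-order
Hamiltonian, and its second-order Hamiltonian is `K₂`. -/
structure IsLieTransform (P : PhaseSystem E) (γw : E → (E →L[ℝ] ℝ)) (g₁ g₂ : E → E)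
    (S₁ S₂ K₂ : E → ℝ) : Prop where
  smooth_g₁ : ContDiffOn ℝ ∞ g₁ P.M
  smooth_g₂ : ContDiffOn ℝ ∞ g₂ P.M
  smooth_S₁ : ContDiffOn ℝ ∞ S₁ P.M
  smooth_S₂ : ContDiffOn ℝ ∞ S₂ P.M
  /-- `Γ₁ = 0` -/
  form1 : ∀ z ∈ P.M,
    lieOrder1 (lieForm g₁) P.γ γw z + fderiv ℝ (P.gauge1 g₁ S₁) z = 0
  /-- `Γ₂ = 0` -/
  form2 : ∀ z ∈ P.M,
    lieOrder2 (lieForm g₁) (lieForm g₂) P.γ γw 0 z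
      + fderiv ℝ (P.gauge2 γw g₁ g₂ S₂) z = 0
  /-- `K₁ = 0` -/
  ham1 : ∀ z ∈ P.M, lieOrder1 (lieFun g₁) P.H 0 z = 0
  ham2 : ∀ z ∈ P.M, K₂ z = lieOrder2 (lieFun g₁) (lieFun g₂) P.H 0 0 z

/-- The second-order oscillation-center Lie transform: a Lie transform as above for which `S₁` and
`S₂` are purely oscillatory (in particular free of secular terms), and in which `S₂` has removed
the oscillatory part of the second-order Hamiltonian, so that `K₂` equals its own average. -/
structure IsOscillationCenterTransform (P : PhaseSystem E) (γw : E → (E →L[ℝ] ℝ))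
    (g₁ g₂ : E → E) (S₁ S₂ K₂ : E → ℝ) : Prop extends
    P.IsLieTransform γw g₁ g₂ S₁ S₂ K₂ where
  osc_S₁ : P.IsOscillatory S₁
  osc_S₂ : P.IsOscillatory S₂
  averaged : ∀ z ∈ P.M, P.HasOrbitAverage K₂ z (K₂ z)

/-- The Lagrangian gauge transformation `γ_w ↦ γ_w + dS_T`. -/
def gaugeShift (γw : E → (E →L[ℝ] ℝ)) (S_T : E → ℝ) (z : E) : E →L[ℝ] ℝ :=
  γw z + fderiv ℝ S_T z

end PhaseSystem

end Abstract

/-! ### Minkowski algebra, metric `diag(-1, 1, 1, 1)` -/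

/-- The diagonal of the Minkowski metric. -/
def eta (i : Fin 4) : ℝ := if i = 0 then -1 else 1

/-- `a · b` for real four-vectors. -/
def mdot (a b : Fin 4 → ℝ) : ℝ := ∑ i, eta i * a i * b i

/-- `a · b` for complex four-vectors (bilinear, without conjugation). -/
def cdot (a b : Fin 4 → ℂ) : ℂ := ∑ i, (eta i : ℂ) * a i * b i

/-- A real four-vector as a complex one. -/
def toC (a : Fin 4 → ℝ) : Fin 4 → ℂ := fun i => (a i : ℂ)

/-- Complex conjugate of a four-vector. -/
def conjV (a : Fin 4 → ℂ) : Fin 4 → ℂ := fun i => starRingEnd ℂ (a i)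

/-- The dyad `a b` as a mixed tensor `a^μ b_ν`. -/
def dyad (a b : Fin 4 → ℂ) : Matrix (Fin 4) (Fin 4) ℂ := Matrix.of fun i j => a i * (eta j * b j)

/-- `M : N = M_{μν} N^{μν}` for mixed tensors `M^μ_ν`, `N^μ_ν`. -/
def ddot (M N : Matrix (Fin 4) (Fin 4) ℂ) : ℂ :=
  ∑ i, ∑ j, (eta i : ℂ) * eta j * M i j * N i j

/-- Entrywise complex conjugate of a tensor. -/
def conjM (M : Matrix (Fin 4) (Fin 4) ℂ) : Matrix (Fin 4) (Fin 4) ℂ := M.map (starRingEnd ℂ)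

/-- `z + c.c.` -/
def addCC (z : ℂ) : ℝ := 2 * z.re

/-- The linear functional `v ↦ a · v` of a real four-vector. -/
def covR (a : Fin 4 → ℝ) : (Fin 4 → ℝ) →L[ℝ] ℝ :=
  ∑ i, (eta i * a i) • ContinuousLinearMap.proj (R := ℝ) (φ := fun _ : Fin 4 => ℝ) i

/-- The linear functional `v ↦ a · v` of a complex four-vector, on real four-vectors. -/
def covC (a : Fin 4 → ℂ) : (Fin 4 → ℝ) →L[ℝ] ℂ :=
  ∑ i, ((eta i : ℂ) * a i) •
    (Complex.ofRealCLM.comp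
      (ContinuousLinearMap.proj (R := ℝ) (φ := fun _ : Fin 4 => ℝ) i))

/-- The Bessel function `J_ℓ`, `ℓ ∈ ℤ`. -/
def besselJ (ℓ : ℤ) (x : ℝ) : ℂ :=
  (1 / (2 * Real.pi) : ℂ) * ∫ ξ in (0 : ℝ)..(2 * Real.pi),
    Complex.exp (Complex.I * x * Real.sin ξ - Complex.I * ℓ * ξ)

/-- `(e^{ix} - 1) / (ix)`, continued by its limit `1` at `x = 0`. -/
def expQuot (x : ℝ) : ℂ :=
  if x = 0 then 1 else (Complex.exp (Complex.I * x) - 1) / (Complex.I * x)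

/-- The magnitude of the part of `k` in the two-flat spanned by `tet 2` and `tet 3`. -/
def perpNorm (tet : Fin 4 → Fin 4 → ℝ) (k : Fin 4 → ℝ) : ℝ :=
  Real.sqrt (mdot (tet 2) k ^ 2 + mdot (tet 3) k ^ 2)

/-! ### A guiding center in an eikonal wave, to leading order -/

/-- The local values of the background field and of the wave. -/
structure LocalWave where
  /-- rest mass -/
  m : ℝ
  /-- speed of light -/
  c : ℝ
  /-- charge -/
  e : ℝ
  /-- the Lorentz scalar `λ_B` of the background field -/
  lamB : ℝ
  /-- the guiding-center and eikonal expansion parameter -/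
  ε : ℝ
  /-- the background field tensor `F₀`, with mixed components `F^μ_ν` -/
  F₀ : Matrix (Fin 4) (Fin 4) ℝ
  /-- the orthonormal tetrad -/
  tet : Fin 4 → Fin 4 → ℝ
  /-- amplitude of the wave four-potential -/
  A : Fin 4 → ℂ
  /-- four-wavevector -/
  k : Fin 4 → ℝ
  /-- direction of the perpendicular part of the wavevector -/
  α : ℝ
  m_pos : 0 < m
  c_pos : 0 < c
  e_ne : e ≠ 0
  lamB_pos : 0 < lamB
  ε_pos : 0 < ε
  tet_orthonormal : ∀ a b, mdot (tet a) (tet b) = if a = b then eta a else 0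
  F₀_tet0 : F₀ *ᵥ tet 0 = 0
  F₀_tet1 : F₀ *ᵥ tet 1 = 0
  F₀_tet2 : F₀ *ᵥ tet 2 = -lamB • tet 3
  F₀_tet3 : F₀ *ᵥ tet 3 = lamB • tet 2
  k_tet2 : mdot (tet 2) k = -(perpNorm tet k * Real.sin α)
  k_tet3 : mdot (tet 3) k = -(perpNorm tet k * Real.cos α)

namespace LocalWave

variable (L : LocalWave)

/-- Gyrofrequency `Ω_B = e λ_B / (m c)`. -/
def Omega : ℝ := L.e * L.lamB / (L.m * L.c)

/-- `k_⊥` -/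
def kperp : ℝ := perpNorm L.tet L.k

/-- Gyroradius `ρ = w / Ω_B`, where the gyromomentum is `μ = m w² / (2 Ω_B)`. -/
def rho (μ : ℝ) : ℝ := Real.sqrt (2 * μ * L.Omega / L.m) / L.Omega

/-- `U = u⁰ ê₀ + u¹ ê₁`, a vector in the parallel two-flat. -/
def U (u : Fin 2 → ℝ) : Fin 4 → ℝ := u 0 • L.tet 0 + u 1 • L.tet 1

/-- `P_∥ = 1 + F₀² / λ_B²` -/
def Ppar : Matrix (Fin 4) (Fin 4) ℝ := 1 + (L.lamB ^ 2)⁻¹ • (L.F₀ * L.F₀)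

/-- `P_∥`, acting on complex four-vectors. -/
def PparC : Matrix (Fin 4) (Fin 4) ℂ := L.Ppar.map (fun x : ℝ => (x : ℂ))

/-- `F₀`, acting on complex four-vectors. -/
def F₀C : Matrix (Fin 4) (Fin 4) ℂ := L.F₀.map (fun x : ℝ => (x : ℂ))

/-- The components of `k_∥ = P_∥ · k` along `ê₀` and `ê₁`. -/
def kparComp : Fin 2 → ℝ := ![-mdot (L.tet 0) L.k, mdot (L.tet 1) L.k]

/-- `F̃ = i (k Ã - Ã k)` -/
def Ftilde : Matrix (Fin 4) (Fin 4) ℂ :=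
  Complex.I • (dyad (toC L.k) L.A - dyad L.A (toC L.k))

/-- `ê₊ = (ê₂ + i ê₃) / √2` -/
def ePlus : Fin 4 → ℂ := (1 / Real.sqrt 2 : ℂ) • (toC (L.tet 2) + Complex.I • toC (L.tet 3))

/-- `ê₋ = (ê₂ - i ê₃) / √2` -/
def eMinus : Fin 4 → ℂ := (1 / Real.sqrt 2 : ℂ) • (toC (L.tet 2) - Complex.I • toC (L.tet 3))

/-- `J_ℓ(k_⊥ ρ)` -/
def J (ℓ : ℤ) (μ : ℝ) : ℂ := besselJ ℓ (L.kperp * L.rho μ)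

/-- `𝒥_ℓ⁺ = ê₊ e^{iα} J_{ℓ-1} + ê₋ e^{-iα} J_{ℓ+1}` -/
def calJPlus (ℓ : ℤ) (μ : ℝ) : Fin 4 → ℂ :=
  (Complex.exp (Complex.I * L.α) * L.J (ℓ - 1) μ) • L.ePlus
    + (Complex.exp (-(Complex.I * L.α)) * L.J (ℓ + 1) μ) • L.eMinus

/-- `𝒥_ℓ⁻ = ê₊ e^{iα} J_{ℓ-1} - ê₋ e^{-iα} J_{ℓ+1}` -/
def calJMinus (ℓ : ℤ) (μ : ℝ) : Fin 4 → ℂ :=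
  (Complex.exp (Complex.I * L.α) * L.J (ℓ - 1) μ) • L.ePlus
    - (Complex.exp (-(Complex.I * L.α)) * L.J (ℓ + 1) μ) • L.eMinus

/-- The resonant denominator `D_ℓ = k · U + ℓ Ω_B`. -/
def D (ℓ : ℤ) (u : Fin 2 → ℝ) : ℝ := mdot L.k (L.U u) + ℓ * L.Omega

/-- `U J_ℓ + (i ρ Ω_B / √2) 𝒥_ℓ⁻` -/
def V (ℓ : ℤ) (u : Fin 2 → ℝ) (μ : ℝ) : Fin 4 → ℂ :=
  L.J ℓ μ • toC (L.U u)
    + (Complex.I * L.rho μ * L.Omega / Real.sqrt 2) • L.calJMinus ℓ μ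

/-- `H_{1ℓ} = -(e/c) (U J_ℓ + (i ρ Ω_B / √2) 𝒥_ℓ⁻) · Ã` -/
def H1 (ℓ : ℤ) (u : Fin 2 → ℝ) (μ : ℝ) : ℂ := -(L.e / L.c) * cdot (L.V ℓ u μ) L.A

/-! #### The three explicit forms of the ponderomotive Hamiltonian -/

/-- The summand `K_{2ℓ}` of the first form. -/
def K2TermA (ℓ : ℤ) (u : Fin 2 → ℝ) (μ : ℝ) : ℝ :=
  addCC
    (L.e * starRingEnd ℂ (L.H1 ℓ u μ) / (L.m * L.c * L.D ℓ u)
        * (cdot (toC L.k) (L.PparC *ᵥ L.A) * L.J ℓ μ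
          - Complex.I * mdot L.k (L.U u) / (L.rho μ * L.Omega)
            * cdot
              ((-(Complex.I * L.kperp / (2 * L.Omega) * (L.J (ℓ - 1) μ - L.J (ℓ + 1) μ)))
                  • toC (L.U u)
                - (mdot L.k (L.U u) / (Real.sqrt 2 * L.Omega) : ℂ) • L.calJPlus ℓ μ
                + (L.rho μ / L.lamB * L.J ℓ μ) • (L.F₀C *ᵥ toC L.k))
              L.A)
      + Complex.normSq (L.H1 ℓ u μ) / (2 * L.m * L.D ℓ u ^ 2)
          * mdot L.k (L.Ppar *ᵥ L.k))

/-- First form: nonresonant terms plus `∑ K_{2ℓ}`, in terms of `Ã`. -/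
def K2FormA (u : Fin 2 → ℝ) (μ : ℝ) : ℝ :=
  L.e ^ 2 / (2 * L.m * L.c ^ 2)
      * addCC
        (cdot (conjV L.A) (L.PparC *ᵥ L.A)
          + Complex.I / (L.lamB * L.Omega) * mdot L.k (L.U u)
            * cdot (conjV L.A) (L.F₀C *ᵥ L.A))
    + ∑' ℓ : ℤ, L.K2TermA ℓ u μ

/-- The summand `K'_{2ℓ}` of the second form. -/
def K2TermF (ℓ : ℤ) (u : Fin 2 → ℝ) (μ : ℝ) : ℝ :=
  addCC
    (Complex.I * L.e ^ 2 / (2 * L.m * L.c ^ 2 * L.D ℓ u ^ 2)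
        * cdot (L.V ℓ u μ)
          (L.Ftilde *ᵥ
            (((L.D ℓ u / (L.lamB * L.Omega) : ℂ) • L.F₀C + Complex.I • L.PparC) *ᵥ
              (conjM L.Ftilde *ᵥ conjV (L.V ℓ u μ))))
      + L.e ^ 2 * L.rho μ / (2 * Real.sqrt 2 * L.m * L.c ^ 2 * L.D ℓ u)
        * ddot L.Ftilde (dyad (L.calJMinus ℓ μ) (toC (L.U u)))
        * ddot (conjM L.Ftilde)
          ((1 / L.lamB : ℂ) •
            (L.F₀C *
              conjM (L.J ℓ μ • (1 : Matrix (Fin 4) (Fin 4) ℂ)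
                + (Real.sqrt 2 * Complex.I / (L.rho μ * L.Omega))
                  • dyad (L.calJMinus ℓ μ) (toC (L.U u))))))

/-- Second form, manifestly gauge invariant: `Ã` enters only through `F̃`. -/
def K2FormF (u : Fin 2 → ℝ) (μ : ℝ) : ℝ := ∑' ℓ : ℤ, L.K2TermF ℓ u μ

/-- `|H_{1ℓ}|² / D_ℓ` -/
def W (ℓ : ℤ) (u : Fin 2 → ℝ) (μ : ℝ) : ℝ := Complex.normSq (L.H1 ℓ u μ) / L.D ℓ u

/-- The summand of the canonical form,
`-½ ((1/m) k_∥ · ∂/∂U + ℓ ∂/∂μ) (|H_{1ℓ}|² / D_ℓ) + c.c.` -/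
def K2TermC (ℓ : ℤ) (u : Fin 2 → ℝ) (μ : ℝ) : ℝ :=
  -((1 / L.m) * deriv (fun s : ℝ => L.W ℓ (u + s • L.kparComp) μ) 0
    + ℓ * deriv (fun s : ℝ => L.W ℓ u s) μ)

/-- Third form, obtained by canonical Lie transforms. -/
def K2FormC (u : Fin 2 → ℝ) (μ : ℝ) : ℝ :=
  addCC (L.e ^ 2 / (2 * L.m * L.c ^ 2) * cdot L.A (conjV L.A)) + ∑' ℓ : ℤ, L.K2TermC ℓ u μ

/-! #### The leading-order guiding-center system and the wave perturbation -/

/-- Guiding-center phase space with coordinates `(R, u, μ, θ)`. -/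
abbrev Phase : Type := (Fin 4 → ℝ) × (Fin 2 → ℝ) × ℝ × ℝ

/-- The projection `dR`. -/
def dR : Phase →L[ℝ] (Fin 4 → ℝ) := ContinuousLinearMap.fst ℝ _ _

/-- The projection `dθ`. -/
def dθ : Phase →L[ℝ] ℝ :=
  (ContinuousLinearMap.snd ℝ ℝ ℝ).comp
    ((ContinuousLinearMap.snd ℝ (Fin 2 → ℝ) (ℝ × ℝ)).comp
      (ContinuousLinearMap.snd ℝ (Fin 4 → ℝ) ((Fin 2 → ℝ) × ℝ × ℝ)))

/-- A four-potential of the local background field, `A₀ = -½ F₀ · R`, so that `dA₀ = F₀`. -/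
def A₀ (R : Fin 4 → ℝ) : Fin 4 → ℝ := -(1 / 2 : ℝ) • (L.F₀ *ᵥ R)

/-- Perpendicular unit vector `â = ê₂ cos θ - ê₃ sin θ`. -/
def aHat (θ : ℝ) : Fin 4 → ℝ := Real.cos θ • L.tet 2 - Real.sin θ • L.tet 3

/-- The guiding-center system
`γ_gc = (e/(εc) A₀ + m U) · dR + ε μ dθ`, `H_gc = (m/2) U² + μ Ω_B`,
on the part of phase space where `μ Ω_B > 0` (`w > 0`) and where neither the wave nor its second
harmonic resonates with the unperturbed motion; with `n = 2ℓ` the condition says `D_ℓ ≠ 0`. -/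
def system : PhaseSystem Phase where
  M := {z | 0 < z.2.2.1 * L.Omega ∧ ∀ n : ℤ, 2 * mdot L.k (L.U z.2.1) + n * L.Omega ≠ 0}
  γ := fun z =>
    (covR ((L.e / (L.ε * L.c)) • L.A₀ z.1 + L.m • L.U z.2.1)).comp dR
      + (L.ε * z.2.2.1) • dθ
  H := fun z => L.m / 2 * mdot (L.U z.2.1) (L.U z.2.1) + z.2.2.1 * L.Omega
  vel := fun z => (L.U z.2.1, 0, 0, L.Omega / L.ε)
  flow := fun t z => (z.1 + t • L.U z.2.1, z.2.1, z.2.2.1, z.2.2.2 + t * (L.Omega / L.ε))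

/-- The particle position `r = R + ε ρ â`. -/
def position (z : Phase) : Fin 4 → ℝ := z.1 + (L.ε * L.rho z.2.2.1) • L.aHat z.2.2.2

/-- The wave perturbation `(e/c) Ã · dr exp(i ψ(r)/ε) + c.c.`, `ψ(r) = k · r`, in guiding-center
coordinates. -/
def γw (z : Phase) : Phase →L[ℝ] ℝ :=
  Complex.reCLM.comp
    ((2 * (L.e / L.c) * Complex.exp (Complex.I * mdot L.k (L.position z) / L.ε) : ℂ) •
      (covC L.A).comp (fderiv ℝ L.position z))

/-- The gauge function
`S_T = -(ε e/c) ρ â·Ã ((exp(i ρ â·k) - 1)/(i ρ â·k)) exp(i ψ(R)/ε) + c.c.` -/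
def S_T (z : Phase) : ℝ :=
  addCC (-(L.ε * L.e / L.c) * L.rho z.2.2.1 * cdot (toC (L.aHat z.2.2.2)) L.A
    * expQuot (L.rho z.2.2.1 * mdot (L.aHat z.2.2.2) L.k)
    * Complex.exp (Complex.I * mdot L.k z.1 / L.ε))

/-- `exp(i Ψ_ℓ / ε)`, where `Ψ_ℓ = ψ(R) + ε ℓ (θ - α)`. -/
def expΨ (ℓ : ℤ) (z : Phase) : ℂ :=
  Complex.exp (Complex.I * ((mdot L.k z.1 + L.ε * ℓ * (z.2.2.2 - L.α) : ℝ) : ℂ) / L.ε)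

end LocalWave

end OscCenter

end

/-! Transform. Cartan's formula L_g γ = i_g dγ + d(i_g γ) splits every Lie derivative of a one-form
into an interior product and an exact part. The exact parts cancel against the gauge functions, and
Γ₁ = Γ₂ = 0 become two linear equations for g₁ and g₂, solvable pointwise because ω_gc is
nonsingular (`form1_iff`, `form2_iff`). Contracting them with ż and using i₀ω_gc = -dH_gc turns K₁ =
0 into Ṡ₁ = -i₀γ_w and gives K₂ = ½i₀i₁ω_w - Ṡ₂ (`isLieTransform_iff`). The orbit derivative of a
function bounded along orbits averages to zero, so an averaged K₂ can only be ⟨½i₀i₁ω_w⟩.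

Gauge. The equations see γ_w only through γ_w + dS₁ and through ω_w, so a shift by dS_T is undone by
S₁ - S_T. Uniqueness rests on one remark: two oscillatory functions with the same orbit derivative
differ by a function that is constant along orbits and has average zero, hence they agree.

Explicit forms. In tetrad components the summands of (A), (B) and (C) have the same resonant part;
they differ by terms without the denominator D_ℓ (`K2TermF_eq_add`, `K2TermC_eq_add`). Those terms
are summed with Neumann's identity Σ J_{ℓ+a} J_{ℓ+b} = δ_{ab}, which is Parseval's identity for the
unimodular generating function exp(ix sin ξ), and they produce exactly the nonresonant terms outside
the series.

Guiding center. The wave is the real part of a function that one gyroperiod of unperturbed motion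
multiplies by a number of modulus one. Equations along the orbits are therefore inverted by an
integral over a single gyroperiod, divided by (that number - 1), which nonresonance keeps away from
zero. The scalar ½i₀i₁ω_w splits into harmonics of order 0 and 2. Only the first has an average, its
gyrophase mean. In Fourier space the orbit derivative is multiplication by iD_ℓ/ε, so Parseval's
identity turns this mean into the series (B) term by term (`pairing_hat_re`), and (B) was shown to
equal (A) (`mean_F0`). -/

noncomputable section

namespace OscCenter

/-! ### Cartan calculus, the Lie transform and averages along orbits. -/

section Abstract

variable {E : Type*} [NormedAddCommGroup E] [NormedSpace ℝ E]

lemma dForm_apply (γ : E → (E →L[ℝ] ℝ)) (z u v : E) :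
    dForm γ z u v = fderiv ℝ γ z u v - fderiv ℝ γ z v u := rfl

lemma dForm_self (γ : E → (E →L[ℝ] ℝ)) (z u : E) : dForm γ z u u = 0 := by
  simp [dForm_apply]

lemma dForm_swap (γ : E → (E →L[ℝ] ℝ)) (z u v : E) : dForm γ z u v = -dForm γ z v u := by
  simp [dForm_apply]

lemma dForm_congr {γ γ' : E → (E →L[ℝ] ℝ)} {z : E} (h : γ =ᶠ[𝓝 z] γ') :
    dForm γ z = dForm γ' z := by
  simp only [dForm, h.fderiv_eq]

lemma dForm_add {γ γ' : E → (E →L[ℝ] ℝ)} {z u : E} (h : DifferentiableAt ℝ γ z)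
    (h' : DifferentiableAt ℝ γ' z) :
    dForm (fun y => γ y + γ' y) z u = dForm γ z u + dForm γ' z u := by
  ext v
  simp only [dForm_apply, _root_.add_apply, fderiv_fun_add h h']
  ring

/-- d ∘ d = 0, that is, symmetry of the second derivative. -/
lemma dForm_fderiv {f : E → ℝ} {z u : E} (hf : ContDiffAt ℝ ∞ f z) :
    dForm (fderiv ℝ f) z u = 0 := by
  ext v
  have h := hf.isSymmSndFDerivAt (by simpa using ENat.LEInfty.out)
  simpa [dForm_apply, sub_eq_zero] using h u v

lemma hasFDerivAt_intForm {γ : E → (E →L[ℝ] ℝ)} {g : E → E} {z : E}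
    (hγ : DifferentiableAt ℝ γ z) (hg : DifferentiableAt ℝ g z) :
    HasFDerivAt (intForm g γ) ((γ z).comp (fderiv ℝ g z) + (fderiv ℝ γ z).flip (g z)) z :=
  hγ.hasFDerivAt.clm_apply hg.hasFDerivAt

/-- Cartan's formula for one-forms. -/
lemma lieForm_eq {γ : E → (E →L[ℝ] ℝ)} {g : E → E} {z : E}
    (hγ : DifferentiableAt ℝ γ z) (hg : DifferentiableAt ℝ g z) :
    lieForm g γ z = dForm γ z (g z) + fderiv ℝ (intForm g γ) z := by
  rw [(hasFDerivAt_intForm hγ hg).fderiv]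
  ext v
  simp [lieForm, dForm]

lemma contDiffOn_dForm {γ : E → (E →L[ℝ] ℝ)} {M : Set E} (hM : IsOpen M)
    (hγ : ContDiffOn ℝ ∞ γ M) : ContDiffOn ℝ ∞ (dForm γ) M := by
  have h : ContDiffOn ℝ ∞ (fderiv ℝ γ) M := hγ.fderiv_of_isOpen hM (by simp)
  have h' : ContDiff ℝ ∞ (fun A : E →L[ℝ] E →L[ℝ] ℝ => A.flip) :=
    ContinuousLinearMap.contDiff (𝕜 := ℝ) (E := E →L[ℝ] E →L[ℝ] ℝ) (F := E →L[ℝ] E →L[ℝ] ℝ)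
      (ContinuousLinearMap.flipₗᵢ ℝ E E ℝ).toContinuousLinearEquiv.toContinuousLinearMap
  exact h.sub (h'.comp_contDiffOn h)

lemma contDiffOn_fderiv {F : Type*} [NormedAddCommGroup F] [NormedSpace ℝ F] {f : E → F}
    {M : Set E} (hM : IsOpen M) (hf : ContDiffOn ℝ ∞ f M) : ContDiffOn ℝ ∞ (fderiv ℝ f) M :=
  hf.fderiv_of_isOpen hM (by simp)

lemma contDiffAt_of_mem {F : Type*} [NormedAddCommGroup F] [NormedSpace ℝ F] {f : E → F}
    {M : Set E} (hM : IsOpen M) (hf : ContDiffOn ℝ ∞ f M) {z : E} (hz : z ∈ M) :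
    ContDiffAt ℝ ∞ f z := hf.contDiffAt (hM.mem_nhds hz)

lemma differentiableAt_of_mem {F : Type*} [NormedAddCommGroup F] [NormedSpace ℝ F] {f : E → F}
    {M : Set E} (hM : IsOpen M) (hf : ContDiffOn ℝ ∞ f M) {z : E} (hz : z ∈ M) :
    DifferentiableAt ℝ f z := (contDiffAt_of_mem hM hf hz).differentiableAt (by simp)

lemma fderiv_eq_of_eqOn {F : Type*} [NormedAddCommGroup F] [NormedSpace ℝ F] {f g : E → F}
    {M : Set E} (hM : IsOpen M) (h : ∀ z ∈ M, f z = g z) {z : E} (hz : z ∈ M) :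
    fderiv ℝ f z = fderiv ℝ g z :=
  (Filter.eventuallyEq_of_mem (hM.mem_nhds hz) h).fderiv_eq

/-- A vector field solving a smooth, pointwise nonsingular linear equation is smooth. -/
lemma contDiffOn_of_bijective [CompleteSpace E] {F : Type*} [NormedAddCommGroup F]
    [NormedSpace ℝ F] [CompleteSpace F] {M : Set E} {w : E → (E →L[ℝ] F)} {g : E → E}
    {β : E → F} (hw : ContDiffOn ℝ ∞ w M) (hβ : ContDiffOn ℝ ∞ β M)
    (hbij : ∀ z ∈ M, Function.Bijective (w z)) (h : ∀ z ∈ M, w z (g z) = β z) :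
    ContDiffOn ℝ ∞ g M := by
  have key : ∀ z ∈ M, ∃ e : E ≃L[ℝ] F, (e : E →L[ℝ] F) = w z := fun z hz =>
    ⟨ContinuousLinearEquiv.ofBijective (w z) (LinearMap.ker_eq_bot.2 (hbij z hz).1)
      (LinearMap.range_eq_top.2 (hbij z hz).2), by ext; rfl⟩
  have h1 : ContDiffOn ℝ ∞ (fun z => ContinuousLinearMap.inverse (w z) (β z)) M := by
    refine ContDiffOn.clm_apply (fun z hz => ?_) hβ
    obtain ⟨e, he⟩ := key z hz
    have := contDiffAt_map_inverse (n := ∞) e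
    rw [he] at this
    exact this.comp_contDiffWithinAt z (hw z hz)
  refine h1.congr fun z hz => ?_
  obtain ⟨e, he⟩ := key z hz
  rw [← h z hz, ← he, ContinuousLinearMap.inverse_equiv]
  simp

namespace PhaseSystem

variable {P : PhaseSystem E}

lemma IsHamiltonian.dForm_vel (hP : P.IsHamiltonian) {z : E} (hz : z ∈ P.M) (v : E) :
    dForm P.γ z v (P.vel z) = fderiv ℝ P.H z v := by
  rw [dForm_swap, hP.hamilton z hz]; simp

lemma IsHamiltonian.smooth_vel [CompleteSpace E] (hP : P.IsHamiltonian) :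
    ContDiffOn ℝ ∞ P.vel P.M :=
  contDiffOn_of_bijective (contDiffOn_dForm hP.isOpen hP.smooth_γ)
    (contDiffOn_fderiv hP.isOpen hP.smooth_H).neg hP.nondegenerate hP.hamilton

/-- Cartan's formula writes L₁γ as i₁ω + d(i₁γ), and `gauge1` contains i₁γ precisely to cancel the
exact part. -/
lemma form1_iff (hP : P.IsHamiltonian) {γw : E → (E →L[ℝ] ℝ)} {g₁ : E → E} {S₁ : E → ℝ}
    (hg₁ : ContDiffOn ℝ ∞ g₁ P.M) (hS₁ : ContDiffOn ℝ ∞ S₁ P.M) {z : E} (hz : z ∈ P.M) :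
    lieOrder1 (lieForm g₁) P.γ γw z + fderiv ℝ (P.gauge1 g₁ S₁) z = 0 ↔
      dForm P.γ z (g₁ z) = γw z + fderiv ℝ S₁ z := by
  have hγ := differentiableAt_of_mem hP.isOpen hP.smooth_γ hz
  have hg := differentiableAt_of_mem hP.isOpen hg₁ hz
  have hS := differentiableAt_of_mem hP.isOpen hS₁ hz
  have h1 : fderiv ℝ (P.gauge1 g₁ S₁) z = fderiv ℝ S₁ z + fderiv ℝ (intForm g₁ P.γ) z :=
    fderiv_fun_add hS (hasFDerivAt_intForm hγ hg).differentiableAt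
  rw [h1, lieOrder1, Pi.sub_apply, lieForm_eq hγ hg]
  constructor
  · intro h
    rw [← sub_eq_zero, ← neg_eq_zero, ← h]
    abel
  · intro h
    rw [h]
    abel

lemma contDiffOn_intForm {γ : E → (E →L[ℝ] ℝ)} {g : E → E} {M : Set E}
    (hγ : ContDiffOn ℝ ∞ γ M) (hg : ContDiffOn ℝ ∞ g M) : ContDiffOn ℝ ∞ (intForm g γ) M :=
  hγ.clm_apply hg

lemma contDiffOn_lieFun {f : E → ℝ} {g : E → E} {M : Set E} (hM : IsOpen M)
    (hf : ContDiffOn ℝ ∞ f M) (hg : ContDiffOn ℝ ∞ g M) : ContDiffOn ℝ ∞ (lieFun g f) M :=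
  (contDiffOn_fderiv hM hf).clm_apply hg

lemma contDiffOn_lieForm {γ : E → (E →L[ℝ] ℝ)} {g : E → E} {M : Set E} (hM : IsOpen M)
    (hγ : ContDiffOn ℝ ∞ γ M) (hg : ContDiffOn ℝ ∞ g M) : ContDiffOn ℝ ∞ (lieForm g γ) M :=
  ((contDiffOn_fderiv hM hγ).clm_apply hg).add (hγ.clm_comp (contDiffOn_fderiv hM hg))

/-- The square of the Lie derivative of the action form, when `i₁ ω = γ_w + dS₁`. -/
lemma lieForm_lieForm (hP : P.IsHamiltonian) {γw : E → (E →L[ℝ] ℝ)}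
    (hγw : ContDiffOn ℝ ∞ γw P.M) {g₁ : E → E} {S₁ : E → ℝ}
    (hg₁ : ContDiffOn ℝ ∞ g₁ P.M) (hS₁ : ContDiffOn ℝ ∞ S₁ P.M)
    (h : ∀ z ∈ P.M, dForm P.γ z (g₁ z) = γw z + fderiv ℝ S₁ z) {z : E} (hz : z ∈ P.M) :
    lieForm g₁ (lieForm g₁ P.γ) z
      = dForm γw z (g₁ z) + fderiv ℝ (lieFun g₁ (intForm g₁ P.γ)) z := by
  have hM := hP.isOpen
  set β := fun y => fderiv ℝ S₁ y + fderiv ℝ (intForm g₁ P.γ) y with hβ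
  have hi := contDiffOn_intForm hP.smooth_γ hg₁
  have hβs : ContDiffOn ℝ ∞ β P.M := (contDiffOn_fderiv hM hS₁).add (contDiffOn_fderiv hM hi)
  -- By Cartan's formula and the first-order equation, L₁γ is γ_w plus an exact form near z, so its
  -- exterior derivative is ω_w.
  have h1 : ∀ y ∈ P.M, lieForm g₁ P.γ y = γw y + β y := fun y hy => by
    rw [lieForm_eq (differentiableAt_of_mem hM hP.smooth_γ hy) (differentiableAt_of_mem hM hg₁ hy),
      h y hy, add_assoc]
  have hd := differentiableAt_of_mem hM (contDiffOn_lieForm hM hP.smooth_γ hg₁) hz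
  rw [lieForm_eq hd (differentiableAt_of_mem hM hg₁ hz),
    dForm_congr (Filter.eventuallyEq_of_mem (hM.mem_nhds hz) h1),
    dForm_add (differentiableAt_of_mem hM hγw hz) (differentiableAt_of_mem hM hβs hz), hβ,
    dForm_add (differentiableAt_of_mem hM (contDiffOn_fderiv hM hS₁) hz)
      (differentiableAt_of_mem hM (contDiffOn_fderiv hM hi) hz),
    dForm_fderiv (contDiffAt_of_mem hM hS₁ hz), dForm_fderiv (contDiffAt_of_mem hM hi hz)]
  rw [add_zero, add_zero]
  refine congrArg _ ?_
  refine fderiv_eq_of_eqOn hM (fun y hy => ?_) hz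
  -- Antisymmetry: i₁(γ_w + dS₁) = i₁i₁ω = 0, which leaves only i₁d(i₁γ) of i₁(L₁γ).
  have h2 := dForm_self P.γ y (g₁ y)
  rw [h y hy, _root_.add_apply] at h2
  simp only [intForm, lieFun, h1 y hy, hβ, _root_.add_apply, ← add_assoc, h2, zero_add]

/-- The coefficient -½ arises as -1 + ½: -L₁γ_w contributes -i₁ω_w, and ½L₁L₁γ contributes ½i₁ω_w by
`lieForm_lieForm`. The exact remainders are those collected in `gauge2`. -/
lemma form2_iff (hP : P.IsHamiltonian) {γw : E → (E →L[ℝ] ℝ)}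
    (hγw : ContDiffOn ℝ ∞ γw P.M) {g₁ g₂ : E → E} {S₁ S₂ : E → ℝ}
    (hg₁ : ContDiffOn ℝ ∞ g₁ P.M) (hg₂ : ContDiffOn ℝ ∞ g₂ P.M)
    (hS₁ : ContDiffOn ℝ ∞ S₁ P.M) (hS₂ : ContDiffOn ℝ ∞ S₂ P.M)
    (h : ∀ z ∈ P.M, dForm P.γ z (g₁ z) = γw z + fderiv ℝ S₁ z) {z : E} (hz : z ∈ P.M) :
    lieOrder2 (lieForm g₁) (lieForm g₂) P.γ γw 0 z + fderiv ℝ (P.gauge2 γw g₁ g₂ S₂) z = 0 ↔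
      dForm P.γ z (g₂ z) = -(1 / 2 : ℝ) • dForm γw z (g₁ z) + fderiv ℝ S₂ z := by
  have hM := hP.isOpen
  have hd : ∀ {F : Type _} [NormedAddCommGroup F] [NormedSpace ℝ F] {f : E → F},
      ContDiffOn ℝ ∞ f P.M → DifferentiableAt ℝ f z := fun hf => differentiableAt_of_mem hM hf hz
  have i1 := contDiffOn_intForm hP.smooth_γ hg₁
  have i2 := hd (contDiffOn_intForm hP.smooth_γ hg₂)
  have iw := hd (contDiffOn_intForm hγw hg₁)
  have l1 := hd (contDiffOn_lieFun hM i1 hg₁)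
  have hS := hd hS₂
  have e : fderiv ℝ (P.gauge2 γw g₁ g₂ S₂) z = fderiv ℝ S₂ z + fderiv ℝ (intForm g₂ P.γ) z
      + fderiv ℝ (intForm g₁ γw) z - (1 / 2 : ℝ) • fderiv ℝ (lieFun g₁ (intForm g₁ P.γ)) z :=
    (((hS.hasFDerivAt.add i2.hasFDerivAt).add iw.hasFDerivAt).sub
      (l1.hasFDerivAt.const_mul (1 / 2 : ℝ))).fderiv
  have dg1 := differentiableAt_of_mem hM hg₁ hz
  have dg2 := differentiableAt_of_mem hM hg₂ hz
  rw [e, lieOrder2]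
  simp only [Pi.sub_apply, Pi.add_apply, Pi.smul_apply, Pi.zero_apply]
  rw [lieForm_lieForm hP hγw hg₁ hS₁ h hz,
    lieForm_eq (differentiableAt_of_mem hM hP.smooth_γ hz) dg2,
    lieForm_eq (differentiableAt_of_mem hM hγw hz) dg1]
  rw [← sub_eq_zero (b := _ + fderiv ℝ S₂ z), ← neg_eq_zero (a := _ - _)]
  refine Eq.congr_left ?_
  module

/-- Hamilton's equation gives dH(g) = ω(g, ż), so the equations for i₁ω and i₂ω determine L₁H and
L₂H. Since K₁ = -L₁H vanishes on the open set M, so does L₁L₁H, and K₂ reduces to -L₂H. Smoothness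
of the generators comes for free from the nonsingularity of ω. -/
lemma isLieTransform_iff [CompleteSpace E] (hP : P.IsHamiltonian) {γw : E → (E →L[ℝ] ℝ)}
    (hγw : ContDiffOn ℝ ∞ γw P.M) {g₁ g₂ : E → E} {S₁ S₂ K₂ : E → ℝ} :
    P.IsLieTransform γw g₁ g₂ S₁ S₂ K₂ ↔
      ContDiffOn ℝ ∞ S₁ P.M ∧ ContDiffOn ℝ ∞ S₂ P.M ∧
      (∀ z ∈ P.M, dForm P.γ z (g₁ z) = γw z + fderiv ℝ S₁ z) ∧
      (∀ z ∈ P.M, dForm P.γ z (g₂ z) = -(1 / 2 : ℝ) • dForm γw z (g₁ z) + fderiv ℝ S₂ z) ∧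
      (∀ z ∈ P.M, P.dot S₁ z = -γw z (P.vel z)) ∧
      (∀ z ∈ P.M, K₂ z = P.halfI0I1 γw g₁ z - P.dot S₂ z) := by
  have hM := hP.isOpen
  have key1 : (∀ z ∈ P.M, dForm P.γ z (g₁ z) = γw z + fderiv ℝ S₁ z) → ∀ z ∈ P.M,
      (lieFun g₁ P.H z = γw z (P.vel z) + P.dot S₁ z) := fun h z hz => by
    rw [lieFun, ← hP.dForm_vel hz, h z hz]; rfl
  have key2 : (∀ z ∈ P.M, dForm P.γ z (g₂ z)
      = -(1 / 2 : ℝ) • dForm γw z (g₁ z) + fderiv ℝ S₂ z) → ∀ z ∈ P.M,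
      (lieFun g₂ P.H z = P.dot S₂ z - P.halfI0I1 γw g₁ z) := fun h z hz => by
    rw [lieFun, ← hP.dForm_vel hz, h z hz]
    simp [dot, halfI0I1]; ring
  have key3 : (∀ z ∈ P.M, lieFun g₁ P.H z = 0) → ∀ z ∈ P.M,
      lieFun g₁ (lieFun g₁ P.H) z = 0 := fun h z hz => by
    rw [lieFun, fderiv_eq_of_eqOn (g := fun _ => 0) hM h hz]; simp
  constructor
  · intro h
    have e1 : ∀ z ∈ P.M, dForm P.γ z (g₁ z) = γw z + fderiv ℝ S₁ z := fun z hz =>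
      (form1_iff hP h.smooth_g₁ h.smooth_S₁ hz).1 (h.form1 z hz)
    have e2 : ∀ z ∈ P.M, dForm P.γ z (g₂ z)
        = -(1 / 2 : ℝ) • dForm γw z (g₁ z) + fderiv ℝ S₂ z := fun z hz =>
      (form2_iff hP hγw h.smooth_g₁ h.smooth_g₂ h.smooth_S₁ h.smooth_S₂ e1 hz).1 (h.form2 z hz)
    have e3 : ∀ z ∈ P.M, lieFun g₁ P.H z = 0 := fun z hz => by
      simpa [lieOrder1] using h.ham1 z hz
    refine ⟨h.smooth_S₁, h.smooth_S₂, e1, e2, fun z hz => ?_, fun z hz => ?_⟩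
    · have := key1 e1 z hz
      rw [e3 z hz] at this
      linarith
    · have h0 : lieFun g₁ (0 : E → ℝ) = 0 := by
        funext y; simp [lieFun]
      rw [h.ham2 z hz, lieOrder2]
      simp only [Pi.sub_apply, Pi.add_apply, Pi.smul_apply, Pi.zero_apply, key3 e3 z hz,
        key2 e2 z hz, h0]
      simp
  · rintro ⟨hS₁, hS₂, e1, e2, e3, e4⟩
    have hω := contDiffOn_dForm hM hP.smooth_γ
    have hg₁ : ContDiffOn ℝ ∞ g₁ P.M := contDiffOn_of_bijective hω
      (hγw.add (contDiffOn_fderiv hM hS₁)) hP.nondegenerate e1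
    have hg₂ : ContDiffOn ℝ ∞ g₂ P.M := contDiffOn_of_bijective hω
      ((((contDiffOn_dForm hM hγw).clm_apply hg₁).const_smul (-(1 / 2 : ℝ))).add
        (contDiffOn_fderiv hM hS₂)) hP.nondegenerate e2
    have e5 : ∀ z ∈ P.M, lieFun g₁ P.H z = 0 := fun z hz => by
      rw [key1 e1 z hz, e3 z hz]; ring
    refine ⟨hg₁, hg₂, hS₁, hS₂, fun z hz => (form1_iff hP hg₁ hS₁ hz).2 (e1 z hz),
      fun z hz => (form2_iff hP hγw hg₁ hg₂ hS₁ hS₂ e1 hz).2 (e2 z hz), fun z hz => ?_,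
      fun z hz => ?_⟩
    · simpa [lieOrder1] using e5 z hz
    · have h0 : lieFun g₁ (0 : E → ℝ) = 0 := by
        funext y; simp [lieFun]
      rw [e4 z hz, lieOrder2]
      simp only [Pi.sub_apply, Pi.add_apply, Pi.smul_apply, Pi.zero_apply, key3 e5 z hz,
        key2 e2 z hz, h0]
      simp

lemma IsHamiltonian.continuous_orbit (hP : P.IsHamiltonian) {z : E} (hz : z ∈ P.M) :
    Continuous (fun t => P.flow t z) :=
  continuous_iff_continuousAt.2 fun t => (hP.flow_deriv z hz t).continuousAt

lemma IsHamiltonian.continuous_comp_orbit (hP : P.IsHamiltonian) {F : Type*}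
    [NormedAddCommGroup F] [NormedSpace ℝ F] {f : E → F} (hf : ContDiffOn ℝ ∞ f P.M) {z : E}
    (hz : z ∈ P.M) : Continuous (fun t => f (P.flow t z)) :=
  hf.continuousOn.comp_continuous (hP.continuous_orbit hz) fun t => hP.flow_mem z hz t

lemma IsHamiltonian.hasDerivAt_comp_orbit (hP : P.IsHamiltonian) {S : E → ℝ}
    (hS : ContDiffOn ℝ ∞ S P.M) {z : E} (hz : z ∈ P.M) (t : ℝ) :
    HasDerivAt (fun s => S (P.flow s z)) (P.dot S (P.flow t z)) t :=
  (differentiableAt_of_mem hP.isOpen hS (hP.flow_mem z hz t)).hasFDerivAt.comp_hasDerivAt t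
    (hP.flow_deriv z hz t)

lemma contDiffOn_dot [CompleteSpace E] (hP : P.IsHamiltonian) {S : E → ℝ}
    (hS : ContDiffOn ℝ ∞ S P.M) : ContDiffOn ℝ ∞ (P.dot S) P.M :=
  (contDiffOn_fderiv hP.isOpen hS).clm_apply hP.smooth_vel

lemma contDiffOn_halfI0I1 [CompleteSpace E] (hP : P.IsHamiltonian) {γw : E → (E →L[ℝ] ℝ)}
    (hγw : ContDiffOn ℝ ∞ γw P.M) {g₁ : E → E} (hg₁ : ContDiffOn ℝ ∞ g₁ P.M) :
    ContDiffOn ℝ ∞ (P.halfI0I1 γw g₁) P.M :=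
  contDiffOn_const.mul
    (((contDiffOn_dForm hP.isOpen hγw).clm_apply hg₁).clm_apply hP.smooth_vel)

/-- The derivative along the orbits of a bounded function has zero average. -/
lemma hasOrbitAverage_dot [CompleteSpace E] (hP : P.IsHamiltonian) {S : E → ℝ}
    (hS : ContDiffOn ℝ ∞ S P.M) {z : E} (hz : z ∈ P.M)
    (hb : ∃ C, ∀ t, |S (P.flow t z)| ≤ C) : P.HasOrbitAverage (P.dot S) z 0 := by
  obtain ⟨C, hC⟩ := hb
  have h1 : ∀ T : ℝ, ∫ t in (0 : ℝ)..T, P.dot S (P.flow t z)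
      = S (P.flow T z) - S (P.flow 0 z) := fun T =>
    intervalIntegral.integral_eq_sub_of_hasDerivAt
      (fun t _ => hP.hasDerivAt_comp_orbit hS hz t)
      ((hP.continuous_comp_orbit (contDiffOn_dot hP hS) hz).intervalIntegrable _ _)
  simp only [HasOrbitAverage, h1]
  refine tendsto_inv_atTop_zero.zero_smul_isBoundedUnder_le ?_
  refine isBoundedUnder_of ⟨C + C, fun T => ?_⟩
  exact (norm_sub_le _ _).trans (add_le_add (hC T) (hC 0))

lemma HasOrbitAverage.add {F : Type*} [NormedAddCommGroup F] [NormedSpace ℝ F] {f g : E → F}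
    {z : E} {a b : F} (hf : P.HasOrbitAverage f z a) (hg : P.HasOrbitAverage g z b)
    (hfc : Continuous fun t => f (P.flow t z)) (hgc : Continuous fun t => g (P.flow t z)) :
    P.HasOrbitAverage (fun y => f y + g y) z (a + b) := by
  refine (Tendsto.add hf hg).congr fun T => ?_
  rw [intervalIntegral.integral_add (hfc.intervalIntegrable _ _) (hgc.intervalIntegrable _ _),
    smul_add]

lemma HasOrbitAverage.neg {F : Type*} [NormedAddCommGroup F] [NormedSpace ℝ F] {f : E → F}
    {z : E} {a : F} (hf : P.HasOrbitAverage f z a) :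
    P.HasOrbitAverage (fun y => -f y) z (-a) := by
  refine (Tendsto.neg hf).congr fun T => ?_
  rw [intervalIntegral.integral_neg, smul_neg]

lemma HasOrbitAverage.congr (hP : P.IsHamiltonian) {F : Type*} [NormedAddCommGroup F]
    [NormedSpace ℝ F] {f g : E → F} {z : E} (hz : z ∈ P.M) {a : F}
    (hf : P.HasOrbitAverage f z a) (h : ∀ y ∈ P.M, f y = g y) : P.HasOrbitAverage g z a := by
  refine Tendsto.congr (fun T => ?_) hf
  congr 2
  funext t
  exact h _ (hP.flow_mem z hz t)

lemma IsOscillatory.sub (hP : P.IsHamiltonian) {S T : E → ℝ} (hS : P.IsOscillatory S)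
    (hT : P.IsOscillatory T) (hSs : ContDiffOn ℝ ∞ S P.M) (hTs : ContDiffOn ℝ ∞ T P.M) :
    P.IsOscillatory (S - T) := by
  intro z hz
  obtain ⟨⟨C, hC⟩, h1⟩ := hS z hz
  obtain ⟨⟨C', hC'⟩, h2⟩ := hT z hz
  refine ⟨⟨C + C', fun t => (abs_sub _ _).trans (add_le_add (hC t) (hC' t))⟩, ?_⟩
  have h := h1.add h2.neg (hP.continuous_comp_orbit hSs hz)
    (hP.continuous_comp_orbit hTs hz).neg
  rw [neg_zero, add_zero] at h
  exact h.congr hP hz fun y _ => (sub_eq_add_neg _ _).symm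

/-- Oscillatory functions with the same derivative along the orbits are equal. -/
lemma IsOscillatory.eq_of_dot_eq (hP : P.IsHamiltonian) {S T : E → ℝ}
    (hS : P.IsOscillatory S) (hT : P.IsOscillatory T) (hSs : ContDiffOn ℝ ∞ S P.M)
    (hTs : ContDiffOn ℝ ∞ T P.M) (h : ∀ z ∈ P.M, P.dot S z = P.dot T z) {z : E}
    (hz : z ∈ P.M) : S z = T z := by
  have h1 := (hS.sub hP hT hSs hTs z hz).2
  -- The difference is constant along each orbit, so its orbit average is its own value; that
  -- average is 0.
  have h2 : ∀ t, (S - T) (P.flow t z) = S z - T z := fun t => by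
    have hd : ∀ s, HasDerivAt (fun s => (S - T) (P.flow s z)) 0 s := fun s => by
      have := (hP.hasDerivAt_comp_orbit hSs hz s).sub (hP.hasDerivAt_comp_orbit hTs hz s)
      rwa [h _ (hP.flow_mem z hz s), sub_self] at this
    have := is_const_of_deriv_eq_zero (fun s => (hd s).differentiableAt)
      (fun s => (hd s).deriv) t 0
    simpa [hP.flow_zero z hz] using this
  simp only [HasOrbitAverage, h2, intervalIntegral.integral_const, sub_zero] at h1
  have h3 : Tendsto (fun T' : ℝ => T'⁻¹ • T' • (S z - T z)) atTop (𝓝 (S z - T z)) := by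
    refine tendsto_const_nhds.congr' ?_
    filter_upwards [eventually_gt_atTop 0] with t ht
    rw [smul_smul, inv_mul_cancel₀ ht.ne', one_smul]
  exact sub_eq_zero.1 (tendsto_nhds_unique h3 h1)

/-- Averaging K₂ + Ṡ₂ = ½i₀i₁ω_w: the first term is its own average, and the second averages to zero
because S₂ is bounded along orbits. -/
lemma isOscillationCenterTransform_spec [CompleteSpace E] (hP : P.IsHamiltonian)
    {γw : E → (E →L[ℝ] ℝ)} (hγw : ContDiffOn ℝ ∞ γw P.M) {g₁ g₂ : E → E} {S₁ S₂ K₂ : E → ℝ}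
    (h : P.IsOscillationCenterTransform γw g₁ g₂ S₁ S₂ K₂) {z : E} (hz : z ∈ P.M) :
    dForm P.γ z (g₁ z) = γw z + fderiv ℝ S₁ z ∧
    dForm P.γ z (g₂ z) = -(1 / 2 : ℝ) • dForm γw z (g₁ z) + fderiv ℝ S₂ z ∧
    P.dot S₁ z = -γw z (P.vel z) ∧
    K₂ z = P.halfI0I1 γw g₁ z - P.dot S₂ z ∧
    P.HasOrbitAverage (P.halfI0I1 γw g₁) z (K₂ z) := by
  obtain ⟨hS₁, hS₂, e1, e2, e3, e4⟩ := (isLieTransform_iff hP hγw).1 h.toIsLieTransform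
  refine ⟨e1 z hz, e2 z hz, e3 z hz, e4 z hz, ?_⟩
  have hh := hP.continuous_comp_orbit (contDiffOn_halfI0I1 hP hγw h.smooth_g₁) hz
  have hd := hP.continuous_comp_orbit (contDiffOn_dot hP hS₂) hz
  -- No regularity of K₂ is assumed; its continuity along the orbit is read off from the formula for
  -- K₂.
  have hK : Continuous fun t => K₂ (P.flow t z) :=
    (hh.sub hd).congr fun t => (e4 _ (hP.flow_mem z hz t)).symm
  have h1 := (h.averaged z hz).add (hasOrbitAverage_dot hP hS₂ hz (h.osc_S₂ z hz).1) hK hd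
  rw [add_zero] at h1
  exact h1.congr hP hz fun y hy => by rw [e4 y hy]; ring

/-- Nonsingularity of ω supplies g₂ point by point. That K₂ is its own average follows from K₂ =
½i₀i₁ω_w - Ṡ₂, whose last term averages to zero. -/
lemma exists_isOscillationCenterTransform [CompleteSpace E] (hP : P.IsHamiltonian)
    {γw : E → (E →L[ℝ] ℝ)} (hγw : ContDiffOn ℝ ∞ γw P.M) {g₁ : E → E} {S₁ S₂ K₂ : E → ℝ}
    (hS₁ : ContDiffOn ℝ ∞ S₁ P.M) (hS₂ : ContDiffOn ℝ ∞ S₂ P.M)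
    (o₁ : P.IsOscillatory S₁) (o₂ : P.IsOscillatory S₂)
    (e3 : ∀ z ∈ P.M, P.dot S₁ z = -γw z (P.vel z))
    (e1 : ∀ z ∈ P.M, dForm P.γ z (g₁ z) = γw z + fderiv ℝ S₁ z)
    (ha : ∀ z ∈ P.M, P.HasOrbitAverage (P.halfI0I1 γw g₁) z (K₂ z))
    (e4 : ∀ z ∈ P.M, P.dot S₂ z = P.halfI0I1 γw g₁ z - K₂ z) :
    ∃ g₂ : E → E, P.IsOscillationCenterTransform γw g₁ g₂ S₁ S₂ K₂ := by
  classical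
  have hex : ∀ z, ∃ v, z ∈ P.M →
      dForm P.γ z v = -(1 / 2 : ℝ) • dForm γw z (g₁ z) + fderiv ℝ S₂ z := fun z => by
    by_cases hz : z ∈ P.M
    · obtain ⟨v, hv⟩ := (hP.nondegenerate z hz).2
        (-(1 / 2 : ℝ) • dForm γw z (g₁ z) + fderiv ℝ S₂ z)
      exact ⟨v, fun _ => hv⟩
    -- Off M the value of g₂ is irrelevant.
    · exact ⟨0, fun h => absurd h hz⟩
  choose g₂ hg₂ using hex
  have hl : P.IsLieTransform γw g₁ g₂ S₁ S₂ K₂ := (isLieTransform_iff hP hγw).2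
    ⟨hS₁, hS₂, e1, hg₂, e3, fun z hz => by rw [e4 z hz]; ring⟩
  refine ⟨g₂, hl, o₁, o₂, fun z hz => ?_⟩
  have hh := hP.continuous_comp_orbit (contDiffOn_halfI0I1 hP hγw hl.smooth_g₁) hz
  have hd := hP.continuous_comp_orbit (contDiffOn_dot hP hS₂) hz
  have h1 := (ha z hz).add (hasOrbitAverage_dot hP hS₂ hz (o₂ z hz).1).neg hh hd.neg
  rw [neg_zero, add_zero] at h1
  exact h1.congr hP hz fun y hy => by rw [e4 y hy]; ring

/-! ### Gauge invariance and uniqueness of the transform. -/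

section Gauge

variable {γw : E → (E →L[ℝ] ℝ)} {S_T : E → ℝ}

lemma contDiffOn_gaugeShift (hP : P.IsHamiltonian) (hγw : ContDiffOn ℝ ∞ γw P.M)
    (hS : ContDiffOn ℝ ∞ S_T P.M) : ContDiffOn ℝ ∞ (gaugeShift γw S_T) P.M :=
  hγw.add (contDiffOn_fderiv hP.isOpen hS)

lemma dForm_gaugeShift (hP : P.IsHamiltonian) (hγw : ContDiffOn ℝ ∞ γw P.M)
    (hS : ContDiffOn ℝ ∞ S_T P.M) {z : E} (hz : z ∈ P.M) (u : E) :
    dForm (gaugeShift γw S_T) z u = dForm γw z u := by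
  have h := dForm_add (u := u) (differentiableAt_of_mem hP.isOpen hγw hz)
    (differentiableAt_of_mem hP.isOpen (contDiffOn_fderiv hP.isOpen hS) hz)
  rw [dForm_fderiv (contDiffAt_of_mem hP.isOpen hS hz), add_zero] at h
  exact h

lemma halfI0I1_gaugeShift (hP : P.IsHamiltonian) (hγw : ContDiffOn ℝ ∞ γw P.M)
    (hS : ContDiffOn ℝ ∞ S_T P.M) {z : E} (hz : z ∈ P.M) (g₁ : E → E) :
    P.halfI0I1 (gaugeShift γw S_T) g₁ z = P.halfI0I1 γw g₁ z := by
  rw [halfI0I1, dForm_gaugeShift hP hγw hS hz, halfI0I1]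

/-- In the characterisation `isLieTransform_iff`, γ_w occurs through γ_w + dS₁, which is unchanged,
through i₀γ_w + Ṡ₁, also unchanged, and through ω_w, which does not see dS_T. -/
lemma isLieTransform_gaugeShift_iff [CompleteSpace E] (hP : P.IsHamiltonian)
    (hγw : ContDiffOn ℝ ∞ γw P.M) (hS : ContDiffOn ℝ ∞ S_T P.M) {g₁ g₂ : E → E}
    {S₁ S₂ K₂ : E → ℝ} :
    P.IsLieTransform γw g₁ g₂ S₁ S₂ K₂ ↔
      P.IsLieTransform (gaugeShift γw S_T) g₁ g₂ (S₁ - S_T) S₂ K₂ := by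
  rw [isLieTransform_iff hP hγw, isLieTransform_iff hP (contDiffOn_gaugeShift hP hγw hS)]
  have hc : ContDiffOn ℝ ∞ S₁ P.M ↔ ContDiffOn ℝ ∞ (S₁ - S_T) P.M :=
    ⟨fun h => h.sub hS, fun h => by simpa using h.add hS⟩
  rw [← hc]
  refine and_congr_right fun hS₁ => and_congr_right fun _ => ?_
  have hf : ∀ z ∈ P.M, fderiv ℝ (S₁ - S_T) z = fderiv ℝ S₁ z - fderiv ℝ S_T z := fun z hz =>
    fderiv_sub (differentiableAt_of_mem hP.isOpen hS₁ hz) (differentiableAt_of_mem hP.isOpen hS hz)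
  refine and_congr (forall₂_congr fun z hz => ?_) (and_congr (forall₂_congr fun z hz => ?_)
    (and_congr (forall₂_congr fun z hz => ?_) (forall₂_congr fun z hz => ?_)))
  · rw [hf z hz, gaugeShift]
    refine Eq.congr_right ?_
    abel
  · rw [dForm_gaugeShift hP hγw hS hz]
  · simp only [dot, hf z hz, gaugeShift, _root_.sub_apply, _root_.add_apply]
    constructor <;> intro h <;> linarith
  · rw [halfI0I1_gaugeShift hP hγw hS hz]

lemma IsOscillationCenterTransform.gaugeShift [CompleteSpace E] (hP : P.IsHamiltonian)
    (hγw : ContDiffOn ℝ ∞ γw P.M) (hS : ContDiffOn ℝ ∞ S_T P.M) (ho : P.IsOscillatory S_T)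
    {g₁ g₂ : E → E} {S₁ S₂ K₂ : E → ℝ}
    (h : P.IsOscillationCenterTransform γw g₁ g₂ S₁ S₂ K₂) :
    P.IsOscillationCenterTransform (gaugeShift γw S_T) g₁ g₂ (S₁ - S_T) S₂ K₂ :=
  ⟨(isLieTransform_gaugeShift_iff hP hγw hS).1 h.toIsLieTransform,
    h.osc_S₁.sub hP ho h.smooth_S₁ hS, h.osc_S₂, h.averaged⟩

/-- The oscillation-center transform is unique. -/
lemma IsOscillationCenterTransform.unique [CompleteSpace E] (hP : P.IsHamiltonian)
    (hγw : ContDiffOn ℝ ∞ γw P.M) {g₁ g₂ g₁' g₂' : E → E} {S₁ S₂ K₂ S₁' S₂' K₂' : E → ℝ}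
    (h : P.IsOscillationCenterTransform γw g₁ g₂ S₁ S₂ K₂)
    (h' : P.IsOscillationCenterTransform γw g₁' g₂' S₁' S₂' K₂') :
    ∀ z ∈ P.M, S₁' z = S₁ z ∧ g₁' z = g₁ z ∧ S₂' z = S₂ z ∧ g₂' z = g₂ z ∧ K₂' z = K₂ z := by
  have s := fun z (hz : z ∈ P.M) => isOscillationCenterTransform_spec hP hγw h hz
  have s' := fun z (hz : z ∈ P.M) => isOscillationCenterTransform_spec hP hγw h' hz
  -- Everything is determined in turn: Ṡ₁ fixes S₁, then g₁ by injectivity of ω, then K₂ as an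
  -- average, then Ṡ₂ and S₂, and finally g₂.
  have a1 : ∀ z ∈ P.M, S₁' z = S₁ z := fun z hz =>
    h'.osc_S₁.eq_of_dot_eq hP h.osc_S₁ h'.smooth_S₁ h.smooth_S₁
      (fun y hy => by rw [(s y hy).2.2.1, (s' y hy).2.2.1]) hz
  have a2 : ∀ z ∈ P.M, g₁' z = g₁ z := fun z hz => (hP.nondegenerate z hz).1 (by
    rw [(s z hz).1, (s' z hz).1, fderiv_eq_of_eqOn hP.isOpen a1 hz])
  have a3 : ∀ z ∈ P.M, P.halfI0I1 γw g₁' z = P.halfI0I1 γw g₁ z := fun z hz => by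
    rw [halfI0I1, a2 z hz, halfI0I1]
  have a4 : ∀ z ∈ P.M, K₂' z = K₂ z := fun z hz =>
    tendsto_nhds_unique ((s' z hz).2.2.2.2.congr hP hz a3) (s z hz).2.2.2.2
  have a5 : ∀ z ∈ P.M, S₂' z = S₂ z := fun z hz =>
    h'.osc_S₂.eq_of_dot_eq hP h.osc_S₂ h'.smooth_S₂ h.smooth_S₂ (fun y hy => by
      linarith [(s y hy).2.2.2.1, (s' y hy).2.2.2.1, a3 y hy, a4 y hy]) hz
  refine fun z hz => ⟨a1 z hz, a2 z hz, a5 z hz, (hP.nondegenerate z hz).1 ?_, a4 z hz⟩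
  rw [(s z hz).2.1, (s' z hz).2.1, fderiv_eq_of_eqOn hP.isOpen a5 hz, a2 z hz]

/-- Two explicit expressions for K₂ are only known to agree on M, so they are exchanged by this
lemma and not by rewriting functions. -/
lemma IsOscillationCenterTransform.congr_K₂ (hP : P.IsHamiltonian) {g₁ g₂ : E → E}
    {S₁ S₂ K₂ K₂' : E → ℝ} (h : P.IsOscillationCenterTransform γw g₁ g₂ S₁ S₂ K₂)
    (hK : ∀ z ∈ P.M, K₂ z = K₂' z) :
    P.IsOscillationCenterTransform γw g₁ g₂ S₁ S₂ K₂' :=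
  { h with
    ham2 := fun z hz => by rw [← hK z hz]; exact h.ham2 z hz
    averaged := fun z hz => by
      rw [← hK z hz]; exact (h.averaged z hz).congr hP hz hK }

end Gauge

end PhaseSystem
end Abstract
end OscCenter
end

/-! ### Fourier coefficients and Parseval's identity. -/

noncomputable section

namespace OscCenter

open Complex MeasureTheory
open scoped Real

section Fourier

/-- The Fourier coefficients of a function on `[0, 2π]`. -/
def fourierC (f : ℝ → ℂ) (ℓ : ℤ) : ℂ :=
  (1 / (2 * Real.pi) : ℂ) * ∫ ξ in (0 : ℝ)..(2 * Real.pi), f ξ * exp (-(I * ℓ * ξ))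

lemma continuous_expC (ℓ : ℤ) : Continuous fun ξ : ℝ => exp (-(I * ℓ * ξ)) := by fun_prop

lemma fourierC_add {f g : ℝ → ℂ} (hf : Continuous f) (hg : Continuous g) (ℓ : ℤ) :
    fourierC (fun ξ => f ξ + g ξ) ℓ = fourierC f ℓ + fourierC g ℓ := by
  simp only [fourierC, add_mul]
  rw [intervalIntegral.integral_add, mul_add]
  · exact (hf.mul (continuous_expC ℓ)).intervalIntegrable _ _
  · exact (hg.mul (continuous_expC ℓ)).intervalIntegrable _ _

lemma fourierC_const_mul (c : ℂ) (f : ℝ → ℂ) (ℓ : ℤ) :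
    fourierC (fun ξ => c * f ξ) ℓ = c * fourierC f ℓ := by
  simp only [fourierC, mul_assoc, intervalIntegral.integral_const_mul]
  ring

lemma fourierC_mul_exp (f : ℝ → ℂ) (a ℓ : ℤ) :
    fourierC (fun ξ => f ξ * exp (I * a * ξ)) ℓ = fourierC f (ℓ - a) := by
  simp only [fourierC, mul_assoc, ← exp_add]
  congr! 5
  push_cast; ring

lemma exp_int_two_pi (ℓ : ℤ) : exp (-(I * ℓ * ((2 * Real.pi : ℝ) : ℂ))) = 1 := by
  rw [exp_neg, inv_eq_one, exp_eq_one_iff]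
  exact ⟨ℓ, by push_cast; ring⟩

/-- Integration by parts for periodic functions. -/
lemma fourierC_deriv {f f' : ℝ → ℂ} (hf : ∀ ξ, HasDerivAt f (f' ξ) ξ) (hf' : Continuous f')
    (hp : f (2 * Real.pi) = f 0) (ℓ : ℤ) : fourierC f' ℓ = I * ℓ * fourierC f ℓ := by
  have hfc : Continuous f := continuous_iff_continuousAt.2 fun ξ => (hf ξ).continuousAt
  have he : ∀ ξ : ℝ, HasDerivAt (fun ξ : ℝ => exp (-(I * ℓ * ξ)))
      (exp (-(I * ℓ * ξ)) * -(I * ℓ)) ξ := fun ξ => by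
    have h1 : HasDerivAt (fun ξ : ℝ => -(I * ℓ * (ξ : ℂ))) (-(I * ℓ)) ξ := by
      have h := ((hasDerivAt_id ξ).ofReal_comp.const_mul (-(I * (ℓ : ℂ))))
      simpa only [id, ofReal_one, mul_one, neg_mul] using h
    exact h1.cexp
  have h := intervalIntegral.integral_eq_sub_of_hasDerivAt (a := 0) (b := 2 * Real.pi)
    (fun ξ _ => (hf ξ).mul (he ξ)) (Continuous.intervalIntegrable (by fun_prop) _ _)
  simp only [Pi.mul_apply] at h
  rw [exp_int_two_pi, hp] at h
  have hi1 : IntervalIntegrable (fun ξ : ℝ => f' ξ * exp (-(I * ℓ * ξ))) volume 0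
      (2 * Real.pi) := Continuous.intervalIntegrable (by fun_prop) _ _
  have hi2 : IntervalIntegrable (fun ξ : ℝ => f ξ * (exp (-(I * ℓ * ξ)) * -(I * ℓ))) volume 0
      (2 * Real.pi) := Continuous.intervalIntegrable (by fun_prop) _ _
  rw [intervalIntegral.integral_add hi1 hi2] at h
  have h2 : ∫ ξ in (0 : ℝ)..(2 * Real.pi), f ξ * (exp (-(I * ℓ * ξ)) * -(I * ℓ))
      = -(I * ℓ) * ∫ ξ in (0 : ℝ)..(2 * Real.pi), f ξ * exp (-(I * ℓ * ξ)) := by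
    rw [← intervalIntegral.integral_const_mul]
    congr! 2; ring
  rw [h2] at h
  simp only [ofReal_zero, mul_zero, neg_zero, exp_zero, sub_self] at h
  simp only [fourierC]
  linear_combination (1 / (2 * Real.pi) : ℂ) * h

lemma fourierC_eq_fourierCoeffOn (f : ℝ → ℂ) (ℓ : ℤ) :
    fourierC f ℓ = fourierCoeffOn Real.two_pi_pos f ℓ := by
  rw [fourierCoeffOn_eq_integral, fourierC, sub_zero, real_smul]
  congr 1
  · push_cast; ring
  · refine intervalIntegral.integral_congr fun ξ _ => ?_
    simp only [smul_eq_mul]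
    rw [fourier_coe_apply, mul_comm]
    congr 2
    have : (Real.pi : ℂ) ≠ 0 := by exact_mod_cast Real.pi_ne_zero
    push_cast
    field_simp

lemma hasSum_normSq_fourierC {f : ℝ → ℂ} (hf : Continuous f) :
    HasSum (fun ℓ => ((normSq (fourierC f ℓ) : ℝ) : ℂ))
      ((1 / (2 * Real.pi) : ℂ) * ∫ ξ in (0 : ℝ)..(2 * Real.pi), ((normSq (f ξ) : ℝ) : ℂ)) := by
  have hL : MemLp f 2 (volume.restrict (Set.Ioc 0 (2 * Real.pi))) := by
    obtain ⟨C, hC⟩ := (isCompact_Icc (a := (0 : ℝ)) (b := 2 * Real.pi)).exists_bound_of_continuousOn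
      hf.continuousOn
    refine MemLp.of_bound hf.aestronglyMeasurable C ?_
    filter_upwards [ae_restrict_mem measurableSet_Ioc] with x hx
    exact hC x ⟨hx.1.le, hx.2⟩
  have h := hasSum_ofReal.2 (hasSum_sq_fourierCoeffOn Real.two_pi_pos hL)
  convert h using 1
  · funext ℓ
    rw [fourierC_eq_fourierCoeffOn, normSq_eq_norm_sq]
  · rw [intervalIntegral.integral_ofReal]
    simp [normSq_eq_norm_sq]

lemma polarization (a b : ℂ) : starRingEnd ℂ a * b =
    (1 / 4) * (normSq (a + b) - normSq (a + -1 * b))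
      + (I / 4) * (normSq (a + -I * b) - normSq (a + I * b)) := by
  apply Complex.ext <;> simp [normSq_apply] <;> ring

/-- Parseval's identity. -/
lemma hasSum_conj_mul_fourierC {f g : ℝ → ℂ} (hf : Continuous f) (hg : Continuous g) :
    HasSum (fun ℓ => starRingEnd ℂ (fourierC f ℓ) * fourierC g ℓ)
      ((1 / (2 * Real.pi) : ℂ) * ∫ ξ in (0 : ℝ)..(2 * Real.pi), starRingEnd ℂ (f ξ) * g ξ) := by
  have hc : ∀ c : ℂ, Continuous fun ξ => f ξ + c * g ξ := fun c => by fun_prop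
  have hs : ∀ (c : ℂ) (ℓ : ℤ), fourierC (fun ξ => f ξ + c * g ξ) ℓ
      = fourierC f ℓ + c * fourierC g ℓ := fun c ℓ => by
    rw [fourierC_add hf (hg.const_mul c), fourierC_const_mul]
  have hn : ∀ c : ℂ, IntervalIntegrable (fun ξ => ((normSq (f ξ + c * g ξ) : ℝ) : ℂ)) volume 0
      (2 * Real.pi) := fun c => by
    refine Continuous.intervalIntegrable ?_ _ _
    exact continuous_ofReal.comp (continuous_normSq.comp (hc c))
  have h := fun c => hasSum_normSq_fourierC (hc c)
  simp only [hs] at h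
  -- Polarization: the norm identity is used for f + cg with c = 1, -1, -i, i.
  have h1 := (((h 1).sub (h (-1))).mul_left (1 / 4)).add
    (((h (-I)).sub (h I)).mul_left (I / 4))
  refine (congrArg₂ (fun F S => HasSum F S) (funext fun ℓ => ?_) ?_).mpr h1
  · rw [polarization, one_mul]
  · have e : ∀ ξ, starRingEnd ℂ (f ξ) * g ξ = (1 / 4) * ((normSq (f ξ + 1 * g ξ) : ℂ)
        - normSq (f ξ + -1 * g ξ)) + (I / 4) * (normSq (f ξ + -I * g ξ) - normSq (f ξ + I * g ξ)) :=
      fun ξ => by rw [polarization, one_mul]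
    simp only [e]
    rw [intervalIntegral.integral_add, intervalIntegral.integral_const_mul,
      intervalIntegral.integral_const_mul, intervalIntegral.integral_sub (hn _) (hn _),
      intervalIntegral.integral_sub (hn _) (hn _)]
    · ring
    · exact ((hn _).sub (hn _)).const_mul _
    · exact ((hn _).sub (hn _)).const_mul _

end Fourier

/-! ### Bessel functions as Fourier coefficients of exp(ix sin ξ). -/

section Bessel

/-- The generating function `e^{ix sin ξ}` of the Bessel functions. -/
def besselGen (x ξ : ℝ) : ℂ := exp (I * x * Real.sin ξ)

lemma continuous_besselGen (x : ℝ) : Continuous (besselGen x) := by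
  unfold besselGen; fun_prop

lemma besselJ_eq_fourierC (ℓ : ℤ) (x : ℝ) : besselJ ℓ x = fourierC (besselGen x) ℓ := by
  simp only [besselJ, fourierC, besselGen, ← exp_add, sub_eq_add_neg]

lemma conj_intervalIntegral (f : ℝ → ℂ) (a b : ℝ) :
    ∫ x in a..b, starRingEnd ℂ (f x) = starRingEnd ℂ (∫ x in a..b, f x) := by
  simp only [intervalIntegral, integral_conj, map_sub]

/-- Conjugating the integrand amounts to ξ ↦ -ξ, and periodicity moves the interval back. Bessel
functions are kept complex-valued throughout, and this is what records that they are real. -/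
lemma conj_besselJ (ℓ : ℤ) (x : ℝ) : starRingEnd ℂ (besselJ ℓ x) = besselJ ℓ x := by
  have hper : Function.Periodic (fun ξ : ℝ => exp (I * x * Real.sin ξ - I * ℓ * ξ))
      (2 * Real.pi) := fun ξ => by
    have h := exp_int_two_pi ℓ
    simp only [Real.sin_add_two_pi]
    rw [← mul_one (exp (I * x * Real.sin ξ - I * ℓ * ξ)), ← h, ← exp_add]
    congr 1
    push_cast; ring
  have h1 : ∀ ξ : ℝ, starRingEnd ℂ (exp (I * x * Real.sin ξ - I * ℓ * ξ))
      = exp (I * x * Real.sin (-ξ) - I * ℓ * (-ξ : ℝ)) := fun ξ => by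
    rw [← exp_conj]
    congr 1
    simp only [map_sub, map_mul, conj_I, conj_ofReal, map_intCast, Real.sin_neg]
    push_cast; ring
  rw [besselJ, map_mul, ← conj_intervalIntegral]
  simp only [h1]
  rw [intervalIntegral.integral_comp_neg (fun ξ : ℝ => exp (I * x * Real.sin ξ - I * ℓ * ξ))]
  have h2 := hper.intervalIntegral_add_eq (-(2 * Real.pi)) 0
  rw [neg_add_cancel, zero_add] at h2
  rw [neg_zero, h2]
  congr 1
  simp [conj_ofReal, map_ofNat]

lemma cos_exp_add (ξ : ℝ) (f : ℂ) :
    (Real.cos ξ : ℂ) * f = (1 / 2) * (f * exp (I * (1 : ℤ) * ξ) + f * exp (I * (-1 : ℤ) * ξ)) := by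
  rw [ofReal_cos, Complex.cos]
  push_cast
  ring_nf

lemma sin_exp_sub (ξ : ℝ) (f : ℂ) :
    I * (Real.sin ξ : ℂ) * f
      = (1 / 2) * (f * exp (I * (1 : ℤ) * ξ) + (-1) * (f * exp (I * (-1 : ℤ) * ξ))) := by
  rw [ofReal_sin, Complex.sin]
  push_cast
  ring_nf
  rw [I_sq]
  ring

/-- Integration by parts: the generating function has derivative ix cos ξ times itself, and cos ξ
shifts the index by ±1. -/
lemma besselJ_recurrence (ℓ : ℤ) (x : ℝ) :
    x * (besselJ (ℓ - 1) x + besselJ (ℓ + 1) x) = 2 * ℓ * besselJ ℓ x := by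
  have hd : ∀ ξ : ℝ, HasDerivAt (besselGen x) ((I * x) * (Real.cos ξ * besselGen x ξ)) ξ :=
    fun ξ => by
      have h1 : HasDerivAt (fun ξ : ℝ => I * x * (Real.sin ξ : ℂ)) (I * x * Real.cos ξ) ξ :=
        (Real.hasDerivAt_sin ξ).ofReal_comp.const_mul (I * (x : ℂ))
      exact h1.cexp.congr_deriv (by rw [besselGen]; ring)
  have hc := continuous_besselGen x
  have h := fourierC_deriv hd (by fun_prop) (by simp [besselGen]) ℓ
  simp only [cos_exp_add] at h
  rw [fourierC_const_mul, fourierC_const_mul, fourierC_add (by fun_prop) (by fun_prop),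
    fourierC_mul_exp, fourierC_mul_exp, ← besselJ_eq_fourierC, ← besselJ_eq_fourierC,
    ← besselJ_eq_fourierC, sub_neg_eq_add] at h
  have h2 : I * (x * (besselJ (ℓ - 1) x + besselJ (ℓ + 1) x)) = I * (2 * ℓ * besselJ ℓ x) := by
    linear_combination 2 * h
  exact mul_left_cancel₀ I_ne_zero h2

/-- Differentiation under the integral brings down i sin ξ, which shifts the index by ±1; the
integrand's derivative is dominated by 1. -/
lemma hasDerivAt_besselJ (ℓ : ℤ) (x : ℝ) :
    HasDerivAt (besselJ ℓ) ((1 / 2) * (besselJ (ℓ - 1) x - besselJ (ℓ + 1) x)) x := by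
  have h := (intervalIntegral.hasDerivAt_integral_of_dominated_loc_of_deriv_le (μ := volume)
    (F := fun (y ξ : ℝ) => besselGen y ξ * exp (-(I * ℓ * ξ)))
    (F' := fun (y ξ : ℝ) => (I * Real.sin ξ * besselGen y ξ) * exp (-(I * ℓ * ξ)))
    (a := 0) (b := 2 * Real.pi) (x₀ := x) (s := Set.univ) (bound := fun _ => 1) univ_mem
    (Eventually.of_forall fun y => Continuous.aestronglyMeasurable
      ((continuous_besselGen y).mul (continuous_expC ℓ)))
    (((continuous_besselGen x).mul (continuous_expC ℓ)).intervalIntegrable _ _)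
    (Continuous.aestronglyMeasurable (by
      have := continuous_besselGen x
      fun_prop))
    (Eventually.of_forall fun ξ _ y _ => by
      have e1 : ‖besselGen y ξ‖ = 1 := by
        rw [besselGen, show I * (y : ℂ) * (Real.sin ξ : ℂ) = ((y * Real.sin ξ : ℝ) : ℂ) * I by
          push_cast; ring, norm_exp_ofReal_mul_I]
      have e2 : ‖exp (-(I * ℓ * ξ))‖ = 1 := by
        rw [show -(I * (ℓ : ℂ) * (ξ : ℂ)) = ((-(ℓ * ξ) : ℝ) : ℂ) * I by
          push_cast; ring, norm_exp_ofReal_mul_I]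
      rw [norm_mul, norm_mul, norm_mul, e1, e2, norm_I, one_mul, mul_one, mul_one, norm_real]
      exact Real.abs_sin_le_one ξ)
    (by simp)
    (Eventually.of_forall fun ξ _ y _ => by
      have h1 : HasDerivAt (fun y : ℝ => I * y * (Real.sin ξ : ℂ)) (I * Real.sin ξ) y := by
        simpa using ((hasDerivAt_id y).ofReal_comp.const_mul I).mul_const (Real.sin ξ : ℂ)
      exact (h1.cexp.mul_const (exp (-(I * ℓ * ξ)))).congr_deriv (by rw [besselGen]; ring))).2
  have h3 := h.const_mul (1 / (2 * Real.pi) : ℂ)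
  have h4 : (1 / (2 * Real.pi) : ℂ) * ∫ ξ in (0 : ℝ)..(2 * Real.pi),
      (I * Real.sin ξ * besselGen x ξ) * exp (-(I * ℓ * ξ))
      = (1 / 2) * (besselJ (ℓ - 1) x - besselJ (ℓ + 1) x) := by
    change fourierC (fun ξ => I * Real.sin ξ * besselGen x ξ) ℓ = _
    have hc := continuous_besselGen x
    simp only [sin_exp_sub]
    rw [fourierC_const_mul, fourierC_add (by fun_prop) (by fun_prop), fourierC_const_mul,
      fourierC_mul_exp, fourierC_mul_exp, ← besselJ_eq_fourierC, ← besselJ_eq_fourierC,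
      sub_neg_eq_add]
    ring
  rw [h4] at h3
  refine h3.congr_of_eventuallyEq (Eventually.of_forall fun y => ?_)
  exact besselJ_eq_fourierC ℓ y

/-- Neumann's addition theorem at equal arguments. -/
lemma hasSum_besselJ_mul (x : ℝ) (a b : ℤ) :
    HasSum (fun ℓ : ℤ => besselJ (ℓ + a) x * besselJ (ℓ + b) x) (if a = b then 1 else 0) := by
  have hc := continuous_besselGen x
  have h := hasSum_conj_mul_fourierC
    (f := fun ξ => besselGen x ξ * exp (I * (-a : ℤ) * ξ))
    (g := fun ξ => besselGen x ξ * exp (I * (-b : ℤ) * ξ)) (by fun_prop) (by fun_prop)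
  simp only [fourierC_mul_exp, ← besselJ_eq_fourierC, conj_besselJ, sub_neg_eq_add] at h
  convert h using 1
  -- The generating function has modulus one, so only the exponential that carries the index shifts
  -- survives.
  have e : ∀ ξ : ℝ, starRingEnd ℂ (besselGen x ξ * exp (I * (-a : ℤ) * ξ))
      * (besselGen x ξ * exp (I * (-b : ℤ) * ξ)) = exp ((I * (a - b : ℤ)) * ξ) := fun ξ => by
    rw [besselGen, map_mul, ← exp_conj, ← exp_conj, ← exp_add, ← exp_add, ← exp_add]
    congr 1
    simp only [map_mul, conj_I, conj_ofReal, map_intCast]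
    push_cast; ring
  simp only [e]
  have hpi : (Real.pi : ℂ) ≠ 0 := by exact_mod_cast Real.pi_ne_zero
  split_ifs with hab
  · subst hab
    simp only [sub_self, Int.cast_zero, mul_zero, zero_mul, exp_zero,
      intervalIntegral.integral_const, sub_zero, real_smul, mul_one]
    push_cast
    field_simp
  · have hne : I * ((a - b : ℤ) : ℂ) ≠ 0 :=
      mul_ne_zero I_ne_zero (by exact_mod_cast sub_ne_zero.2 hab)
    rw [integral_exp_mul_complex hne]
    have h1 : exp (I * ((a - b : ℤ) : ℂ) * ((2 * Real.pi : ℝ) : ℂ)) = 1 := by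
      have := exp_int_two_pi (a - b)
      rwa [exp_neg, inv_eq_one] at this
    rw [h1]
    simp

end Bessel

end OscCenter
end

/-! ### Minkowski algebra in the tetrad of the background field. -/

noncomputable section

namespace OscCenter

open Complex MeasureTheory
open scoped Real

section Minkowski

lemma cdot_add_left (a b v : Fin 4 → ℂ) : cdot (a + b) v = cdot a v + cdot b v := by
  simp only [cdot, Pi.add_apply, ← Finset.sum_add_distrib]
  exact Finset.sum_congr rfl fun i _ => by ring

lemma cdot_smul_left (c : ℂ) (a v : Fin 4 → ℂ) : cdot (c • a) v = c * cdot a v := by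
  simp only [cdot, Pi.smul_apply, smul_eq_mul, Finset.mul_sum]
  exact Finset.sum_congr rfl fun i _ => by ring

lemma cdot_comm (a b : Fin 4 → ℂ) : cdot a b = cdot b a := by
  simp only [cdot]
  exact Finset.sum_congr rfl fun i _ => by ring

lemma cdot_add_right (v a b : Fin 4 → ℂ) : cdot v (a + b) = cdot v a + cdot v b := by
  rw [cdot_comm, cdot_add_left, cdot_comm a, cdot_comm b]

lemma cdot_smul_right (c : ℂ) (v a : Fin 4 → ℂ) : cdot v (c • a) = c * cdot v a := by
  rw [cdot_comm, cdot_smul_left, cdot_comm]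

lemma cdot_neg_right (v a : Fin 4 → ℂ) : cdot v (-a) = -cdot v a := by
  rw [← neg_one_smul ℂ a, cdot_smul_right, neg_one_mul]

lemma cdot_sub_right (v a b : Fin 4 → ℂ) : cdot v (a - b) = cdot v a - cdot v b := by
  rw [sub_eq_add_neg, cdot_add_right, cdot_neg_right, sub_eq_add_neg]

lemma cdot_sub_left (a b v : Fin 4 → ℂ) : cdot (a - b) v = cdot a v - cdot b v := by
  rw [cdot_comm, cdot_sub_right, cdot_comm a, cdot_comm b]

lemma toC_add (a b : Fin 4 → ℝ) : toC (a + b) = toC a + toC b := by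
  funext i; simp [toC]

lemma toC_smul (r : ℝ) (a : Fin 4 → ℝ) : toC (r • a) = (r : ℂ) • toC a := by
  funext i; simp [toC]

lemma conjV_toC (a : Fin 4 → ℝ) : conjV (toC a) = toC a := by
  funext i; simp [conjV, toC]

lemma cdot_toC (a b : Fin 4 → ℝ) : cdot (toC a) (toC b) = mdot a b := by
  simp [cdot, mdot, toC]

lemma cdot_conjV (a b : Fin 4 → ℂ) : cdot (conjV a) (conjV b) = starRingEnd ℂ (cdot a b) := by
  simp [cdot, conjV, map_sum]

lemma dyad_mulVec (a b v : Fin 4 → ℂ) : dyad a b *ᵥ v = cdot b v • a := by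
  funext i
  simp only [dyad, Matrix.mulVec, dotProduct, Matrix.of_apply, cdot, Pi.smul_apply, smul_eq_mul,
    Finset.sum_mul]
  exact Finset.sum_congr rfl fun j _ => by ring

lemma eta_sq (i : Fin 4) : eta i * eta i = 1 := by
  unfold eta; split_ifs <;> norm_num

lemma etaC_sq (i : Fin 4) : (eta i : ℂ) * eta i = 1 := by exact_mod_cast eta_sq i

lemma ddot_dyad_right (M : Matrix (Fin 4) (Fin 4) ℂ) (a b : Fin 4 → ℂ) :
    ddot M (dyad a b) = cdot a (M *ᵥ b) := by
  simp only [ddot, dyad, Matrix.of_apply, cdot, Matrix.mulVec, dotProduct, Finset.mul_sum]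
  refine Finset.sum_congr rfl fun i _ => Finset.sum_congr rfl fun j _ => ?_
  linear_combination (eta i : ℂ) * M i j * a i * b j * etaC_sq j

lemma ddot_comm (M N : Matrix (Fin 4) (Fin 4) ℂ) : ddot M N = ddot N M := by
  simp only [ddot]
  exact Finset.sum_congr rfl fun i _ => Finset.sum_congr rfl fun j _ => by ring

lemma ddot_add_right (M N N' : Matrix (Fin 4) (Fin 4) ℂ) :
    ddot M (N + N') = ddot M N + ddot M N' := by
  simp only [ddot, Matrix.add_apply, ← Finset.sum_add_distrib]
  exact Finset.sum_congr rfl fun i _ => Finset.sum_congr rfl fun j _ => by ring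

lemma ddot_smul_right (c : ℂ) (M N : Matrix (Fin 4) (Fin 4) ℂ) :
    ddot M (c • N) = c * ddot M N := by
  simp only [ddot, Matrix.smul_apply, smul_eq_mul, Finset.mul_sum]
  exact Finset.sum_congr rfl fun i _ => Finset.sum_congr rfl fun j _ => by ring

lemma mul_dyad (M : Matrix (Fin 4) (Fin 4) ℂ) (a b : Fin 4 → ℂ) :
    M * dyad a b = dyad (M *ᵥ a) b := by
  ext i j
  simp only [Matrix.mul_apply, dyad, Matrix.of_apply, Matrix.mulVec, dotProduct, Finset.sum_mul]
  exact Finset.sum_congr rfl fun l _ => by ring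

lemma conjM_dyad (a b : Fin 4 → ℂ) : conjM (dyad a b) = dyad (conjV a) (conjV b) := by
  ext i j; simp [conjM, dyad, conjV]

lemma conjM_smul (c : ℂ) (M : Matrix (Fin 4) (Fin 4) ℂ) :
    conjM (c • M) = starRingEnd ℂ c • conjM M := by
  ext i j; simp [conjM]

lemma conjM_add (M N : Matrix (Fin 4) (Fin 4) ℂ) : conjM (M + N) = conjM M + conjM N := by
  ext i j; simp [conjM]

lemma conjM_sub (M N : Matrix (Fin 4) (Fin 4) ℂ) : conjM (M - N) = conjM M - conjM N := by
  ext i j; simp [conjM]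

lemma conjM_one : conjM (1 : Matrix (Fin 4) (Fin 4) ℂ) = 1 := by
  ext i j; by_cases h : i = j <;> simp [conjM, Matrix.one_apply, h]

lemma map_mulVec_toC (M : Matrix (Fin 4) (Fin 4) ℝ) (v : Fin 4 → ℝ) :
    (M.map (fun x : ℝ => (x : ℂ))) *ᵥ toC v = toC (M *ᵥ v) := by
  funext i; simp [Matrix.mulVec, dotProduct, toC]

end Minkowski

namespace LocalWave

variable (L : LocalWave)

/-- The tetrad vectors as complex vectors. -/
def tC (a : Fin 4) : Fin 4 → ℂ := toC (L.tet a)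

/-- Orthonormality reads T η Tᵀ = η and exhibits a one-sided inverse of Tᵀ. For square matrices it
is two-sided, which gives the completeness relation Tᵀ η T = η. -/
lemma tet_complete (i j : Fin 4) :
    ∑ a, eta a * L.tet a i * L.tet a j = if i = j then eta i else 0 := by
  set N : Matrix (Fin 4) (Fin 4) ℝ := Matrix.diagonal eta with hN
  set T : Matrix (Fin 4) (Fin 4) ℝ := Matrix.of L.tet with hT
  have hNN : N * N = 1 := by
    rw [hN, Matrix.diagonal_mul_diagonal, ← Matrix.diagonal_one]
    congr 1; funext i; exact eta_sq i
  have h1 : T * N * Tᵀ = N := by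
    ext a b
    rw [Matrix.mul_apply, hN, Matrix.diagonal_apply, ← L.tet_orthonormal a b]
    simp only [mdot, Matrix.mul_diagonal, Matrix.transpose_apply, hT, Matrix.of_apply]
    exact Finset.sum_congr rfl fun l _ => by ring
  have h2 : (N * T * N) * Tᵀ = 1 := by
    rw [← hNN]
    nth_rewrite 4 [← h1]
    simp only [Matrix.mul_assoc]
  have h3 : Tᵀ * (N * T * N) = 1 := mul_eq_one_comm.1 h2
  have h4 : Tᵀ * N * T = N := by
    calc Tᵀ * N * T = Tᵀ * (N * T * N) * N := by
          simp only [Matrix.mul_assoc, hNN, Matrix.mul_one]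
      _ = N := by rw [h3, Matrix.one_mul]
  have h5 := congrFun (congrFun h4 i) j
  rw [Matrix.mul_apply, hN, Matrix.diagonal_apply] at h5
  rw [← h5]
  simp only [Matrix.mul_diagonal, Matrix.transpose_apply, hT, Matrix.of_apply]
  exact Finset.sum_congr rfl fun l _ => by ring

lemma vec_expand (v : Fin 4 → ℂ) : v = ∑ a, ((eta a : ℂ) * cdot (L.tC a) v) • L.tC a := by
  funext i
  have h : ∀ j, ∑ a, (eta a : ℂ) * L.tet a i * L.tet a j = if i = j then (eta i : ℂ) else 0 :=
    fun j => by
      have := congrArg (fun x : ℝ => (x : ℂ)) (L.tet_complete i j)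
      simp only [ofReal_sum, ofReal_mul] at this
      rw [this]; split_ifs <;> simp
  calc v i = ∑ j, (eta j : ℂ) * v j * (if i = j then (eta i : ℂ) else 0) := by
        simp only [mul_ite, mul_zero, Finset.sum_ite_eq, Finset.mem_univ, if_true]
        linear_combination -(v i) * etaC_sq i
    _ = ∑ j, ∑ a, (eta j : ℂ) * v j * ((eta a : ℂ) * L.tet a i * L.tet a j) := by
        refine Finset.sum_congr rfl fun j _ => ?_
        rw [← h j, Finset.mul_sum]
    _ = _ := by
        rw [Finset.sum_comm]
        simp only [Finset.sum_apply, Pi.smul_apply, smul_eq_mul, cdot, tC, toC, Finset.mul_sum,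
          Finset.sum_mul]
        exact Finset.sum_congr rfl fun a _ => Finset.sum_congr rfl fun j _ => by ring

/-- With this every contraction in the explicit forms becomes a polynomial in the four tetrad
components, where `PparC` keeps components 0 and 1 and `F₀C` exchanges 2 and 3. -/
lemma cdot_expand (v w : Fin 4 → ℂ) : cdot v w =
    -(cdot (L.tC 0) v * cdot (L.tC 0) w) + cdot (L.tC 1) v * cdot (L.tC 1) w
      + cdot (L.tC 2) v * cdot (L.tC 2) w + cdot (L.tC 3) v * cdot (L.tC 3) w := by
  conv_lhs => rw [L.vec_expand v]
  simp only [Fin.sum_univ_four, cdot_add_left, cdot_smul_left, eta]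
  simp

lemma cdot_tC (a b : Fin 4) : cdot (L.tC a) (L.tC b) = if a = b then (eta a : ℂ) else 0 := by
  rw [tC, tC, cdot_toC, L.tet_orthonormal]; split_ifs <;> simp

lemma F₀C_tC : L.F₀C *ᵥ L.tC 0 = 0 ∧ L.F₀C *ᵥ L.tC 1 = 0 ∧
    L.F₀C *ᵥ L.tC 2 = -(L.lamB : ℂ) • L.tC 3 ∧ L.F₀C *ᵥ L.tC 3 = (L.lamB : ℂ) • L.tC 2 := by
  have h0 : toC 0 = 0 := by funext i; simp [toC]
  refine ⟨?_, ?_, ?_, ?_⟩ <;>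
  simp only [F₀C, tC, map_mulVec_toC, L.F₀_tet0, L.F₀_tet1, L.F₀_tet2, L.F₀_tet3, h0, toC_smul,
    ofReal_neg]

lemma F₀C_mulVec (v : Fin 4 → ℂ) : L.F₀C *ᵥ v =
    (L.lamB * cdot (L.tC 3) v) • L.tC 2 - (L.lamB * cdot (L.tC 2) v) • L.tC 3 := by
  obtain ⟨h0, h1, h2, h3⟩ := L.F₀C_tC
  conv_lhs => rw [L.vec_expand v]
  simp only [Fin.sum_univ_four, Matrix.mulVec_add, Matrix.mulVec_smul, h0, h1, h2, h3, eta]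
  simp only [smul_zero, smul_smul, Fin.isValue, Fin.reduceEq, if_false, ofReal_one, one_mul,
    zero_add, neg_smul, smul_neg]
  rw [mul_comm, mul_comm (cdot (L.tC 3) v)]
  abel

lemma cdot_tC_F₀C (v : Fin 4 → ℂ) :
    cdot (L.tC 0) (L.F₀C *ᵥ v) = 0 ∧ cdot (L.tC 1) (L.F₀C *ᵥ v) = 0 ∧
    cdot (L.tC 2) (L.F₀C *ᵥ v) = L.lamB * cdot (L.tC 3) v ∧
    cdot (L.tC 3) (L.F₀C *ᵥ v) = -(L.lamB * cdot (L.tC 2) v) := by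
  rw [F₀C_mulVec]
  simp only [cdot_sub_right, cdot_smul_right, cdot_tC]
  simp [eta]

lemma PparC_mulVec (v : Fin 4 → ℂ) : L.PparC *ᵥ v =
    v + ((L.lamB : ℂ) ^ 2)⁻¹ • (L.F₀C *ᵥ (L.F₀C *ᵥ v)) := by
  have : L.PparC = 1 + ((L.lamB : ℂ) ^ 2)⁻¹ • (L.F₀C * L.F₀C) := by
    ext i j
    simp only [PparC, Ppar, F₀C, Matrix.map_apply, Matrix.add_apply, Matrix.smul_apply,
      Matrix.mul_apply, smul_eq_mul, Matrix.one_apply]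
    push_cast
    split_ifs <;> simp
  rw [this, Matrix.add_mulVec, Matrix.one_mulVec, Matrix.smul_mulVec, Matrix.mulVec_mulVec]

lemma lamB_neC : (L.lamB : ℂ) ≠ 0 := by exact_mod_cast L.lamB_pos.ne'

lemma cdot_tC_PparC (v : Fin 4 → ℂ) :
    cdot (L.tC 0) (L.PparC *ᵥ v) = cdot (L.tC 0) v ∧
    cdot (L.tC 1) (L.PparC *ᵥ v) = cdot (L.tC 1) v ∧
    cdot (L.tC 2) (L.PparC *ᵥ v) = 0 ∧ cdot (L.tC 3) (L.PparC *ᵥ v) = 0 := by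
  have hl := L.lamB_neC
  obtain ⟨h0, h1, h2, h3⟩ := L.cdot_tC_F₀C (L.F₀C *ᵥ v)
  obtain ⟨-, -, h2', h3'⟩ := L.cdot_tC_F₀C v
  simp only [PparC_mulVec, cdot_add_right, cdot_smul_right, h0, h1, h2, h3, h2', h3', mul_zero,
    add_zero, true_and]
  constructor <;> field_simp <;> ring

lemma cdot_PparC (v w : Fin 4 → ℂ) : cdot v (L.PparC *ᵥ w) =
    -(cdot (L.tC 0) v * cdot (L.tC 0) w) + cdot (L.tC 1) v * cdot (L.tC 1) w := by
  obtain ⟨h0, h1, h2, h3⟩ := L.cdot_tC_PparC w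
  rw [L.cdot_expand, h0, h1, h2, h3]; ring

lemma cdot_F₀C (v w : Fin 4 → ℂ) : cdot v (L.F₀C *ᵥ w) =
    L.lamB * (cdot (L.tC 2) v * cdot (L.tC 3) w - cdot (L.tC 3) v * cdot (L.tC 2) w) := by
  obtain ⟨h0, h1, h2, h3⟩ := L.cdot_tC_F₀C w
  rw [L.cdot_expand, h0, h1, h2, h3]; ring

/-- The tetrad components `k · ê_a`. -/
def kT (a : Fin 4) : ℝ := mdot (L.tet a) L.k

/-- The tetrad components `Ã · ê_a`. -/
def AT (a : Fin 4) : ℂ := cdot (L.tC a) L.A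

/-- `e^{iα} ê₊ · Ã` -/
def aPlus : ℂ := exp (I * L.α) * ((L.AT 2 + I * L.AT 3) / Real.sqrt 2)

/-- `e^{-iα} ê₋ · Ã` -/
def aMinus : ℂ := exp (-(I * L.α)) * ((L.AT 2 - I * L.AT 3) / Real.sqrt 2)

/-- `k · U` -/
def kU (u : Fin 2 → ℝ) : ℝ := u 0 * L.kT 0 + u 1 * L.kT 1

/-- `U · Ã` -/
def UA (u : Fin 2 → ℝ) : ℂ := u 0 * L.AT 0 + u 1 * L.AT 1

lemma cdot_tC_k (a : Fin 4) : cdot (L.tC a) (toC L.k) = L.kT a := cdot_toC _ _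

lemma cdot_tC_conjV (a : Fin 4) (v : Fin 4 → ℂ) :
    cdot (L.tC a) (conjV v) = starRingEnd ℂ (cdot (L.tC a) v) := by
  rw [← cdot_conjV, tC, conjV_toC]

lemma toC_U (u : Fin 2 → ℝ) : toC (L.U u) = (u 0 : ℂ) • L.tC 0 + (u 1 : ℂ) • L.tC 1 := by
  rw [U, toC_add, toC_smul, toC_smul]; rfl

lemma cdot_U (u : Fin 2 → ℝ) (v : Fin 4 → ℂ) :
    cdot (toC (L.U u)) v = u 0 * cdot (L.tC 0) v + u 1 * cdot (L.tC 1) v := by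
  rw [toC_U, cdot_add_left, cdot_smul_left, cdot_smul_left]

lemma mdot_comm (a b : Fin 4 → ℝ) : mdot a b = mdot b a := by
  simp only [mdot]
  exact Finset.sum_congr rfl fun i _ => by ring

lemma mdot_k_U (u : Fin 2 → ℝ) : mdot L.k (L.U u) = L.kU u := by
  have h : ((mdot L.k (L.U u) : ℝ) : ℂ) = L.kU u := by
    rw [← cdot_toC, cdot_comm, cdot_U, cdot_tC_k, cdot_tC_k, kU]; push_cast; ring
  exact_mod_cast h

lemma D_eq (ℓ : ℤ) (u : Fin 2 → ℝ) : L.D ℓ u = L.kU u + ℓ * L.Omega := by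
  rw [D, mdot_k_U]

lemma sqrt2C_sq : ((Real.sqrt 2 : ℝ) : ℂ) ^ 2 = 2 := by
  have := Real.sq_sqrt (show (0 : ℝ) ≤ 2 by norm_num)
  exact_mod_cast this

lemma sqrt2C_ne : ((Real.sqrt 2 : ℝ) : ℂ) ≠ 0 := by
  simp

lemma inv_sqrt2C_sq : (((Real.sqrt 2 : ℝ) : ℂ)⁻¹) ^ 2 = 1 / 2 := by
  rw [inv_pow, sqrt2C_sq]; norm_num

lemma expα_mul : exp (I * L.α) * exp (-(I * L.α)) = 1 := by
  rw [← exp_add]; simp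

lemma kT_two : (L.kT 2 : ℂ) = L.kperp * (I * (exp (I * L.α) - exp (-(I * L.α))) / 2) := by
  have h : L.kT 2 = -(L.kperp * Real.sin L.α) := L.k_tet2
  rw [h]
  push_cast
  rw [Complex.sin]
  ring_nf

lemma kT_three : (L.kT 3 : ℂ) = -(L.kperp * ((exp (I * L.α) + exp (-(I * L.α))) / 2)) := by
  have h : L.kT 3 = -(L.kperp * Real.cos L.α) := L.k_tet3
  rw [h]
  push_cast
  rw [Complex.cos]
  ring_nf

lemma cdot_ePlus (v : Fin 4 → ℂ) : cdot L.ePlus v =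
    (cdot (L.tC 2) v + I * cdot (L.tC 3) v) / Real.sqrt 2 := by
  rw [ePlus, cdot_smul_left, cdot_add_left, cdot_smul_left]; simp only [tC]; ring

lemma cdot_eMinus (v : Fin 4 → ℂ) : cdot L.eMinus v =
    (cdot (L.tC 2) v - I * cdot (L.tC 3) v) / Real.sqrt 2 := by
  rw [eMinus, cdot_smul_left, cdot_sub_left, cdot_smul_left]; simp only [tC]; ring

/-- The phase e^{iα} rotates the perpendicular part of k to a fixed direction, so α disappears here
and stays only inside `aPlus` and `aMinus`. -/
lemma ePlus_k : exp (I * L.α) * cdot L.ePlus (toC L.k) = -(I * L.kperp / Real.sqrt 2) := by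
  rw [cdot_ePlus, cdot_tC_k, cdot_tC_k, kT_two, kT_three]
  linear_combination (-(I * L.kperp / Real.sqrt 2)) * L.expα_mul

lemma eMinus_k : exp (-(I * L.α)) * cdot L.eMinus (toC L.k) = I * L.kperp / Real.sqrt 2 := by
  rw [cdot_eMinus, cdot_tC_k, cdot_tC_k, kT_two, kT_three]
  linear_combination (I * L.kperp / Real.sqrt 2) * L.expα_mul

lemma ePlus_A : exp (I * L.α) * cdot L.ePlus L.A = L.aPlus := by
  rw [cdot_ePlus, aPlus]; rfl

lemma eMinus_A : exp (-(I * L.α)) * cdot L.eMinus L.A = L.aMinus := by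
  rw [cdot_eMinus, aMinus]; rfl

/-- `k · F₀ · Ã / λ_B` -/
lemma kT_cross_AT : L.kT 2 * L.AT 3 - L.kT 3 * L.AT 2
    = L.kperp * (L.aPlus + L.aMinus) / Real.sqrt 2 := by
  rw [kT_two, kT_three, aPlus, aMinus]
  linear_combination (-(L.kperp * (L.AT 2 * (exp (I * L.α) + exp (-(I * L.α))) + I * L.AT 3 *
    (exp (I * L.α) - exp (-(I * L.α)))))) * inv_sqrt2C_sq

lemma conj_expα : starRingEnd ℂ (exp (I * L.α)) = exp (-(I * L.α)) := by
  rw [← exp_conj]; simp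

lemma conj_expα' : starRingEnd ℂ (exp (-(I * L.α))) = exp (I * L.α) := by
  rw [← exp_conj]; simp

lemma aPlus_conj : L.aPlus * starRingEnd ℂ L.aPlus =
    (L.AT 2 + I * L.AT 3) * (starRingEnd ℂ (L.AT 2) - I * starRingEnd ℂ (L.AT 3)) / 2 := by
  rw [aPlus]
  simp only [map_mul, map_div₀, map_add, conj_I, conj_ofReal, conj_expα]
  set z := (L.AT 2 + I * L.AT 3) * (starRingEnd ℂ (L.AT 2) - I * starRingEnd ℂ (L.AT 3))
  linear_combination z * (((Real.sqrt 2 : ℝ) : ℂ)⁻¹) ^ 2 * L.expα_mul + z * inv_sqrt2C_sq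

lemma aMinus_conj : L.aMinus * starRingEnd ℂ L.aMinus =
    (L.AT 2 - I * L.AT 3) * (starRingEnd ℂ (L.AT 2) + I * starRingEnd ℂ (L.AT 3)) / 2 := by
  rw [aMinus]
  simp only [map_mul, map_div₀, map_sub, conj_I, conj_ofReal, conj_expα']
  set z := (L.AT 2 - I * L.AT 3) * (starRingEnd ℂ (L.AT 2) + I * starRingEnd ℂ (L.AT 3))
  linear_combination z * (((Real.sqrt 2 : ℝ) : ℂ)⁻¹) ^ 2 * L.expα_mul + z * inv_sqrt2C_sq

end LocalWave

end OscCenter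
end

/-! ### The summands of the first two forms in tetrad components. -/

noncomputable section

namespace OscCenter

open Complex MeasureTheory
open scoped Real

namespace LocalWave

variable (L : LocalWave)

lemma m_neC : (L.m : ℂ) ≠ 0 := by exact_mod_cast L.m_pos.ne'
lemma c_neC : (L.c : ℂ) ≠ 0 := by exact_mod_cast L.c_pos.ne'
lemma e_neC : (L.e : ℂ) ≠ 0 := by exact_mod_cast L.e_ne
lemma ε_neC : (L.ε : ℂ) ≠ 0 := by exact_mod_cast L.ε_pos.ne'

lemma Omega_ne : L.Omega ≠ 0 :=
  div_ne_zero (mul_ne_zero L.e_ne L.lamB_pos.ne') (mul_ne_zero L.m_pos.ne' L.c_pos.ne')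

lemma Omega_neC : (L.Omega : ℂ) ≠ 0 := by exact_mod_cast L.Omega_ne

lemma Omega_mul : L.m * L.c * L.Omega = L.e * L.lamB := by
  have h1 := L.m_pos.ne'
  have h2 := L.c_pos.ne'
  rw [Omega]; field_simp

lemma rho_ne {μ : ℝ} (h : 0 < μ * L.Omega) : L.rho μ ≠ 0 := by
  refine div_ne_zero (Real.sqrt_pos.2 ?_).ne' L.Omega_ne
  exact div_pos (by linarith) L.m_pos

lemma rho_neC {μ : ℝ} (h : 0 < μ * L.Omega) : (L.rho μ : ℂ) ≠ 0 := by
  exact_mod_cast L.rho_ne h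

lemma conj_J (ℓ : ℤ) (μ : ℝ) : starRingEnd ℂ (L.J ℓ μ) = L.J ℓ μ := conj_besselJ _ _

lemma J_recurrence (ℓ : ℤ) (μ : ℝ) :
    L.kperp * L.rho μ * (L.J (ℓ - 1) μ + L.J (ℓ + 1) μ) = 2 * ℓ * L.J ℓ μ := by
  have := besselJ_recurrence ℓ (L.kperp * L.rho μ)
  push_cast at this
  exact this

lemma calJPlus_A (ℓ : ℤ) (μ : ℝ) : cdot (L.calJPlus ℓ μ) L.A =
    L.aPlus * L.J (ℓ - 1) μ + L.aMinus * L.J (ℓ + 1) μ := by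
  rw [calJPlus, cdot_add_left, cdot_smul_left, cdot_smul_left, ← ePlus_A, ← eMinus_A]; ring

lemma calJMinus_A (ℓ : ℤ) (μ : ℝ) : cdot (L.calJMinus ℓ μ) L.A =
    L.aPlus * L.J (ℓ - 1) μ - L.aMinus * L.J (ℓ + 1) μ := by
  rw [calJMinus, cdot_sub_left, cdot_smul_left, cdot_smul_left, ← ePlus_A, ← eMinus_A]; ring

lemma calJPlus_k (ℓ : ℤ) (μ : ℝ) : cdot (L.calJPlus ℓ μ) (toC L.k) =
    -(I * L.kperp / Real.sqrt 2) * (L.J (ℓ - 1) μ - L.J (ℓ + 1) μ) := by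
  rw [calJPlus, cdot_add_left, cdot_smul_left, cdot_smul_left]
  linear_combination L.J (ℓ - 1) μ * L.ePlus_k + L.J (ℓ + 1) μ * L.eMinus_k

lemma calJMinus_k (ℓ : ℤ) (μ : ℝ) : cdot (L.calJMinus ℓ μ) (toC L.k) =
    -(I * L.kperp / Real.sqrt 2) * (L.J (ℓ - 1) μ + L.J (ℓ + 1) μ) := by
  rw [calJMinus, cdot_sub_left, cdot_smul_left, cdot_smul_left]
  linear_combination L.J (ℓ - 1) μ * L.ePlus_k - L.J (ℓ + 1) μ * L.eMinus_k

lemma cdot_U_A (u : Fin 2 → ℝ) : cdot (toC (L.U u)) L.A = L.UA u := L.cdot_U u _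

lemma cdot_U_k (u : Fin 2 → ℝ) : cdot (toC (L.U u)) (toC L.k) = L.kU u := by
  rw [cdot_toC, mdot_comm, mdot_k_U]

lemma V_A (ℓ : ℤ) (u : Fin 2 → ℝ) (μ : ℝ) : cdot (L.V ℓ u μ) L.A =
    L.J ℓ μ * L.UA u + I * L.rho μ * L.Omega / Real.sqrt 2 *
      (L.aPlus * L.J (ℓ - 1) μ - L.aMinus * L.J (ℓ + 1) μ) := by
  rw [V, cdot_add_left, cdot_smul_left, cdot_smul_left, cdot_U_A, calJMinus_A]

lemma H1_eq (ℓ : ℤ) (u : Fin 2 → ℝ) (μ : ℝ) : L.H1 ℓ u μ = -(L.e / L.c) *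
    (L.J ℓ μ * L.UA u + I * L.rho μ * L.Omega / Real.sqrt 2 *
      (L.aPlus * L.J (ℓ - 1) μ - L.aMinus * L.J (ℓ + 1) μ)) := by
  rw [H1, V_A]

/-- The recurrence turns ½ρΩk_⊥(J_{ℓ-1} + J_{ℓ+1}) into ℓΩJ_ℓ, which completes k·U to D_ℓ. This is
how D_ℓ enters V_ℓ·F̃, and later cancels denominators. -/
lemma V_k (ℓ : ℤ) (u : Fin 2 → ℝ) (μ : ℝ) :
    cdot (L.V ℓ u μ) (toC L.k) = L.D ℓ u * L.J ℓ μ := by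
  rw [V, cdot_add_left, cdot_smul_left, cdot_smul_left, cdot_U_k, calJMinus_k, D_eq]
  have h := L.J_recurrence ℓ μ
  push_cast
  linear_combination (L.Omega / 2 : ℂ) * h - L.rho μ * L.Omega * L.kperp *
    (L.J (ℓ - 1) μ + L.J (ℓ + 1) μ) * (I ^ 2 * inv_sqrt2C_sq + 1 / 2 * I_sq)

/-- The Fourier coefficient of `(k·â Ã·ṙ - k·ṙ Ã·â) exp(iρ k·â)`. -/
def X (ℓ : ℤ) (u : Fin 2 → ℝ) (μ : ℝ) : ℂ :=
  -(I * L.kperp / 2) * (L.J (ℓ - 1) μ - L.J (ℓ + 1) μ) * L.UA u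
    - L.kU u / Real.sqrt 2 * (L.aPlus * L.J (ℓ - 1) μ + L.aMinus * L.J (ℓ + 1) μ)
    - L.rho μ * L.Omega * L.kperp / Real.sqrt 2 * (L.aPlus + L.aMinus) * L.J ℓ μ

/-- The tetrad components of `H_{1ℓ} k + (e/c) D_ℓ J_ℓ Ã`. -/
def Q (ℓ : ℤ) (u : Fin 2 → ℝ) (μ : ℝ) (a : Fin 4) : ℂ :=
  L.H1 ℓ u μ * L.kT a + L.e / L.c * L.D ℓ u * L.J ℓ μ * L.AT a

/-- `U · (H_{1ℓ} k + (e/c) D_ℓ J_ℓ Ã)` -/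
def QU (ℓ : ℤ) (u : Fin 2 → ℝ) (μ : ℝ) : ℂ := u 0 * L.Q ℓ u μ 0 + u 1 * L.Q ℓ u μ 1

lemma QU_eq (ℓ : ℤ) (u : Fin 2 → ℝ) (μ : ℝ) : L.QU ℓ u μ =
    L.H1 ℓ u μ * L.kU u + L.e / L.c * L.D ℓ u * L.J ℓ μ * L.UA u := by
  simp only [QU, Q, kU, UA]; push_cast; ring

/-- `Ã* · P_∥ · Ã` -/
def APA : ℝ := normSq (L.AT 1) - normSq (L.AT 0)

/-- `k · P_∥ · k` -/
def kPk : ℝ := L.kT 1 ^ 2 - L.kT 0 ^ 2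

/-- `k · P_∥ · Ã` -/
def kPA : ℂ := L.kT 1 * L.AT 1 - L.kT 0 * L.AT 0

lemma cdot_k_PparC_A : cdot (toC L.k) (L.PparC *ᵥ L.A) = L.kPA := by
  rw [cdot_PparC, cdot_tC_k, cdot_tC_k, kPA]; simp only [AT]; ring

lemma mdot_k_Ppar_k : mdot L.k (L.Ppar *ᵥ L.k) = L.kPk := by
  have h : ((mdot L.k (L.Ppar *ᵥ L.k) : ℝ) : ℂ) = L.kPk := by
    rw [← cdot_toC, ← map_mulVec_toC]
    change cdot (toC L.k) (L.PparC *ᵥ toC L.k) = _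
    rw [cdot_PparC, cdot_tC_k, cdot_tC_k, kPk]; push_cast; ring
  exact_mod_cast h

lemma K2TermA_eq {ℓ : ℤ} {u : Fin 2 → ℝ} {μ : ℝ} (hμ : 0 < μ * L.Omega) :
    L.K2TermA ℓ u μ = addCC
      (L.e * starRingEnd ℂ (L.H1 ℓ u μ) / (L.m * L.c * L.D ℓ u) *
        (L.kPA * L.J ℓ μ - I * L.kU u / (L.rho μ * L.Omega ^ 2) * L.X ℓ u μ)
      + L.H1 ℓ u μ * starRingEnd ℂ (L.H1 ℓ u μ) / (2 * L.m * L.D ℓ u ^ 2) * L.kPk) := by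
  have hΩ := L.Omega_neC
  have hl := L.lamB_neC
  have hρ := L.rho_neC hμ
  -- The square bracket of the first form, contracted with Ã, is X_ℓ/Ω.
  have hb : cdot ((-(I * L.kperp / (2 * L.Omega) * (L.J (ℓ - 1) μ - L.J (ℓ + 1) μ)))
                  • toC (L.U u)
                - (mdot L.k (L.U u) / (Real.sqrt 2 * L.Omega) : ℂ) • L.calJPlus ℓ μ
                + (L.rho μ / L.lamB * L.J ℓ μ) • (L.F₀C *ᵥ toC L.k)) L.A
      = L.X ℓ u μ / L.Omega := by
    rw [cdot_add_left, cdot_sub_left, cdot_smul_left, cdot_smul_left, cdot_smul_left, cdot_U_A,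
      calJPlus_A, mdot_k_U, cdot_comm _ L.A, cdot_F₀C, cdot_tC_k, cdot_tC_k]
    have h := L.kT_cross_AT
    simp only [AT] at h
    have h' : (cdot (L.tC 2) L.A * L.kT 3 - cdot (L.tC 3) L.A * L.kT 2 : ℂ)
        = -(L.kperp * (L.aPlus + L.aMinus) / Real.sqrt 2) := by
      rw [← h]; ring
    rw [h', X]
    field_simp
    ring
  rw [K2TermA, hb, cdot_k_PparC_A, mdot_k_Ppar_k, mdot_k_U, normSq_eq_conj_mul_self]
  congr 1
  field_simp

/-- ê₊ and ê₋ are eigenvectors of F₀ with eigenvalues iλ_B and -iλ_B, and conjugation exchanges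
them; the opposite eigenvalues flip the relative sign of the two terms, turning 𝒥⁻ into 𝒥⁺. -/
lemma calJPlus_conj_F₀ (ℓ : ℤ) (μ : ℝ) :
    L.F₀C *ᵥ conjV (L.calJMinus ℓ μ) = -(I * L.lamB) • conjV (L.calJPlus ℓ μ) := by
  have hP : ∀ a, cdot (L.tC a) (L.calJMinus ℓ μ) =
      exp (I * L.α) * L.J (ℓ - 1) μ * cdot L.ePlus (L.tC a)
        - exp (-(I * L.α)) * L.J (ℓ + 1) μ * cdot L.eMinus (L.tC a) := fun a => by
    rw [calJMinus, cdot_sub_right, cdot_smul_right, cdot_smul_right, cdot_comm _ L.ePlus,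
      cdot_comm _ L.eMinus]
  have hM : ∀ a, cdot (L.tC a) (L.calJPlus ℓ μ) =
      exp (I * L.α) * L.J (ℓ - 1) μ * cdot L.ePlus (L.tC a)
        + exp (-(I * L.α)) * L.J (ℓ + 1) μ * cdot L.eMinus (L.tC a) := fun a => by
    rw [calJPlus, cdot_add_right, cdot_smul_right, cdot_smul_right, cdot_comm _ L.ePlus,
      cdot_comm _ L.eMinus]
  -- A vector is determined by its tetrad components.
  have key : ∀ v w : Fin 4 → ℂ, (∀ a, cdot (L.tC a) v = cdot (L.tC a) w) → v = w :=
    fun v w h => by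
      rw [L.vec_expand v, L.vec_expand w]
      simp only [h]
  refine key _ _ fun a => ?_
  obtain ⟨h0, h1, h2, h3⟩ := L.cdot_tC_F₀C (conjV (L.calJMinus ℓ μ))
  rw [cdot_smul_right]
  fin_cases a
  · change cdot (L.tC 0) _ = _ * cdot (L.tC 0) _
    rw [h0, cdot_tC_conjV, hM, cdot_ePlus, cdot_eMinus, cdot_tC, cdot_tC]; simp
  · change cdot (L.tC 1) _ = _ * cdot (L.tC 1) _
    rw [h1, cdot_tC_conjV, hM, cdot_ePlus, cdot_eMinus, cdot_tC, cdot_tC]; simp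
  · change cdot (L.tC 2) _ = _ * cdot (L.tC 2) _
    rw [h2, cdot_tC_conjV, cdot_tC_conjV, hP, hM, cdot_ePlus, cdot_eMinus, cdot_ePlus,
      cdot_eMinus]
    simp only [cdot_tC]
    simp [eta, conj_J]
    ring
  · change cdot (L.tC 3) _ = _ * cdot (L.tC 3) _
    rw [h3, cdot_tC_conjV, cdot_tC_conjV, hP, hM, cdot_ePlus, cdot_eMinus, cdot_ePlus,
      cdot_eMinus]
    simp only [cdot_tC]
    simp [eta, conj_J]
    ring_nf
    simp only [I_sq]
    ring

lemma Ftilde_mulVec (w : Fin 4 → ℂ) : L.Ftilde *ᵥ w =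
    I • (cdot L.A w • toC L.k - cdot (toC L.k) w • L.A) := by
  rw [Ftilde, Matrix.smul_mulVec, Matrix.sub_mulVec, dyad_mulVec, dyad_mulVec]

lemma conjM_Ftilde : conjM L.Ftilde =
    (-I) • (dyad (toC L.k) (conjV L.A) - dyad (conjV L.A) (toC L.k)) := by
  rw [Ftilde, conjM_smul, conjM_sub, conjM_dyad, conjM_dyad, conjV_toC, conj_I]

lemma conjM_Ftilde_mulVec (w : Fin 4 → ℂ) : conjM L.Ftilde *ᵥ w =
    (-I) • (cdot (conjV L.A) w • toC L.k - cdot (toC L.k) w • conjV L.A) := by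
  rw [conjM_Ftilde, Matrix.smul_mulVec, Matrix.sub_mulVec, dyad_mulVec, dyad_mulVec]

/-- The tetrad components of `V_ℓ · F̃`. -/
lemma V_Ftilde (ℓ : ℤ) (u : Fin 2 → ℝ) (μ : ℝ) (w : Fin 4 → ℂ) :
    cdot (L.V ℓ u μ) (L.Ftilde *ᵥ w) = I * (L.c / L.e) *
      (-(L.Q ℓ u μ 0 * cdot (L.tC 0) w) + L.Q ℓ u μ 1 * cdot (L.tC 1) w
        + L.Q ℓ u μ 2 * cdot (L.tC 2) w + L.Q ℓ u μ 3 * cdot (L.tC 3) w) := by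
  have he := L.e_neC
  have hc := L.c_neC
  have hA : cdot (L.V ℓ u μ) L.A = -(L.c / L.e) * L.H1 ℓ u μ := by
    rw [H1]; field_simp
  rw [Ftilde_mulVec, cdot_smul_right, cdot_sub_right, cdot_smul_right, cdot_smul_right, V_k, hA,
    L.cdot_expand L.A w, L.cdot_expand (toC L.k) w]
  simp only [cdot_tC_k, Q, AT]
  field_simp
  ring

lemma Ftilde_conj_V (ℓ : ℤ) (u : Fin 2 → ℝ) (μ : ℝ) (a : Fin 4) :
    cdot (L.tC a) (conjM L.Ftilde *ᵥ conjV (L.V ℓ u μ)) =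
      I * (L.c / L.e) * starRingEnd ℂ (L.Q ℓ u μ a) := by
  have he := L.e_neC
  have hc := L.c_neC
  have hA : cdot L.A (L.V ℓ u μ) = -(L.c / L.e) * L.H1 ℓ u μ := by
    rw [cdot_comm, H1]; field_simp
  have hk : cdot (toC L.k) (conjV (L.V ℓ u μ)) = L.D ℓ u * L.J ℓ μ := by
    rw [← conjV_toC, cdot_conjV, cdot_comm, V_k, map_mul, conj_ofReal, conj_J]
  rw [conjM_Ftilde_mulVec, cdot_smul_right, cdot_sub_right, cdot_smul_right, cdot_smul_right,
    cdot_conjV, hA, hk, cdot_tC_k, cdot_tC_conjV]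
  simp only [Q, AT, map_add, map_mul, map_neg, map_div₀, conj_ofReal, conj_J]
  field_simp
  ring

/-- The contraction is i(U·Ã 𝒥⁻·k - k·U 𝒥⁻·Ã). By the recurrence 𝒥⁻·k is a multiple of ℓJ_ℓ, and
𝒥⁻·Ã is what H_{1ℓ} contains besides U·Ã J_ℓ; together they assemble U·(H_{1ℓ}k + (e/c)D_ℓJ_ℓÃ). -/
lemma ddot_Ftilde_calJ (ℓ : ℤ) (u : Fin 2 → ℝ) {μ : ℝ} (hμ : 0 < μ * L.Omega) :
    ddot L.Ftilde (dyad (L.calJMinus ℓ μ) (toC (L.U u))) =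
      Real.sqrt 2 * L.c / (L.e * L.rho μ * L.Omega) * L.QU ℓ u μ := by
  have he := L.e_neC
  have hc := L.c_neC
  have hΩ := L.Omega_neC
  have hρ := L.rho_neC hμ
  have h2 := sqrt2C_ne
  have hk : cdot (toC L.k) (toC (L.U u)) = L.kU u := by rw [cdot_comm, cdot_U_k]
  have hA : cdot L.A (toC (L.U u)) = L.UA u := by rw [cdot_comm, cdot_U_A]
  rw [ddot_dyad_right, Ftilde_mulVec, cdot_smul_right, cdot_sub_right, cdot_smul_right,
    cdot_smul_right, hk, hA, calJMinus_A, calJMinus_k, QU_eq, H1_eq, D_eq]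
  have h := L.J_recurrence ℓ μ
  have hs := sqrt2C_sq
  set s : ℂ := ((Real.sqrt 2 : ℝ) : ℂ)
  generalize L.J (ℓ - 1) μ = jm at *
  generalize L.J (ℓ + 1) μ = jp at *
  push_cast
  field_simp
  ring_nf
  simp only [I_sq, hs]
  linear_combination (L.UA u * L.Omega) * h

/-- The identity part gives F̃*:F₀, the term of X_ℓ with J_ℓ. In the dyad F₀ replaces 𝒥⁻ by 𝒥⁺ and
yields the terms with J_{ℓ±1}. -/
lemma ddot_conj_Ftilde (ℓ : ℤ) (u : Fin 2 → ℝ) {μ : ℝ} (hμ : 0 < μ * L.Omega) :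
    ddot (conjM L.Ftilde)
          ((1 / L.lamB : ℂ) •
            (L.F₀C *
              conjM (L.J ℓ μ • (1 : Matrix (Fin 4) (Fin 4) ℂ)
                + (Real.sqrt 2 * Complex.I / (L.rho μ * L.Omega))
                  • dyad (L.calJMinus ℓ μ) (toC (L.U u))))) =
      2 * I / (L.rho μ * L.Omega) * starRingEnd ℂ (L.X ℓ u μ) := by
  have hl := L.lamB_neC
  have hΩ := L.Omega_neC
  have hρ := L.rho_neC hμ
  have h2 := sqrt2C_ne
  have hk : cdot (toC L.k) (toC (L.U u)) = L.kU u := by rw [cdot_comm, cdot_U_k]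
  have hA : cdot (conjV L.A) (toC (L.U u)) = starRingEnd ℂ (L.UA u) := by
    rw [← conjV_toC, cdot_conjV, cdot_comm, cdot_U_A]
  have h1 : ddot (conjM L.Ftilde) L.F₀C =
      -(2 * I) * (L.lamB * starRingEnd ℂ (L.kperp * (L.aPlus + L.aMinus) / Real.sqrt 2)) := by
    rw [conjM_Ftilde, ddot_comm, ddot_smul_right, sub_eq_add_neg, ← neg_one_smul ℂ (dyad _ _),
      ddot_add_right, ddot_smul_right, ddot_dyad_right, ddot_dyad_right, cdot_F₀C, cdot_F₀C,
      ← kT_cross_AT]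
    simp only [cdot_tC_k, cdot_tC_conjV, map_sub, map_mul, conj_ofReal, AT]
    ring
  have h3 : cdot (conjV (L.calJPlus ℓ μ)) (conjM L.Ftilde *ᵥ toC (L.U u)) =
      -I * (starRingEnd ℂ (cdot (L.calJPlus ℓ μ) (toC L.k)) * starRingEnd ℂ (L.UA u)
        - L.kU u * starRingEnd ℂ (cdot (L.calJPlus ℓ μ) L.A)) := by
    have : cdot (conjV (L.calJPlus ℓ μ)) (toC L.k)
        = starRingEnd ℂ (cdot (L.calJPlus ℓ μ) (toC L.k)) := by
      rw [← cdot_conjV, conjV_toC]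
    rw [conjM_Ftilde_mulVec, cdot_smul_right, cdot_sub_right, cdot_smul_right, cdot_smul_right,
      hk, hA, this, cdot_conjV]
    ring
  rw [ddot_smul_right, conjM_add, conjM_smul, conjM_smul, conjM_one, conjM_dyad, Matrix.mul_add,
    Matrix.mul_smul, Matrix.mul_smul, Matrix.mul_one, mul_dyad, calJPlus_conj_F₀, conjV_toC,
    ddot_add_right, ddot_smul_right, ddot_smul_right, h1, ddot_dyad_right, cdot_smul_left, h3,
    calJPlus_k, calJPlus_A, X]
  simp only [map_sub, map_add, map_mul, map_div₀, map_neg, conj_ofReal, conj_I, conj_J, map_ofNat]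
  have hs := sqrt2C_sq
  set s : ℂ := ((Real.sqrt 2 : ℝ) : ℂ)
  field_simp
  ring_nf
  simp only [I_sq, I_pow_three, hs]
  ring

/-- Form (B) depends on the wave only through the vector Q_ℓ, which is V_ℓ·F̃ up to a constant, and
through X_ℓ. P_∥ selects its components 0 and 1, F₀ the components 2 and 3. This is also the shape
in which Parseval's identity will deliver K₂. -/
lemma K2TermF_eq {ℓ : ℤ} {u : Fin 2 → ℝ} {μ : ℝ} (hμ : 0 < μ * L.Omega) (hD : L.D ℓ u ≠ 0) :
    L.K2TermF ℓ u μ = addCC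
      ((L.Q ℓ u μ 1 * starRingEnd ℂ (L.Q ℓ u μ 1) - L.Q ℓ u μ 0 * starRingEnd ℂ (L.Q ℓ u μ 0))
          / (2 * L.m * L.D ℓ u ^ 2)
        - I * (L.Q ℓ u μ 2 * starRingEnd ℂ (L.Q ℓ u μ 3)
            - L.Q ℓ u μ 3 * starRingEnd ℂ (L.Q ℓ u μ 2)) / (2 * L.m * L.Omega * L.D ℓ u)
        + I * L.e / (L.m * L.c * L.rho μ * L.Omega ^ 2 * L.D ℓ u)
          * (L.QU ℓ u μ * starRingEnd ℂ (L.X ℓ u μ))) := by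
  have hl := L.lamB_neC
  have hΩ := L.Omega_neC
  have hρ := L.rho_neC hμ
  have h2 := sqrt2C_ne
  have he := L.e_neC
  have hc := L.c_neC
  have hm := L.m_neC
  have hD' : (L.D ℓ u : ℂ) ≠ 0 := by exact_mod_cast hD
  rw [K2TermF, ddot_conj_Ftilde L ℓ u hμ, ddot_Ftilde_calJ L ℓ u hμ, V_Ftilde]
  simp only [Matrix.add_mulVec, Matrix.smul_mulVec, cdot_add_right, cdot_smul_right]
  obtain ⟨f0, f1, f2, f3⟩ := L.cdot_tC_F₀C (conjM L.Ftilde *ᵥ conjV (L.V ℓ u μ))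
  obtain ⟨p0, p1, p2, p3⟩ := L.cdot_tC_PparC (conjM L.Ftilde *ᵥ conjV (L.V ℓ u μ))
  rw [f0, f1, f2, f3, p0, p1, p2, p3]
  simp only [Ftilde_conj_V]
  congr 1
  field_simp
  ring_nf
  simp only [I_pow_three, I_pow_four]
  ring

end LocalWave

end OscCenter
end

/-! ### Neumann sums; the second form equals the first. -/

noncomputable section

namespace OscCenter

open Complex MeasureTheory
open scoped Real

lemma addCC_eq (z : ℂ) : ((addCC z : ℝ) : ℂ) = z + starRingEnd ℂ z := by
  rw [add_conj, addCC]

/-- Used for convergence: H_{1ℓ}, J_ℓ and X_ℓ are square summable in ℓ, and the denominators only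
contribute bounded factors. -/
lemma summable_mul_mul_of_sq {f g w : ℤ → ℂ} (hf : Summable fun ℓ => ‖f ℓ‖ ^ 2)
    (hg : Summable fun ℓ => ‖g ℓ‖ ^ 2) {C : ℝ} (hw : ∀ ℓ, ‖w ℓ‖ ≤ C) :
    Summable fun ℓ => f ℓ * g ℓ * w ℓ := by
  refine Summable.of_norm_bounded ((hf.add hg).mul_left C) fun ℓ => ?_
  rw [norm_mul, norm_mul]
  have hC : 0 ≤ C := (norm_nonneg _).trans (hw ℓ)
  have h1 : ‖f ℓ‖ * ‖g ℓ‖ ≤ ‖f ℓ‖ ^ 2 + ‖g ℓ‖ ^ 2 := by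
    nlinarith [sq_nonneg (‖f ℓ‖ - ‖g ℓ‖), sq_nonneg ‖f ℓ‖, sq_nonneg ‖g ℓ‖]
  calc ‖f ℓ‖ * ‖g ℓ‖ * ‖w ℓ‖ ≤ (‖f ℓ‖ ^ 2 + ‖g ℓ‖ ^ 2) * C := by
        gcongr
        exact hw ℓ
    _ = _ := mul_comm _ _

namespace LocalWave

variable (L : LocalWave)

lemma hasSum_J_mul (μ : ℝ) (a b : ℤ) :
    HasSum (fun ℓ : ℤ => L.J (ℓ + a) μ * L.J (ℓ + b) μ) (if a = b then 1 else 0) :=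
  hasSum_besselJ_mul _ a b

/-- Neumann sums for combinations of neighbouring Bessel functions. -/
lemma hasSum_comb_mul (μ : ℝ) (a b c a' b' c' : ℂ) :
    HasSum (fun ℓ : ℤ => (a * L.J ℓ μ + b * L.J (ℓ - 1) μ + c * L.J (ℓ + 1) μ) *
      (a' * L.J ℓ μ + b' * L.J (ℓ - 1) μ + c' * L.J (ℓ + 1) μ)) (a * a' + b * b' + c * c') := by
  have h := L.hasSum_J_mul μ
  have h1 := ((h 0 0).mul_left (a * a')).add (((h (-1) (-1)).mul_left (b * b')).add
    (((h 1 1).mul_left (c * c')).add (((h 0 (-1)).mul_left (a * b' + b * a')).add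
    (((h 0 1).mul_left (a * c' + c * a')).add ((h (-1) 1).mul_left (b * c' + c * b'))))))
  simp only [add_zero, ← sub_eq_add_neg] at h1
  norm_num at h1
  refine (congrArg₂ (fun F S => HasSum F S) (funext fun ℓ => ?_) ?_).mpr h1 <;> ring

/-- First moments of the Neumann sums. -/
lemma hasSum_int_mul_comb_mul (μ : ℝ) (a b c b' c' : ℂ) :
    HasSum (fun ℓ : ℤ => ℓ * ((a * L.J ℓ μ + b * L.J (ℓ - 1) μ + c * L.J (ℓ + 1) μ) *
      (b' * L.J (ℓ - 1) μ + c' * L.J (ℓ + 1) μ)))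
      (L.kperp * L.rho μ / 2 * a * (b' + c') + b * b' - c * c') := by
  set x : ℂ := L.kperp * L.rho μ with hx
  have h := L.hasSum_J_mul μ
  -- The recurrence absorbs the weight ℓ at the price of the neighbours J_{ℓ±2}, after which only
  -- plain Neumann sums remain.
  have r0 : ∀ ℓ : ℤ, ℓ * L.J ℓ μ = x / 2 * (L.J (ℓ - 1) μ + L.J (ℓ + 1) μ) := fun ℓ => by
    linear_combination (-1 / 2) * L.J_recurrence ℓ μ
  have rm : ∀ ℓ : ℤ, ℓ * L.J (ℓ - 1) μ
      = x / 2 * (L.J (ℓ - 2) μ + L.J ℓ μ) + L.J (ℓ - 1) μ := fun ℓ => by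
    have := r0 (ℓ - 1)
    rw [show ℓ - 1 - 1 = ℓ - 2 by ring, sub_add_cancel] at this
    push_cast at this
    linear_combination this
  have rp : ∀ ℓ : ℤ, ℓ * L.J (ℓ + 1) μ
      = x / 2 * (L.J ℓ μ + L.J (ℓ + 2) μ) - L.J (ℓ + 1) μ := fun ℓ => by
    have := r0 (ℓ + 1)
    rw [show ℓ + 1 + 1 = ℓ + 2 by ring, add_sub_cancel_right] at this
    push_cast at this
    linear_combination this
  have h1 := (((((h (-1) (-1)).mul_left (x / 2 * a * b' + b * b')).add
    ((h 1 1).mul_left (x / 2 * a * c' - c * c'))).add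
    ((h (-1) 1).mul_left (x / 2 * a * (b' + c') + b * c' - c * b'))).add
    (((h (-2) (-1)).mul_left (x / 2 * b * b')).add ((h 0 (-1)).mul_left (x / 2 * b * b')))).add
    ((((h (-2) 1).mul_left (x / 2 * b * c')).add ((h 0 1).mul_left (x / 2 * b * c'))).add
    ((((h 0 (-1)).mul_left (x / 2 * c * b')).add ((h 2 (-1)).mul_left (x / 2 * c * b'))).add
    (((h 0 1).mul_left (x / 2 * c * c')).add ((h 2 1).mul_left (x / 2 * c * c')))))
  simp only [add_zero, ← sub_eq_add_neg] at h1
  norm_num at h1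
  refine (congrArg₂ (fun F S => HasSum F S) (funext fun ℓ => ?_) ?_).mpr h1
  · linear_combination (a * (b' * L.J (ℓ - 1) μ + c' * L.J (ℓ + 1) μ)) * r0 ℓ
      + (b * (b' * L.J (ℓ - 1) μ + c' * L.J (ℓ + 1) μ)) * rm ℓ
      + (c * (b' * L.J (ℓ - 1) μ + c' * L.J (ℓ + 1) μ)) * rp ℓ
  · ring

/-- The coefficients of `H_{1ℓ}` in the neighbouring Bessel functions. -/
lemma H1_comb (ℓ : ℤ) (u : Fin 2 → ℝ) (μ : ℝ) : L.H1 ℓ u μ =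
    (-(L.e / L.c) * L.UA u) * L.J ℓ μ
      + (-(L.e / L.c) * (I * L.rho μ * L.Omega / Real.sqrt 2) * L.aPlus) * L.J (ℓ - 1) μ
      + (L.e / L.c * (I * L.rho μ * L.Omega / Real.sqrt 2) * L.aMinus) * L.J (ℓ + 1) μ := by
  rw [H1_eq]; ring

lemma H1_conj_comb (ℓ : ℤ) (u : Fin 2 → ℝ) (μ : ℝ) : starRingEnd ℂ (L.H1 ℓ u μ) =
    (-(L.e / L.c) * starRingEnd ℂ (L.UA u)) * L.J ℓ μ
      + (L.e / L.c * (I * L.rho μ * L.Omega / Real.sqrt 2) * starRingEnd ℂ L.aPlus)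
        * L.J (ℓ - 1) μ
      + (-(L.e / L.c) * (I * L.rho μ * L.Omega / Real.sqrt 2) * starRingEnd ℂ L.aMinus)
        * L.J (ℓ + 1) μ := by
  rw [H1_comb]
  simp only [map_add, map_mul, map_neg, map_div₀, conj_ofReal, conj_I, conj_J]
  ring

lemma X_comb (ℓ : ℤ) (u : Fin 2 → ℝ) (μ : ℝ) : L.X ℓ u μ =
    (-(L.rho μ * L.Omega * L.kperp / Real.sqrt 2 * (L.aPlus + L.aMinus))) * L.J ℓ μ
      + (-(I * L.kperp / 2) * L.UA u - L.kU u / Real.sqrt 2 * L.aPlus) * L.J (ℓ - 1) μ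
      + (I * L.kperp / 2 * L.UA u - L.kU u / Real.sqrt 2 * L.aMinus) * L.J (ℓ + 1) μ := by
  rw [X]; ring

lemma X_conj_comb (ℓ : ℤ) (u : Fin 2 → ℝ) (μ : ℝ) : starRingEnd ℂ (L.X ℓ u μ) =
    starRingEnd ℂ (-(L.rho μ * L.Omega * L.kperp / Real.sqrt 2 * (L.aPlus + L.aMinus))) * L.J ℓ μ
      + starRingEnd ℂ (-(I * L.kperp / 2) * L.UA u - L.kU u / Real.sqrt 2 * L.aPlus)
        * L.J (ℓ - 1) μ
      + starRingEnd ℂ (I * L.kperp / 2 * L.UA u - L.kU u / Real.sqrt 2 * L.aMinus)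
        * L.J (ℓ + 1) μ := by
  rw [X_comb]
  simp only [map_add, map_mul, conj_J]

lemma J_comb (ℓ : ℤ) (μ : ℝ) : L.J ℓ μ =
    1 * L.J ℓ μ + 0 * L.J (ℓ - 1) μ + 0 * L.J (ℓ + 1) μ := by ring

/-- The squared modulus is the product with the conjugate combination, a Neumann sum because the J_ℓ
are real. -/
lemma summable_sq_comb (μ : ℝ) (a b c : ℂ) :
    Summable fun ℓ : ℤ => ‖a * L.J ℓ μ + b * L.J (ℓ - 1) μ + c * L.J (ℓ + 1) μ‖ ^ 2 := by
  have h := (L.hasSum_comb_mul μ a b c (starRingEnd ℂ a) (starRingEnd ℂ b)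
    (starRingEnd ℂ c)).summable
  rw [← summable_ofReal]
  refine h.congr fun ℓ => ?_
  rw [ofReal_pow, ← mul_conj']
  simp only [map_add, map_mul, conj_J]

lemma summable_sq_J (μ : ℝ) : Summable fun ℓ : ℤ => ‖L.J ℓ μ‖ ^ 2 :=
  (L.summable_sq_comb μ 1 0 0).congr fun ℓ => by rw [← J_comb]

lemma summable_sq_H1 (u : Fin 2 → ℝ) (μ : ℝ) : Summable fun ℓ : ℤ => ‖L.H1 ℓ u μ‖ ^ 2 :=
  (L.summable_sq_comb μ _ _ _).congr fun ℓ => by rw [H1_comb]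

lemma summable_sq_H1_conj (u : Fin 2 → ℝ) (μ : ℝ) :
    Summable fun ℓ : ℤ => ‖starRingEnd ℂ (L.H1 ℓ u μ)‖ ^ 2 :=
  (L.summable_sq_H1 u μ).congr fun ℓ => by rw [norm_conj]

lemma summable_sq_X (u : Fin 2 → ℝ) (μ : ℝ) : Summable fun ℓ : ℤ => ‖L.X ℓ u μ‖ ^ 2 :=
  (L.summable_sq_comb μ _ _ _).congr fun ℓ => by rw [X_comb]

/-- Since Ω ≠ 0, |D_ℓ| tends to infinity with |ℓ| and the inverses tend to 0. Nonresonance is not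
required: a vanishing D_ℓ has inverse 0 here. -/
lemma exists_inv_D_bound (u : Fin 2 → ℝ) : ∃ C : ℝ, ∀ ℓ : ℤ, ‖(L.D ℓ u : ℂ)⁻¹‖ ≤ C := by
  have h1 : Tendsto (fun ℓ : ℤ => (ℓ : ℝ)) cofinite (cocompact ℝ) := Int.tendsto_coe_cofinite
  have h2 : Tendsto (fun x : ℝ => L.kU u + x * L.Omega) (cocompact ℝ) (cocompact ℝ) := by
    have : (fun x : ℝ => L.kU u + x * L.Omega) =
        (Homeomorph.addLeft (L.kU u)) ∘ (Homeomorph.mulRight₀ L.Omega L.Omega_ne) := by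
      funext x; simp
    rw [this]
    exact (Homeomorph.isClosedEmbedding _).tendsto_cocompact.comp
      (Homeomorph.isClosedEmbedding _).tendsto_cocompact
  have h3 : Tendsto (fun ℓ : ℤ => ‖(L.D ℓ u : ℂ)⁻¹‖) cofinite (𝓝 0) := by
    have h4 := (tendsto_inv₀_cobounded (α := ℝ)).comp
      ((Metric.cobounded_eq_cocompact (α := ℝ)).symm ▸ (h2.comp h1))
    have h5 := h4.norm
    rw [norm_zero] at h5
    refine h5.congr fun ℓ => ?_
    simp only [Function.comp_apply, D_eq, norm_inv, norm_real]
  obtain ⟨C, hC⟩ := h3.bddAbove_range_of_cofinite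
  exact ⟨C, fun ℓ => hC ⟨ℓ, rfl⟩⟩

lemma summable_K2TermA {u : Fin 2 → ℝ} {μ : ℝ} (hμ : 0 < μ * L.Omega) :
    Summable fun ℓ : ℤ => L.K2TermA ℓ u μ := by
  obtain ⟨C, hC⟩ := L.exists_inv_D_bound u
  have hC2 : ∀ ℓ : ℤ, ‖(L.D ℓ u : ℂ)⁻¹ ^ 2‖ ≤ C ^ 2 := fun ℓ => by
    rw [norm_pow]; exact pow_le_pow_left₀ (norm_nonneg _) (hC ℓ) 2
  have s1 := (summable_mul_mul_of_sq (L.summable_sq_H1_conj u μ) (L.summable_sq_J μ) hC).mul_left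
    (L.e / (L.m * L.c) * L.kPA)
  have s2 := (summable_mul_mul_of_sq (L.summable_sq_H1_conj u μ) (L.summable_sq_X u μ) hC).mul_left
    (-(L.e / (L.m * L.c) * (I * L.kU u / (L.rho μ * L.Omega ^ 2))))
  have s3 := (summable_mul_mul_of_sq (L.summable_sq_H1 u μ) (L.summable_sq_H1_conj u μ)
    hC2).mul_left (L.kPk / (2 * L.m) : ℂ)
  have s := (hasSum_re ((s1.add s2).add s3).hasSum).summable.mul_left 2
  refine s.congr fun ℓ => ?_
  rw [K2TermA_eq L hμ, addCC]
  congr 2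
  simp only [div_eq_mul_inv, mul_inv, inv_pow]
  ring

/-- The denominator-free difference of the summands of the second and the first form. -/
def diffFA (ℓ : ℤ) (u : Fin 2 → ℝ) (μ : ℝ) : ℂ :=
  L.e ^ 2 / (2 * L.m * L.c ^ 2) * L.APA * (L.J ℓ μ * L.J ℓ μ)
    - I / (2 * L.m * L.Omega) * (L.e / L.c
        * (L.J ℓ μ * L.H1 ℓ u μ * starRingEnd ℂ (L.kperp * (L.aPlus + L.aMinus) / Real.sqrt 2)
          - L.J ℓ μ * starRingEnd ℂ (L.H1 ℓ u μ)
            * (L.kperp * (L.aPlus + L.aMinus) / Real.sqrt 2))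
      + (L.e / L.c) ^ 2 * (L.D ℓ u * (L.J ℓ μ * L.J ℓ μ))
        * (L.AT 2 * starRingEnd ℂ (L.AT 3) - L.AT 3 * starRingEnd ℂ (L.AT 2)))
    + I * L.e ^ 2 / (L.m * L.c ^ 2 * L.rho μ * L.Omega ^ 2) * L.UA u
      * (L.J ℓ μ * starRingEnd ℂ (L.X ℓ u μ))

/-- In Q_ℓ = H_{1ℓ}k + (e/c)D_ℓJ_ℓÃ the second term carries a factor D_ℓ. Expanding the products of
Q, the pieces that keep a denominator are those of (A), up to conjugation; in the F₀ part the
|H_{1ℓ}|² piece drops by antisymmetry, so nothing resonant survives there. -/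
lemma K2TermF_eq_add {ℓ : ℤ} {u : Fin 2 → ℝ} {μ : ℝ} (hμ : 0 < μ * L.Omega)
    (hD : L.D ℓ u ≠ 0) : L.K2TermF ℓ u μ = L.K2TermA ℓ u μ + addCC (L.diffFA ℓ u μ) := by
  have hΩ := L.Omega_neC
  have hρ := L.rho_neC hμ
  have hc := L.c_neC
  have hm := L.m_neC
  have hD' : (L.D ℓ u : ℂ) ≠ 0 := by exact_mod_cast hD
  rw [K2TermF_eq L hμ hD, K2TermA_eq L hμ, ← ofReal_inj]
  push_cast
  simp only [addCC_eq]
  rw [diffFA, ← kT_cross_AT, QU_eq]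
  simp only [Q, kPA, kPk, APA]
  push_cast
  simp only [normSq_eq_conj_mul_self, map_add, map_sub, map_mul, map_div₀, map_pow,
    conj_ofReal, conj_I, conj_J, map_ofNat, conj_conj]
  generalize L.H1 ℓ u μ = h
  generalize L.X ℓ u μ = x
  generalize starRingEnd ℂ h = h'
  generalize starRingEnd ℂ x = x'
  field_simp
  ring

/-- The first moment Σ ℓJ_ℓ² vanishes: by the recurrence it is a sum of products of neighbouring
Bessel functions. -/
lemma hasSum_D_mul_J_sq (u : Fin 2 → ℝ) (μ : ℝ) :
    HasSum (fun ℓ : ℤ => L.D ℓ u * (L.J ℓ μ * L.J ℓ μ) : ℤ → ℂ) (L.kU u) := by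
  have h1 := (L.hasSum_comb_mul μ 1 0 0 1 0 0).mul_left (L.kU u : ℂ)
  have h2 := (L.hasSum_comb_mul μ 1 0 0 0 1 1).mul_left
    (L.Omega * (L.kperp * L.rho μ) / 2 : ℂ)
  refine (congrArg₂ (fun F S => HasSum F S) (funext fun ℓ => ?_) ?_).mpr (h1.add h2)
  · rw [D_eq]
    push_cast
    linear_combination (-L.Omega / 2 * L.J ℓ μ) * L.J_recurrence ℓ μ
  · ring

/-- The nonresonant part of the first form. -/
def nonresA (u : Fin 2 → ℝ) : ℝ :=
  L.e ^ 2 / (2 * L.m * L.c ^ 2)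
      * addCC
        (cdot (conjV L.A) (L.PparC *ᵥ L.A)
          + Complex.I / (L.lamB * L.Omega) * mdot L.k (L.U u)
            * cdot (conjV L.A) (L.F₀C *ᵥ L.A))

lemma nonresA_eq (u : Fin 2 → ℝ) : L.nonresA u = addCC (L.e ^ 2 / (2 * L.m * L.c ^ 2) *
    (L.APA - I / L.Omega * L.kU u *
      (L.AT 2 * starRingEnd ℂ (L.AT 3) - L.AT 3 * starRingEnd ℂ (L.AT 2)))) := by
  have hl := L.lamB_neC
  have hΩ := L.Omega_neC
  have h : (L.e ^ 2 / (2 * L.m * L.c ^ 2) : ℂ) = ((L.e ^ 2 / (2 * L.m * L.c ^ 2) : ℝ) : ℂ) := by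
    push_cast; ring
  rw [nonresA, h, addCC, addCC, re_ofReal_mul, cdot_PparC, cdot_F₀C, mdot_k_U]
  simp only [cdot_tC_conjV]
  rw [mul_left_comm]
  congr 3
  rw [APA]
  push_cast
  simp only [normSq_eq_conj_mul_self, AT]
  field_simp
  ring

lemma hasSum_addCC_diffFA (u : Fin 2 → ℝ) {μ : ℝ} (hμ : 0 < μ * L.Omega) :
    HasSum (fun ℓ : ℤ => addCC (L.diffFA ℓ u μ)) (L.nonresA u) := by
  have hΩ := L.Omega_neC
  have hρ := L.rho_neC hμ
  have hc := L.c_neC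
  have hm := L.m_neC
  set G : ℂ := L.kperp * (L.aPlus + L.aMinus) / Real.sqrt 2 with hG
  have sJ : HasSum (fun ℓ : ℤ => L.J ℓ μ * L.J ℓ μ) 1 := by
    simpa using L.hasSum_J_mul μ 0 0
  have sH : HasSum (fun ℓ : ℤ => L.J ℓ μ * L.H1 ℓ u μ) (-(L.e / L.c) * L.UA u) := by
    have h := L.hasSum_comb_mul μ 1 0 0 (-(L.e / L.c) * L.UA u)
      (-(L.e / L.c) * (I * L.rho μ * L.Omega / Real.sqrt 2) * L.aPlus)
      (L.e / L.c * (I * L.rho μ * L.Omega / Real.sqrt 2) * L.aMinus)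
    simp only [← J_comb, ← H1_comb] at h
    convert h using 1; ring
  have sH' : HasSum (fun ℓ : ℤ => L.J ℓ μ * starRingEnd ℂ (L.H1 ℓ u μ))
      (-(L.e / L.c) * starRingEnd ℂ (L.UA u)) := by
    have h := L.hasSum_comb_mul μ 1 0 0 (-(L.e / L.c) * starRingEnd ℂ (L.UA u))
      (L.e / L.c * (I * L.rho μ * L.Omega / Real.sqrt 2) * starRingEnd ℂ L.aPlus)
      (-(L.e / L.c) * (I * L.rho μ * L.Omega / Real.sqrt 2) * starRingEnd ℂ L.aMinus)
    simp only [← J_comb, ← H1_conj_comb] at h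
    convert h using 1; ring
  have sX : HasSum (fun ℓ : ℤ => L.J ℓ μ * starRingEnd ℂ (L.X ℓ u μ))
      (-(L.rho μ * L.Omega * starRingEnd ℂ G)) := by
    have h := L.hasSum_comb_mul μ 1 0 0
      (starRingEnd ℂ (-(L.rho μ * L.Omega * L.kperp / Real.sqrt 2 * (L.aPlus + L.aMinus))))
      (starRingEnd ℂ (-(I * L.kperp / 2) * L.UA u - L.kU u / Real.sqrt 2 * L.aPlus))
      (starRingEnd ℂ (I * L.kperp / 2 * L.UA u - L.kU u / Real.sqrt 2 * L.aMinus))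
    simp only [← J_comb, ← X_conj_comb] at h
    convert h using 1
    simp only [hG, map_neg, map_mul, map_div₀, conj_ofReal, map_add]; ring
  have h := ((sJ.mul_left (L.e ^ 2 / (2 * L.m * L.c ^ 2) * L.APA : ℂ)).sub
    (((((sH.mul_right (starRingEnd ℂ G)).sub (sH'.mul_right G)).mul_left (L.e / L.c : ℂ)).add
      (((L.hasSum_D_mul_J_sq u μ).mul_left ((L.e / L.c) ^ 2 : ℂ)).mul_right
        (L.AT 2 * starRingEnd ℂ (L.AT 3) - L.AT 3 * starRingEnd ℂ (L.AT 2)))).mul_left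
      (I / (2 * L.m * L.Omega)))).add
    (sX.mul_left (I * L.e ^ 2 / (L.m * L.c ^ 2 * L.rho μ * L.Omega ^ 2) * L.UA u))
  have h2 := (hasSum_re h).mul_left 2
  -- The terms with G, which stem from k·F₀·Ã, cancel once the complex conjugate is added; what is
  -- left is the nonresonant part of (A).
  have e : L.nonresA u = 2 * (L.e ^ 2 / (2 * L.m * L.c ^ 2) * L.APA * 1
      - I / (2 * L.m * L.Omega) * (L.e / L.c * (-(L.e / L.c) * L.UA u * starRingEnd ℂ G
        - -(L.e / L.c) * starRingEnd ℂ (L.UA u) * G) + (L.e / L.c) ^ 2 * L.kU u *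
        (L.AT 2 * starRingEnd ℂ (L.AT 3) - L.AT 3 * starRingEnd ℂ (L.AT 2)))
      + I * L.e ^ 2 / (L.m * L.c ^ 2 * L.rho μ * L.Omega ^ 2) * L.UA u
        * (-(L.rho μ * L.Omega * starRingEnd ℂ G)) : ℂ).re := by
    rw [nonresA_eq]
    change addCC _ = addCC _
    rw [← ofReal_inj, addCC_eq, addCC_eq]
    simp only [map_add, map_sub, map_mul, map_div₀, map_pow, map_neg, conj_ofReal, conj_I,
      map_ofNat, conj_conj, map_one]
    generalize starRingEnd ℂ G = G'
    field_simp
    ring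
  rw [e]
  exact h2

lemma hasSum_K2TermF {u : Fin 2 → ℝ} {μ : ℝ} (hμ : 0 < μ * L.Omega) (hD : ∀ ℓ : ℤ, L.D ℓ u ≠ 0) :
    HasSum (fun ℓ : ℤ => L.K2TermF ℓ u μ) (L.K2FormA u μ) := by
  have h := (L.summable_K2TermA (u := u) hμ).hasSum.add (L.hasSum_addCC_diffFA u hμ)
  rw [add_comm] at h
  exact h.congr_fun fun ℓ => L.K2TermF_eq_add hμ (hD ℓ)

end LocalWave

end OscCenter
end

/-! ### The canonical form equals the first. -/

noncomputable section

namespace OscCenter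

open Complex MeasureTheory
open scoped Real

lemma hasDerivAt_normSq {f : ℝ → ℂ} {f' : ℂ} {x : ℝ} (hf : HasDerivAt f f' x) :
    HasDerivAt (fun t => normSq (f t)) (addCC (starRingEnd ℂ (f x) * f')) x := by
  have hr : HasDerivAt (fun t => (f t).re) f'.re x := reCLM.hasFDerivAt.comp_hasDerivAt x hf
  have hi : HasDerivAt (fun t => (f t).im) f'.im x := imCLM.hasFDerivAt.comp_hasDerivAt x hf
  have h := (hr.mul hr).add (hi.mul hi)
  refine (h.congr_deriv ?_)
  simp [addCC]; ring

namespace LocalWave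

variable (L : LocalWave)

lemma hasDerivAt_rho {μ : ℝ} (hμ : 0 < μ * L.Omega) :
    HasDerivAt L.rho (1 / (L.m * L.Omega * L.rho μ)) μ := by
  have hm := L.m_pos.ne'
  have hΩ := L.Omega_ne
  have hp : 0 < 2 * μ * L.Omega / L.m := div_pos (by linarith) L.m_pos
  have h1 : HasDerivAt (fun s : ℝ => 2 * s * L.Omega / L.m) (2 * L.Omega / L.m) μ := by
    have := (((hasDerivAt_id μ).const_mul 2).mul_const L.Omega).div_const L.m
    simpa using this
  refine ((h1.sqrt hp.ne').div_const L.Omega).congr_deriv ?_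
  have := (Real.sqrt_pos.2 hp).ne'
  rw [rho]
  field_simp

lemma hasDerivAt_J (ℓ : ℤ) {μ : ℝ} (hμ : 0 < μ * L.Omega) :
    HasDerivAt (L.J ℓ) ((L.kperp / (2 * L.m * L.Omega * L.rho μ)) *
      (L.J (ℓ - 1) μ - L.J (ℓ + 1) μ)) μ := by
  have h := (hasDerivAt_besselJ ℓ (L.kperp * L.rho μ)).scomp μ
    ((L.hasDerivAt_rho hμ).const_mul L.kperp)
  refine h.congr_deriv ?_
  rw [real_smul]
  simp only [J]
  push_cast
  have hΩ := L.Omega_neC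
  have hρ := L.rho_neC hμ
  have hm := L.m_neC
  field_simp

/-- Chain rule through ρ and J. The D_ℓ part is split off because it cancels the denominator of
|H_{1ℓ}|²/D_ℓ. -/
lemma hasDerivAt_H1_mu (ℓ : ℤ) (u : Fin 2 → ℝ) {μ : ℝ} (hμ : 0 < μ * L.Omega) :
    HasDerivAt (L.H1 ℓ u) (-(I * L.e / (L.c * L.m * L.Omega * L.rho μ)) *
      (L.X ℓ u μ + L.D ℓ u / Real.sqrt 2 *
        (L.aPlus * L.J (ℓ - 1) μ + L.aMinus * L.J (ℓ + 1) μ))) μ := by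
  have hρ' : HasDerivAt (fun s : ℝ => (L.rho s : ℂ)) ((1 / (L.m * L.Omega * L.rho μ) : ℝ) : ℂ) μ :=
    (L.hasDerivAt_rho hμ).ofReal_comp
  have h := (((L.hasDerivAt_J ℓ hμ).mul_const (L.UA u)).add
    (((hρ'.const_mul I).mul_const (L.Omega : ℂ)).div_const (Real.sqrt 2 : ℂ) |>.mul
      (((L.hasDerivAt_J (ℓ - 1) hμ).const_mul L.aPlus).sub
        ((L.hasDerivAt_J (ℓ + 1) hμ).const_mul L.aMinus)))).const_mul (-(L.e / L.c : ℂ))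
  have e : L.H1 ℓ u = fun s => -(L.e / L.c) * (L.J ℓ s * L.UA u +
      I * L.rho s * L.Omega / Real.sqrt 2 *
      (L.aPlus * L.J (ℓ - 1) s - L.aMinus * L.J (ℓ + 1) s)) := funext fun s => L.H1_eq ℓ u s
  rw [e]
  refine h.congr_deriv ?_
  have hΩ := L.Omega_neC
  have hρ := L.rho_neC hμ
  have hc := L.c_neC
  have hm := L.m_neC
  -- The recurrences at ℓ ∓ 1 eliminate J_{ℓ±2}, which appear when J_{ℓ±1} are differentiated.
  have r1 := L.J_recurrence (ℓ - 1) μ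
  have r2 := L.J_recurrence (ℓ + 1) μ
  rw [sub_add_cancel] at r1
  rw [add_sub_cancel_right] at r2
  rw [X, D_eq]
  simp only [Pi.sub_apply, sub_add_cancel, add_sub_cancel_right]
  generalize L.J (ℓ - 1 - 1) μ = jmm at *
  generalize L.J (ℓ + 1 + 1) μ = jpp at *
  generalize L.J (ℓ - 1) μ = jm at *
  generalize L.J (ℓ + 1) μ = jp at *
  have h2 := sqrt2C_ne
  have hs := sqrt2C_sq
  set s : ℂ := ((Real.sqrt 2 : ℝ) : ℂ)
  push_cast at *
  field_simp
  ring_nf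
  simp only [I_sq]
  linear_combination (-(L.e * L.Omega * I * L.aPlus)) * r1 - (L.e * L.Omega * I * L.aMinus) * r2

lemma kparComp_U (u : Fin 2 → ℝ) (s : ℝ) :
    L.UA (u + s • L.kparComp) = L.UA u + s * L.kPA ∧
      L.kU (u + s • L.kparComp) = L.kU u + s * L.kPk := by
  have h0 : L.kparComp 0 = -L.kT 0 := rfl
  have h1 : L.kparComp 1 = L.kT 1 := rfl
  constructor
  · simp only [UA, kPA, Pi.add_apply, Pi.smul_apply, smul_eq_mul, h0, h1]
    push_cast; ring
  · simp only [kU, kPk, Pi.add_apply, Pi.smul_apply, smul_eq_mul, h0, h1]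
    ring

lemma deriv_W_u (ℓ : ℤ) {u : Fin 2 → ℝ} (μ : ℝ) (hD : L.D ℓ u ≠ 0) :
    deriv (fun s : ℝ => L.W ℓ (u + s • L.kparComp) μ) 0 =
      addCC (-(L.e / L.c) * (starRingEnd ℂ (L.H1 ℓ u μ) * (L.J ℓ μ * L.kPA))) / L.D ℓ u
        - normSq (L.H1 ℓ u μ) * L.kPk / L.D ℓ u ^ 2 := by
  have hH : HasDerivAt (fun s : ℝ => L.H1 ℓ (u + s • L.kparComp) μ)
      (-(L.e / L.c) * (L.J ℓ μ * L.kPA)) 0 := by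
    have e : (fun s : ℝ => L.H1 ℓ (u + s • L.kparComp) μ) =
        fun s : ℝ => L.H1 ℓ u μ + (s : ℂ) * (-(L.e / L.c) * (L.J ℓ μ * L.kPA)) := by
      funext s
      rw [H1_eq, H1_eq, (L.kparComp_U u s).1]; ring
    rw [e]
    have := ((hasDerivAt_id (0 : ℝ)).ofReal_comp.mul_const
      (-(L.e / L.c) * (L.J ℓ μ * L.kPA))).const_add (L.H1 ℓ u μ)
    simpa using this
  have hDd : HasDerivAt (fun s : ℝ => L.D ℓ (u + s • L.kparComp)) L.kPk 0 := by
    have e : (fun s : ℝ => L.D ℓ (u + s • L.kparComp)) = fun s : ℝ => L.D ℓ u + s * L.kPk := by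
      funext s
      rw [D_eq, D_eq, (L.kparComp_U u s).2]; ring
    rw [e]
    simpa using ((hasDerivAt_id (0 : ℝ)).mul_const L.kPk).const_add (L.D ℓ u)
  have h := (hasDerivAt_normSq hH).div hDd (by simpa using hD)
  refine (h.deriv).trans ?_
  simp only [zero_smul, add_zero]
  rw [sub_div, mul_left_comm]
  congr 1
  field_simp

lemma deriv_W_mu (ℓ : ℤ) (u : Fin 2 → ℝ) {μ : ℝ} (hμ : 0 < μ * L.Omega) :
    deriv (fun s : ℝ => L.W ℓ u s) μ =
      addCC (-(I * L.e / (L.c * L.m * L.Omega * L.rho μ)) * (starRingEnd ℂ (L.H1 ℓ u μ) *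
        (L.X ℓ u μ + L.D ℓ u / Real.sqrt 2 *
          (L.aPlus * L.J (ℓ - 1) μ + L.aMinus * L.J (ℓ + 1) μ)))) / L.D ℓ u := by
  have h := (hasDerivAt_normSq (L.hasDerivAt_H1_mu ℓ u hμ)).div_const (L.D ℓ u)
  refine h.deriv.trans ?_
  rw [mul_left_comm]

/-- The denominator-free difference of the summands of the canonical and the first form. -/
def diffCA (ℓ : ℤ) (u : Fin 2 → ℝ) (μ : ℝ) : ℂ :=
  I * L.e / (L.c * L.m * L.Omega ^ 2 * L.rho μ) * (starRingEnd ℂ (L.H1 ℓ u μ) * L.X ℓ u μ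
    + L.Omega / Real.sqrt 2 * (ℓ * (starRingEnd ℂ (L.H1 ℓ u μ) *
      (L.aPlus * L.J (ℓ - 1) μ + L.aMinus * L.J (ℓ + 1) μ))))

/-- The derivative along k_∥ produces the k·P_∥·Ã and k·P_∥·k terms of (A); the μ-derivative
produces X_ℓ. -/
lemma K2TermC_eq_add {ℓ : ℤ} {u : Fin 2 → ℝ} {μ : ℝ} (hμ : 0 < μ * L.Omega)
    (hD : L.D ℓ u ≠ 0) : L.K2TermC ℓ u μ = L.K2TermA ℓ u μ + addCC (L.diffCA ℓ u μ) := by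
  have hΩ := L.Omega_neC
  have hρ := L.rho_neC hμ
  have hc := L.c_neC
  have hm := L.m_neC
  have hD' : (L.D ℓ u : ℂ) ≠ 0 := by exact_mod_cast hD
  rw [K2TermC, deriv_W_u L ℓ μ hD, deriv_W_mu L ℓ u hμ, K2TermA_eq L hμ, ← ofReal_inj]
  push_cast
  simp only [addCC_eq]
  rw [diffCA]
  simp only [normSq_eq_conj_mul_self, map_add, map_sub, map_mul, map_div₀, map_pow, map_neg,
    conj_ofReal, conj_I, conj_J, map_ofNat, conj_conj, map_intCast]
  -- From ℓΩ = D_ℓ - k·U: the k·U part of ℓX_ℓ/D_ℓ is the resonant term of (A), and the D_ℓ part has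
  -- no denominator.
  have hl : (ℓ : ℂ) = (L.D ℓ u - L.kU u) / L.Omega := by
    rw [D_eq]; push_cast; field_simp; ring
  rw [hl]
  have h2 := sqrt2C_ne
  generalize ((Real.sqrt 2 : ℝ) : ℂ) = s at *
  generalize L.H1 ℓ u μ = h
  generalize L.X ℓ u μ = x
  generalize starRingEnd ℂ h = h'
  generalize starRingEnd ℂ x = x'
  generalize (L.D ℓ u : ℂ) = d at *
  field_simp
  ring

/-- The nonresonant part of the canonical form. -/
def nonresC : ℝ := addCC (L.e ^ 2 / (2 * L.m * L.c ^ 2) * cdot L.A (conjV L.A))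

/-- The sum must account for replacing Ã*·P_∥·Ã and the F₀ term by Ã·Ã*. The perpendicular part of
Ã·Ã* is |ê₊·Ã|² + |ê₋·Ã|² and the F₀ term is proportional to their difference, so both can be
compared with the Neumann sums. -/
lemma hasSum_addCC_diffCA (u : Fin 2 → ℝ) {μ : ℝ} (hμ : 0 < μ * L.Omega) :
    HasSum (fun ℓ : ℤ => addCC (L.diffCA ℓ u μ)) (L.nonresA u - L.nonresC) := by
  have hΩ := L.Omega_neC
  have hρ := L.rho_neC hμ
  have hc := L.c_neC
  have hm := L.m_neC
  have s1 := L.hasSum_comb_mul μ (-(L.e / L.c) * starRingEnd ℂ (L.UA u))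
      (L.e / L.c * (I * L.rho μ * L.Omega / Real.sqrt 2) * starRingEnd ℂ L.aPlus)
      (-(L.e / L.c) * (I * L.rho μ * L.Omega / Real.sqrt 2) * starRingEnd ℂ L.aMinus)
      (-(L.rho μ * L.Omega * L.kperp / Real.sqrt 2 * (L.aPlus + L.aMinus)))
      (-(I * L.kperp / 2) * L.UA u - L.kU u / Real.sqrt 2 * L.aPlus)
      (I * L.kperp / 2 * L.UA u - L.kU u / Real.sqrt 2 * L.aMinus)
  simp only [← X_comb, ← H1_conj_comb] at s1
  have s2 := L.hasSum_int_mul_comb_mul μ (-(L.e / L.c) * starRingEnd ℂ (L.UA u))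
      (L.e / L.c * (I * L.rho μ * L.Omega / Real.sqrt 2) * starRingEnd ℂ L.aPlus)
      (-(L.e / L.c) * (I * L.rho μ * L.Omega / Real.sqrt 2) * starRingEnd ℂ L.aMinus)
      L.aPlus L.aMinus
  simp only [← H1_conj_comb] at s2
  have h2 := (hasSum_re ((s1.add (s2.mul_left (L.Omega / Real.sqrt 2 : ℂ))).mul_left
    (I * L.e / (L.c * L.m * L.Omega ^ 2 * L.rho μ)))).mul_left 2
  refine (congrArg₂ (fun F S => HasSum F S) (funext fun ℓ => rfl) ?_).mpr h2
  have hA : cdot L.A (conjV L.A) = L.APA + (L.aPlus * starRingEnd ℂ L.aPlus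
      + L.aMinus * starRingEnd ℂ L.aMinus) := by
    rw [L.cdot_expand, aPlus_conj, aMinus_conj, APA]
    simp only [cdot_tC_conjV]
    push_cast
    simp only [normSq_eq_conj_mul_self, AT]
    linear_combination (cdot (L.tC 3) L.A * starRingEnd ℂ (cdot (L.tC 3) L.A)) * I_sq
  have hW : I * (L.AT 2 * starRingEnd ℂ (L.AT 3) - L.AT 3 * starRingEnd ℂ (L.AT 2)) =
      -(L.aPlus * starRingEnd ℂ L.aPlus - L.aMinus * starRingEnd ℂ L.aMinus) := by
    rw [aPlus_conj, aMinus_conj]; ring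
  rw [nonresC, nonresA_eq, hA]
  change addCC _ - addCC _ = addCC _
  have hW' : I / L.Omega * L.kU u *
      (L.AT 2 * starRingEnd ℂ (L.AT 3) - L.AT 3 * starRingEnd ℂ (L.AT 2)) =
      -(L.kU u / L.Omega * (L.aPlus * starRingEnd ℂ L.aPlus - L.aMinus * starRingEnd ℂ L.aMinus)) := by
    linear_combination (L.kU u / L.Omega : ℂ) * hW
  rw [hW', ← ofReal_inj]
  push_cast
  simp only [addCC_eq]
  simp only [map_add, map_sub, map_mul, map_div₀, map_pow, map_neg, conj_ofReal, conj_I,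
    map_ofNat, conj_conj]
  have h2 := sqrt2C_ne
  have hs := sqrt2C_sq
  generalize ((Real.sqrt 2 : ℝ) : ℂ) = s at *
  generalize starRingEnd ℂ L.aPlus = p'
  generalize starRingEnd ℂ L.aMinus = q'
  generalize starRingEnd ℂ (L.UA u) = v'
  field_simp
  ring_nf
  simp only [I_sq, I_pow_three, hs]
  ring

lemma hasSum_K2TermC {u : Fin 2 → ℝ} {μ : ℝ} (hμ : 0 < μ * L.Omega) (hD : ∀ ℓ : ℤ, L.D ℓ u ≠ 0) :
    HasSum (fun ℓ : ℤ => L.K2TermC ℓ u μ) (L.K2FormA u μ - L.nonresC) := by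
  have h := (L.summable_K2TermA (u := u) hμ).hasSum.add (L.hasSum_addCC_diffCA u hμ)
  have e : (∑' ℓ : ℤ, L.K2TermA ℓ u μ) + (L.nonresA u - L.nonresC)
      = L.K2FormA u μ - L.nonresC := by
    change _ = L.nonresA u + _ - _
    ring
  rw [e] at h
  exact h.congr_fun fun ℓ => L.K2TermC_eq_add hμ (hD ℓ)

/-- Ensures that the derivatives in form (C) are genuine and not the default value of `deriv`. -/
lemma differentiableAt_W (ℓ : ℤ) {u : Fin 2 → ℝ} {μ : ℝ} (hμ : 0 < μ * L.Omega)
    (hD : L.D ℓ u ≠ 0) :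
    DifferentiableAt ℝ (fun p : (Fin 2 → ℝ) × ℝ => L.W ℓ p.1 p.2) (u, μ) := by
  have hJ : ∀ n : ℤ, DifferentiableAt ℝ (fun p : (Fin 2 → ℝ) × ℝ => L.J n p.2) (u, μ) := fun n =>
    DifferentiableAt.comp (𝕜 := ℝ) (u, μ) (f := Prod.snd) (g := L.J n)
      (L.hasDerivAt_J n hμ).differentiableAt differentiableAt_snd
  have hρ : DifferentiableAt ℝ (fun p : (Fin 2 → ℝ) × ℝ => (L.rho p.2 : ℂ)) (u, μ) :=
    DifferentiableAt.comp (𝕜 := ℝ) (u, μ) (f := Prod.snd) (g := fun s => (L.rho s : ℂ))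
      (L.hasDerivAt_rho hμ).ofReal_comp.differentiableAt differentiableAt_snd
  have hu : ∀ i : Fin 2, DifferentiableAt ℝ (fun p : (Fin 2 → ℝ) × ℝ => p.1 i) (u, μ) := fun i => by
    fun_prop
  have huC : ∀ i : Fin 2, DifferentiableAt ℝ (fun p : (Fin 2 → ℝ) × ℝ => (p.1 i : ℂ)) (u, μ) :=
    fun i => ofRealCLM.differentiableAt.comp _ (hu i)
  have hUA : DifferentiableAt ℝ (fun p : (Fin 2 → ℝ) × ℝ => L.UA p.1) (u, μ) :=
    ((huC 0).mul_const _).add ((huC 1).mul_const _)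
  have hkU : DifferentiableAt ℝ (fun p : (Fin 2 → ℝ) × ℝ => L.kU p.1) (u, μ) :=
    ((hu 0).mul_const _).add ((hu 1).mul_const _)
  have hH : DifferentiableAt ℝ (fun p : (Fin 2 → ℝ) × ℝ => L.H1 ℓ p.1 p.2) (u, μ) := by
    simp only [H1_eq, div_eq_mul_inv]
    exact (((hJ ℓ).mul hUA).add ((((hρ.const_mul I).mul_const _).mul_const _).mul
      (((hJ (ℓ - 1)).const_mul _).sub ((hJ (ℓ + 1)).const_mul _)))).const_mul _
  have hre : DifferentiableAt ℝ (fun p : (Fin 2 → ℝ) × ℝ => (L.H1 ℓ p.1 p.2).re) (u, μ) :=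
    reCLM.differentiableAt.comp _ hH
  have him : DifferentiableAt ℝ (fun p : (Fin 2 → ℝ) × ℝ => (L.H1 ℓ p.1 p.2).im) (u, μ) :=
    imCLM.differentiableAt.comp _ hH
  have hDd : DifferentiableAt ℝ (fun p : (Fin 2 → ℝ) × ℝ => L.D ℓ p.1) (u, μ) := by
    simp only [D_eq]
    exact hkU.add (differentiableAt_const _)
  simp only [W, normSq_apply, div_eq_mul_inv]
  exact ((hre.mul hre).add (him.mul him)).mul (hDd.fun_inv hD)

/-- The three explicit forms of the ponderomotive Hamiltonian are convergent and equal. -/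
lemma explicit_forms {u : Fin 2 → ℝ} {μ : ℝ} (hμ : 0 < μ * L.Omega)
    (hD : ∀ ℓ : ℤ, L.D ℓ u ≠ 0) :
    (∀ ℓ : ℤ, DifferentiableAt ℝ (fun p : (Fin 2 → ℝ) × ℝ => L.W ℓ p.1 p.2) (u, μ)) ∧
      Summable (fun ℓ : ℤ => L.K2TermA ℓ u μ) ∧
      Summable (fun ℓ : ℤ => L.K2TermF ℓ u μ) ∧
      Summable (fun ℓ : ℤ => L.K2TermC ℓ u μ) ∧
      L.K2FormF u μ = L.K2FormA u μ ∧ L.K2FormC u μ = L.K2FormA u μ := by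
  refine ⟨fun ℓ => L.differentiableAt_W ℓ hμ (hD ℓ), L.summable_K2TermA hμ,
    (L.hasSum_K2TermF hμ hD).summable, (L.hasSum_K2TermC hμ hD).summable,
    (L.hasSum_K2TermF hμ hD).tsum_eq, ?_⟩
  change L.nonresC + _ = _
  rw [(L.hasSum_K2TermC hμ hD).tsum_eq]
  ring

end LocalWave

end OscCenter
end

noncomputable section

namespace OscCenter

open MeasureTheory

/-! ### Smooth dependence of integrals on parameters. -/

section ParametricIntegral

variable {E : Type*} [NormedAddCommGroup E] [NormedSpace ℝ E] [ProperSpace E]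

/-- Closed balls are compact in a proper space, so the continuous derivative is bounded on a ball
times the interval; this constant is the dominating function. -/
lemma hasFDerivAt_intervalIntegral_of_contDiffOn {F : Type*} [NormedAddCommGroup F]
    [NormedSpace ℝ F] {f : E × ℝ → F} {M : Set E} (hM : IsOpen M)
    (hf : ContDiffOn ℝ ∞ f (M ×ˢ Set.univ)) (a b : ℝ) {x : E} (hx : x ∈ M) :
    HasFDerivAt (fun y => ∫ t in a..b, f (y, t))
      (∫ t in a..b, (fderiv ℝ f (x, t)).comp (ContinuousLinearMap.inl ℝ E ℝ)) x := by
  have hO : IsOpen (M ×ˢ (Set.univ : Set ℝ)) := hM.prod isOpen_univ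
  have hD : ContDiffOn ℝ ∞ (fun p => (fderiv ℝ f p).comp (ContinuousLinearMap.inl ℝ E ℝ))
      (M ×ˢ Set.univ) := (contDiffOn_fderiv hO hf).clm_comp contDiffOn_const
  have hc : ∀ y ∈ M, Continuous fun t => f (y, t) := fun y hy =>
    hf.continuousOn.comp_continuous (by fun_prop) fun t => ⟨hy, trivial⟩
  obtain ⟨r, hr, hball⟩ := Metric.nhds_basis_closedBall.mem_iff.1 (hM.mem_nhds hx)
  obtain ⟨C, hC⟩ := ((isCompact_closedBall x r).prod (isCompact_uIcc (a := a) (b := b))).exists_bound_of_continuousOn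
    (hD.continuousOn.mono (Set.prod_mono hball (Set.subset_univ _)))
  refine intervalIntegral.hasFDerivAt_integral_of_dominated_of_fderiv_le (μ := volume)
    (F := fun y t => f (y, t))
    (F' := fun y t => (fderiv ℝ f (y, t)).comp (ContinuousLinearMap.inl ℝ E ℝ))
    (bound := fun _ => C) (Metric.closedBall_mem_nhds x hr) ?_
    ((hc x hx).intervalIntegrable _ _)
    (hD.continuousOn.comp_continuous (by fun_prop)
      fun t => ⟨hx, trivial⟩).aestronglyMeasurable ?_
    (by simp) ?_
  · filter_upwards [hM.mem_nhds hx] with y hy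
    exact (hc y hy).aestronglyMeasurable
  · refine Eventually.of_forall fun t ht y hy => hC (y, t) ⟨hy, Set.uIoc_subset_uIcc ht⟩
  · refine Eventually.of_forall fun t ht y hy => ?_
    have h1 := (differentiableAt_of_mem hO hf (z := (y, t)) ⟨hball hy, trivial⟩).hasFDerivAt
    exact h1.comp y (hasFDerivAt_prodMk_left y t)

/-- Induction on the order. The target space must vary, because the derivative of the integral is
the integral of a map into E →L F; hence the common universe of E and F. -/
lemma contDiffOn_nat_intervalIntegral {E : Type} [NormedAddCommGroup E] [NormedSpace ℝ E]
    [ProperSpace E] {M : Set E} (hM : IsOpen M) (a b : ℝ) (n : ℕ) :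
    ∀ {F : Type} [NormedAddCommGroup F] [NormedSpace ℝ F] {f : E × ℝ → F},
      ContDiffOn ℝ ∞ f (M ×ˢ Set.univ) → ContDiffOn ℝ n (fun y => ∫ t in a..b, f (y, t)) M := by
  induction n with
  | zero =>
    intro F _ _ f hf
    refine contDiffOn_zero.2 fun x hx => ?_
    exact (hasFDerivAt_intervalIntegral_of_contDiffOn hM hf a b hx).continuousAt.continuousWithinAt
  | succ n ih =>
    intro F _ _ f hf
    have h := fun x hx => hasFDerivAt_intervalIntegral_of_contDiffOn hM hf a b (x := x) hx
    rw [Nat.cast_succ, contDiffOn_succ_iff_fderiv_of_isOpen hM]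
    refine ⟨fun x hx => (h x hx).differentiableAt.differentiableWithinAt, by simp, ?_⟩
    refine (ih (f := fun p => (fderiv ℝ f p).comp (ContinuousLinearMap.inl ℝ E ℝ)) ?_).congr
      fun x hx => (h x hx).fderiv
    exact (contDiffOn_fderiv (hM.prod isOpen_univ) hf).clm_comp contDiffOn_const

/-- Integrals of smooth functions over a compact interval depend smoothly on parameters. -/
lemma contDiffOn_intervalIntegral {E : Type} [NormedAddCommGroup E] [NormedSpace ℝ E]
    [ProperSpace E] {M : Set E} (hM : IsOpen M) (a b : ℝ) {F : Type} [NormedAddCommGroup F]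
    [NormedSpace ℝ F] {f : E × ℝ → F} (hf : ContDiffOn ℝ ∞ f (M ×ˢ Set.univ)) :
    ContDiffOn ℝ ∞ (fun y => ∫ t in a..b, f (y, t)) M :=
  contDiffOn_infty.2 fun n => contDiffOn_nat_intervalIntegral hM a b n hf

end ParametricIntegral

/-! ### Averages of periodic and quasi-periodic functions. -/

section QuasiPeriodic

variable {h : ℝ → ℂ} {T : ℝ} {m : ℂ}

lemma exists_bound_of_quasiPeriodic (hc : Continuous h) (hT : T ≠ 0) (hm : ‖m‖ = 1)
    (hp : ∀ t, h (t + T) = m * h t) : ∃ C, ∀ t, ‖h t‖ ≤ C := by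
  have hper : Function.Periodic (fun t => ‖h t‖) T := fun t => by
    simp only [hp, norm_mul, hm, one_mul]
  obtain ⟨C, hC⟩ := (hper.isBounded_of_continuous hT hc.norm).bddAbove
  exact ⟨C, fun t => hC ⟨t, rfl⟩⟩

/-- A bounded deviation of the primitive from linear growth disappears after division by t. -/
lemma tendsto_average_of_bounded {a : ℂ} (hb : ∃ C, ∀ t : ℝ, ‖(∫ s in (0 : ℝ)..t, h s) - t * a‖ ≤ C) :
    Tendsto (fun t : ℝ => t⁻¹ • ∫ s in (0 : ℝ)..t, h s) atTop (𝓝 a) := by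
  obtain ⟨C, hC⟩ := hb
  have h1 : Tendsto (fun t : ℝ => t⁻¹ • ((∫ s in (0 : ℝ)..t, h s) - t * a)) atTop (𝓝 0) :=
    tendsto_inv_atTop_zero.zero_smul_isBoundedUnder_le (isBoundedUnder_of ⟨C, hC⟩)
  have h2 := h1.add_const a
  rw [zero_add] at h2
  refine h2.congr' ?_
  filter_upwards [eventually_gt_atTop 0] with t ht
  have : (t : ℂ) ≠ 0 := by exact_mod_cast ht.ne'
  rw [smul_sub, Complex.real_smul, Complex.real_smul]
  push_cast
  rw [inv_mul_cancel_left₀ this, sub_add_cancel]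

lemma continuous_primitive (hc : Continuous h) : Continuous fun t : ℝ => ∫ s in (0 : ℝ)..t, h s :=
  intervalIntegral.continuous_primitive (fun _ _ => hc.intervalIntegrable _ _) 0

lemma tendsto_average_of_periodic (hc : Continuous h) (hT : T ≠ 0)
    (hp : ∀ t, h (t + T) = h t) : Tendsto (fun t : ℝ => t⁻¹ • ∫ s in (0 : ℝ)..t, h s) atTop
      (𝓝 ((T : ℂ)⁻¹ * ∫ s in (0 : ℝ)..T, h s)) := by
  have hT' : (T : ℂ) ≠ 0 := by exact_mod_cast hT
  -- With a the mean over one period, ∫₀ᵗ h - ta is itself T-periodic and hence bounded.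
  refine tendsto_average_of_bounded (exists_bound_of_quasiPeriodic (T := T) (m := 1) ?_ hT
    (by simp) fun t => ?_)
  · exact (continuous_primitive hc).sub (by fun_prop)
  · have h1 := intervalIntegral.integral_add_adjacent_intervals
      (hc.intervalIntegrable (μ := volume) 0 t) (hc.intervalIntegrable t (t + T))
    have h2 := Function.Periodic.intervalIntegral_add_eq (f := h) (T := T) hp t 0
    rw [zero_add] at h2
    rw [← h1, h2]
    push_cast
    field_simp
    ring

lemma tendsto_average_of_quasiPeriodic (hc : Continuous h) (hT : T ≠ 0) (hm : ‖m‖ = 1)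
    (hm1 : m ≠ 1) (hp : ∀ t, h (t + T) = m * h t) :
    Tendsto (fun t : ℝ => t⁻¹ • ∫ s in (0 : ℝ)..t, h s) atTop (𝓝 0) := by
  have hm' : 1 - m ≠ 0 := sub_ne_zero.2 hm1.symm
  -- The primitive H satisfies H(t + T) = H(T) + mH(t). The fixed point c of x ↦ H(T) + mx makes H -
  -- c quasi-periodic with the same factor m, hence bounded.
  set c := (∫ s in (0 : ℝ)..T, h s) / (1 - m) with hcdef
  obtain ⟨C, hC⟩ := exists_bound_of_quasiPeriodic (h := fun t => (∫ s in (0 : ℝ)..t, h s) - c)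
    ((continuous_primitive hc).sub continuous_const) hT hm fun t => by
      have h1 := intervalIntegral.integral_add_adjacent_intervals
        (hc.intervalIntegrable (μ := volume) 0 T) (hc.intervalIntegrable T (t + T))
      have h2 : ∫ s in T..(t + T), h s = m * ∫ s in (0 : ℝ)..t, h s := by
        have := intervalIntegral.integral_comp_add_right h T (a := 0) (b := t)
        rw [zero_add] at this
        rw [← this, ← intervalIntegral.integral_const_mul]
        exact intervalIntegral.integral_congr fun s _ => hp s
      have h3 : (∫ s in (0 : ℝ)..T, h s) = c * (1 - m) := by rw [hcdef]; field_simp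
      rw [← h1, h2, h3]
      ring
  refine tendsto_average_of_bounded ⟨C + ‖c‖, fun t => ?_⟩
  rw [mul_zero, sub_zero]
  calc _ = ‖((∫ s in (0 : ℝ)..t, h s) - c) + c‖ := by rw [sub_add_cancel]
    _ ≤ _ := (norm_add_le _ _).trans (by gcongr; exact hC t)

/-- The derivative at `0` of the integral over a sliding window. -/
lemma hasDerivAt_integral_window (hc : Continuous h) (T : ℝ) :
    HasDerivAt (fun τ : ℝ => ∫ s in (0 : ℝ)..T, h (s + τ)) (h T - h 0) 0 := by
  have e : (fun τ : ℝ => ∫ s in (0 : ℝ)..T, h (s + τ)) =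
      fun τ => (∫ s in (0 : ℝ)..(T + τ), h s) - ∫ s in (0 : ℝ)..τ, h s := by
    funext τ
    rw [intervalIntegral.integral_comp_add_right, zero_add,
      intervalIntegral.integral_interval_sub_left (hc.intervalIntegrable _ _)
        (hc.intervalIntegrable _ _)]
  rw [e]
  have h1 : ∀ x : ℝ, HasDerivAt (fun t : ℝ => ∫ s in (0 : ℝ)..t, h s) (h x) x := fun x =>
    intervalIntegral.integral_hasDerivAt_right (hc.intervalIntegrable _ _)
      hc.stronglyMeasurable.stronglyMeasurableAtFilter hc.continuousAt
  have h2 : HasDerivAt (fun τ : ℝ => ∫ s in (0 : ℝ)..(T + τ), h s) (h T) 0 := by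
    have := h1 (T + 0)
    rw [add_zero] at this
    have h3 : HasDerivAt (fun τ : ℝ => T + τ) 1 0 := (hasDerivAt_id (0 : ℝ)).const_add T
    have h4 := HasDerivAt.scomp (0 : ℝ) (h := fun τ : ℝ => T + τ)
      (g₁ := fun t : ℝ => ∫ s in (0 : ℝ)..t, h s) (by simpa using this) h3
    exact h4.congr_deriv (one_smul _ _)
  exact h2.sub (h1 0)

/-- The derivative at `0` of a linearly weighted integral of a periodic function over a sliding
window. -/
lemma hasDerivAt_integral_window_weighted (hc : Continuous h) (hp : ∀ t, h (t + T) = h t) :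
    HasDerivAt (fun τ : ℝ => ∫ s in (0 : ℝ)..T, (s : ℂ) * h (s + τ))
      (T * h 0 - ∫ s in (0 : ℝ)..T, h s) 0 := by
  have hg : Continuous fun s : ℝ => (s : ℂ) * h s := by fun_prop
  -- Write the weight as s = (s + τ) - τ: the first part is an unweighted window integral, and the
  -- integral multiplying τ does not depend on τ by periodicity.
  have e : (fun τ : ℝ => ∫ s in (0 : ℝ)..T, (s : ℂ) * h (s + τ)) = fun τ : ℝ =>
      (∫ s in (0 : ℝ)..T, (fun s : ℝ => (s : ℂ) * h s) (s + τ))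
        - (τ : ℂ) * ∫ s in (0 : ℝ)..T, h s := by
    funext τ
    have h2 := Function.Periodic.intervalIntegral_add_eq (f := h) (T := T) hp τ 0
    rw [zero_add] at h2
    rw [← h2, add_comm τ T]
    nth_rewrite 4 [← zero_add τ]
    rw [← intervalIntegral.integral_comp_add_right, ← intervalIntegral.integral_const_mul,
      ← intervalIntegral.integral_sub]
    · refine intervalIntegral.integral_congr fun s _ => ?_
      push_cast; ring
    · exact Continuous.intervalIntegrable (by fun_prop) _ _
    · exact Continuous.intervalIntegrable (by fun_prop) _ _
  rw [e]
  have h1 := hasDerivAt_integral_window hg T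
  have h2 := ((hasDerivAt_id (0 : ℝ)).ofReal_comp.mul_const (∫ s in (0 : ℝ)..T, h s))
  refine (h1.sub h2).congr_deriv ?_
  have : h T = h 0 := by have := hp 0; rwa [zero_add] at this
  simp [this]

end QuasiPeriodic

end OscCenter
end

/-! ### The guiding-center system is Hamiltonian. -/

noncomputable section

namespace OscCenter

section Minkowski

lemma mdot_add_right (a b d : Fin 4 → ℝ) : mdot a (b + d) = mdot a b + mdot a d := by
  simp only [mdot, Pi.add_apply, ← Finset.sum_add_distrib]
  exact Finset.sum_congr rfl fun i _ => by ring

lemma mdot_smul_right (a : Fin 4 → ℝ) (r : ℝ) (b : Fin 4 → ℝ) : mdot a (r • b) = r * mdot a b := by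
  simp only [mdot, Pi.smul_apply, smul_eq_mul, Finset.mul_sum]
  exact Finset.sum_congr rfl fun i _ => by ring

lemma mdot_sub_right (a b d : Fin 4 → ℝ) : mdot a (b - d) = mdot a b - mdot a d := by
  rw [sub_eq_add_neg, mdot_add_right, ← neg_one_smul ℝ d, mdot_smul_right]; ring

lemma mdot_zero_right (a : Fin 4 → ℝ) : mdot a 0 = 0 := by simp [mdot]

lemma mdot_add_left (a b d : Fin 4 → ℝ) : mdot (a + b) d = mdot a d + mdot b d := by
  rw [LocalWave.mdot_comm, mdot_add_right, LocalWave.mdot_comm d, LocalWave.mdot_comm d]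

lemma mdot_smul_left (r : ℝ) (a b : Fin 4 → ℝ) : mdot (r • a) b = r * mdot a b := by
  rw [LocalWave.mdot_comm, mdot_smul_right, LocalWave.mdot_comm b]

lemma covR_apply (a v : Fin 4 → ℝ) : covR a v = mdot a v := by
  simp [covR, mdot]

lemma covC_apply (a : Fin 4 → ℂ) (v : Fin 4 → ℝ) : covC a v = cdot a (toC v) := by
  simp [covC, cdot, toC]

end Minkowski

namespace LocalWave

variable (L : LocalWave)

lemma vec_expand_real (v : Fin 4 → ℝ) : v = -(mdot (L.tet 0) v) • L.tet 0
    + mdot (L.tet 1) v • L.tet 1 + mdot (L.tet 2) v • L.tet 2 + mdot (L.tet 3) v • L.tet 3 := by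
  have h := L.vec_expand (toC v)
  have hr : ∀ a, cdot (L.tC a) (toC v) = mdot (L.tet a) v := fun a => cdot_toC _ _
  funext i
  have h' := congrFun h i
  simp only [Fin.sum_univ_four, hr] at h'
  simp only [eta, tC, toC, Pi.add_apply, Pi.smul_apply, smul_eq_mul] at h'
  simp only [Pi.add_apply, Pi.smul_apply, smul_eq_mul]
  simp at h'
  rw [neg_mul]
  exact_mod_cast h'

lemma mdot_tet_F₀ (v w : Fin 4 → ℝ) : mdot v (L.F₀ *ᵥ w) =
    L.lamB * (mdot (L.tet 2) v * mdot (L.tet 3) w - mdot (L.tet 3) v * mdot (L.tet 2) w) := by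
  have h := L.cdot_F₀C (toC v) (toC w)
  rw [F₀C, map_mulVec_toC] at h
  simp only [tC, cdot_toC] at h
  exact_mod_cast h

/-- The tetrad components of the `R`-part of a phase-space vector. -/
def comp (a : Fin 4) (v : Phase) : ℝ := mdot (L.tet a) v.1

lemma mdot_U (u : Fin 2 → ℝ) (v : Fin 4 → ℝ) :
    mdot (L.U u) v = u 0 * mdot (L.tet 0) v + u 1 * mdot (L.tet 1) v := by
  rw [U, mdot_add_left, mdot_smul_left, mdot_smul_left]

lemma system_γ_apply (z v : Phase) : L.system.γ z v =
    L.e / (L.ε * L.c) * (-(1 / 2) * (L.lamB * (L.comp 2 v * L.comp 3 z - L.comp 3 v * L.comp 2 z)))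
      + L.m * (z.2.1 0 * L.comp 0 v + z.2.1 1 * L.comp 1 v) + L.ε * z.2.2.1 * v.2.2.2 := by
  change (covR ((L.e / (L.ε * L.c)) • L.A₀ z.1 + L.m • L.U z.2.1)) v.1
    + (L.ε * z.2.2.1) * v.2.2.2 = _
  rw [covR_apply, mdot_add_left, mdot_smul_left, mdot_smul_left, mdot_U, A₀, mdot_smul_left,
    mdot_comm (L.F₀ *ᵥ z.1), mdot_tet_F₀]
  rfl

lemma comp_add (a : Fin 4) (v w : Phase) : L.comp a (v + w) = L.comp a v + L.comp a w :=
  mdot_add_right _ _ _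

lemma comp_smul (a : Fin 4) (r : ℝ) (v : Phase) : L.comp a (r • v) = r * L.comp a v :=
  mdot_smul_right _ _ _

/-- The action one-form of the guiding center depends linearly on the point. -/
def γLinear : Phase →L[ℝ] Phase →L[ℝ] ℝ := LinearMap.toContinuousLinearMap
  { toFun := L.system.γ
    map_add' := fun z w => by
      refine ContinuousLinearMap.ext fun v => ?_
      simp only [_root_.add_apply, system_γ_apply, comp_add, Prod.snd_add, Prod.fst_add,
        Pi.add_apply]
      ring
    map_smul' := fun r z => by
      refine ContinuousLinearMap.ext fun v => ?_
      simp only [_root_.smul_apply, system_γ_apply, comp_smul, Prod.smul_snd, Prod.smul_fst,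
        Pi.smul_apply, smul_eq_mul, RingHom.id_apply]
      ring }

lemma system_γ_eq : L.system.γ = L.γLinear := rfl

/-- The action form is linear in the point, so ω_gc is constant; eλ_B/c = mΩ_B makes the magnetic
part the coefficient mΩ_B/ε. -/
lemma dForm_system_γ (z a b : Phase) : dForm L.system.γ z a b =
    L.m * L.Omega / L.ε * (L.comp 2 a * L.comp 3 b - L.comp 3 a * L.comp 2 b)
      + L.m * (a.2.1 0 * L.comp 0 b + a.2.1 1 * L.comp 1 b
        - b.2.1 0 * L.comp 0 a - b.2.1 1 * L.comp 1 a)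
      + L.ε * (a.2.2.1 * b.2.2.2 - b.2.2.1 * a.2.2.2) := by
  have hΩ : L.m * L.Omega = L.e * L.lamB / L.c := by
    rw [eq_div_iff L.c_pos.ne', ← L.Omega_mul]; ring
  have hf : fderiv ℝ L.system.γ z = L.γLinear := by
    rw [system_γ_eq]; exact L.γLinear.hasFDerivAt.fderiv
  have h : ∀ a b, L.γLinear a b = L.system.γ a b := fun _ _ => rfl
  rw [dForm_apply, hf, h, h, system_γ_apply, system_γ_apply, hΩ]
  have := L.c_pos.ne'
  have := L.ε_pos.ne'
  field_simp
  ring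

/-- The coordinate vector along `ê_a`. -/
def eR (a : Fin 4) : Phase := (L.tet a, 0, 0, 0)

/-- The coordinate vector of `uⁱ`. -/
def eu (i : Fin 2) : Phase := (0, Pi.single i 1, 0, 0)

/-- The coordinate vector of `μ`. -/
def eμ : Phase := (0, 0, 1, 0)

/-- The coordinate vector of `θ`. -/
def eθ : Phase := (0, 0, 0, 1)

lemma phase_expand (v : Phase) : v = -(L.comp 0 v) • L.eR 0 + L.comp 1 v • L.eR 1
    + L.comp 2 v • L.eR 2 + L.comp 3 v • L.eR 3 + v.2.1 0 • eu 0 + v.2.1 1 • eu 1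
    + v.2.2.1 • eμ + v.2.2.2 • eθ := by
  refine Prod.ext ?_ (Prod.ext ?_ (Prod.ext ?_ ?_))
  · simpa [eR, eu, eμ, eθ, comp] using L.vec_expand_real v.1
  · funext i; fin_cases i <;> simp [eR, eu, eμ, eθ]
  · simp [eR, eu, eμ, eθ]
  · simp [eR, eu, eμ, eθ]

lemma comp_eR (a b : Fin 4) : L.comp a (L.eR b) = if a = b then eta a else 0 :=
  L.tet_orthonormal a b

lemma comp_eu (a : Fin 4) (i : Fin 2) : L.comp a (eu i) = 0 := mdot_zero_right _
lemma comp_eμ (a : Fin 4) : L.comp a eμ = 0 := mdot_zero_right _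
lemma comp_eθ (a : Fin 4) : L.comp a eθ = 0 := mdot_zero_right _

lemma map_phase_expand {F : Type*} [NormedAddCommGroup F] [NormedSpace ℝ F] (φ : Phase →L[ℝ] F)
    (v : Phase) : φ v = -(L.comp 0 v) • φ (L.eR 0) + L.comp 1 v • φ (L.eR 1)
    + L.comp 2 v • φ (L.eR 2) + L.comp 3 v • φ (L.eR 3) + v.2.1 0 • φ (eu 0)
    + v.2.1 1 • φ (eu 1) + v.2.2.1 • φ eμ + v.2.2.2 • φ eθ := by
  conv_lhs => rw [L.phase_expand v]
  simp only [map_add, map_smul]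

/-- The vector that corresponds to a covector under the Lagrangian two-form `ω_gc`. -/
def sharp (φ : Phase →L[ℝ] ℝ) : Phase :=
  (φ (eu 0) / L.m) • L.eR 0 + (-(φ (eu 1) / L.m)) • L.eR 1
    + (L.ε / (L.m * L.Omega) * φ (L.eR 3)) • L.eR 2
    + (-(L.ε / (L.m * L.Omega) * φ (L.eR 2))) • L.eR 3
    + (-(φ (L.eR 0) / L.m)) • eu 0 + (φ (L.eR 1) / L.m) • eu 1
    + (φ eθ / L.ε) • eμ + (-(φ eμ / L.ε)) • eθ

lemma map_sharp (ψ φ : Phase →L[ℝ] ℝ) : ψ (L.sharp φ) =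
    (φ (eu 0) * ψ (L.eR 0) - φ (eu 1) * ψ (L.eR 1)) / L.m
    + L.ε / (L.m * L.Omega) * (φ (L.eR 3) * ψ (L.eR 2) - φ (L.eR 2) * ψ (L.eR 3))
    + (φ (L.eR 1) * ψ (eu 1) - φ (L.eR 0) * ψ (eu 0)) / L.m
    + (φ eθ * ψ eμ - φ eμ * ψ eθ) / L.ε := by
  simp only [sharp, map_add, map_smul, smul_eq_mul]
  ring

lemma dForm_sharp (z : Phase) (φ : Phase →L[ℝ] ℝ) : dForm L.system.γ z (L.sharp φ) = φ := by
  have hm := L.m_pos.ne'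
  have hε := L.ε_pos.ne'
  have hΩ := L.Omega_ne
  refine ContinuousLinearMap.ext fun v => ?_
  rw [L.map_phase_expand φ v, dForm_system_γ]
  have c : ∀ a, L.comp a (L.sharp φ) = (φ (eu 0) / L.m) * L.comp a (L.eR 0)
      + (-(φ (eu 1) / L.m)) * L.comp a (L.eR 1)
      + (L.ε / (L.m * L.Omega) * φ (L.eR 3)) * L.comp a (L.eR 2)
      + (-(L.ε / (L.m * L.Omega) * φ (L.eR 2))) * L.comp a (L.eR 3) := fun a => by
    simp only [sharp, comp_add, comp_smul, comp_eu, comp_eμ, comp_eθ]; ring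
  have c0 : L.comp 0 (L.sharp φ) = -(φ (eu 0) / L.m) := by simp [c, comp_eR, eta]
  have c1 : L.comp 1 (L.sharp φ) = -(φ (eu 1) / L.m) := by simp [c, comp_eR, eta]
  have c2 : L.comp 2 (L.sharp φ) = L.ε / (L.m * L.Omega) * φ (L.eR 3) := by simp [c, comp_eR, eta]
  have c3 : L.comp 3 (L.sharp φ) = -(L.ε / (L.m * L.Omega) * φ (L.eR 2)) := by
    simp [c, comp_eR, eta]
  have d0 : (L.sharp φ).2.1 0 = -(φ (L.eR 0) / L.m) := by simp [sharp, eR, eu, eμ, eθ]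
  have d1 : (L.sharp φ).2.1 1 = φ (L.eR 1) / L.m := by simp [sharp, eR, eu, eμ, eθ]
  have dμ : (L.sharp φ).2.2.1 = φ eθ / L.ε := by simp [sharp, eR, eu, eμ, eθ]
  have dt : (L.sharp φ).2.2.2 = -(φ eμ / L.ε) := by simp [sharp, eR, eu, eμ, eθ]
  rw [c0, c1, c2, c3, d0, d1, dμ, dt]
  simp only [smul_eq_mul]
  field_simp
  ring

/-- Surjectivity is the explicit inverse `sharp`; injectivity comes from pairing with the eight
coordinate vectors. -/
lemma dForm_bijective (z : Phase) : Function.Bijective (dForm L.system.γ z) := by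
  have hm := L.m_pos.ne'
  have hε := L.ε_pos.ne'
  have hΩ := L.Omega_ne
  have hmΩ : L.m * L.Omega / L.ε ≠ 0 := by positivity
  refine ⟨(injective_iff_map_eq_zero _).2 fun a ha => ?_, fun φ => ⟨_, L.dForm_sharp z φ⟩⟩
  have h : ∀ b, dForm L.system.γ z a b = 0 := fun b => by rw [ha]; rfl
  have h0 := h (L.eR 0); have h1 := h (L.eR 1); have h2 := h (L.eR 2); have h3 := h (L.eR 3)
  have h4 := h (eu 0); have h5 := h (eu 1); have h6 := h eμ; have h7 := h eθ
  simp only [dForm_system_γ, comp_eR, comp_eu, comp_eμ, comp_eθ] at h0 h1 h2 h3 h4 h5 h6 h7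
  simp [eR, eu, eμ, eθ, eta, hm, hε, hΩ] at h0 h1 h2 h3 h4 h5 h6 h7
  rw [L.phase_expand a, h0, h1, h2, h3, h4, h5, h6, h7]
  simp

lemma mdot_U_U (u : Fin 2 → ℝ) : mdot (L.U u) (L.U u) = u 1 ^ 2 - u 0 ^ 2 := by
  rw [mdot_U, mdot_comm (L.tet 0), mdot_comm (L.tet 1), mdot_U, mdot_U]
  simp [L.tet_orthonormal, eta]
  ring

lemma system_H_eq : L.system.H =
    fun z : Phase => L.m / 2 * (z.2.1 1 ^ 2 - z.2.1 0 ^ 2) + z.2.2.1 * L.Omega := by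
  funext z
  change L.m / 2 * mdot (L.U z.2.1) (L.U z.2.1) + _ = _
  rw [mdot_U_U]

/-- Nonresonance says that -2k·U/Ω_B avoids ℤ, a closed subset of the line. -/
lemma isOpen_system_M : IsOpen L.system.M := by
  have h1 : IsOpen {z : Phase | 0 < z.2.2.1 * L.Omega} :=
    isOpen_lt continuous_const (by fun_prop)
  have h2 : IsClosed (Set.range ((↑) : ℤ → ℝ)) := Int.isClosedEmbedding_coe_real.isClosed_range
  have hk : Continuous fun z : Phase => -(2 * L.kU z.2.1) / L.Omega := by
    unfold kU; fun_prop
  have h3 := h1.inter (h2.isOpen_compl.preimage hk)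
  convert h3 using 1
  ext z
  simp only [system, Set.mem_ofPred_eq, Set.mem_inter_iff, Set.mem_preimage, Set.mem_compl_iff,
    Set.mem_range, not_exists, mdot_k_U]
  refine and_congr_right fun _ => forall_congr' fun n => not_congr ?_
  rw [eq_div_iff L.Omega_ne]
  constructor <;> intro h <;> linarith

lemma system_vel (z : Phase) : L.system.vel z = (L.U z.2.1, 0, 0, L.Omega / L.ε) := rfl

lemma system_flow (t : ℝ) (z : Phase) : L.system.flow t z =
    (z.1 + t • L.U z.2.1, z.2.1, z.2.2.1, z.2.2.2 + t * (L.Omega / L.ε)) := rfl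

lemma comp_vel (z : Phase) (a : Fin 4) : L.comp a (L.system.vel z) =
    z.2.1 0 * mdot (L.tet a) (L.tet 0) + z.2.1 1 * mdot (L.tet a) (L.tet 1) := by
  change mdot (L.tet a) (L.U z.2.1) = _
  rw [mdot_comm, mdot_U, mdot_comm, mdot_comm (L.tet 1)]

lemma isHamiltonian_system : L.system.IsHamiltonian where
  isOpen := L.isOpen_system_M
  smooth_γ := by rw [system_γ_eq]; exact L.γLinear.contDiff.contDiffOn
  smooth_H := by
    rw [system_H_eq]
    refine ContDiff.contDiffOn ?_
    fun_prop
  nondegenerate z _ := L.dForm_bijective z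
  hamilton z _ := by
    have hm := L.m_pos.ne'
    have hε := L.ε_pos.ne'
    refine ContinuousLinearMap.ext fun v => ?_
    have hd : HasFDerivAt L.system.H
        ((L.m / 2) • ((2 * z.2.1 1) • ((ContinuousLinearMap.proj (R := ℝ) (φ := fun _ : Fin 2 => ℝ)
          1).comp ((ContinuousLinearMap.fst ℝ (Fin 2 → ℝ) (ℝ × ℝ)).comp
            (ContinuousLinearMap.snd ℝ (Fin 4 → ℝ) _)))
          - (2 * z.2.1 0) • ((ContinuousLinearMap.proj (R := ℝ) (φ := fun _ : Fin 2 => ℝ)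
          0).comp ((ContinuousLinearMap.fst ℝ (Fin 2 → ℝ) (ℝ × ℝ)).comp
            (ContinuousLinearMap.snd ℝ (Fin 4 → ℝ) _))))
        + L.Omega • ((ContinuousLinearMap.fst ℝ ℝ ℝ).comp
          ((ContinuousLinearMap.snd ℝ (Fin 2 → ℝ) (ℝ × ℝ)).comp
            (ContinuousLinearMap.snd ℝ (Fin 4 → ℝ) _)))) z := by
      rw [system_H_eq]
      have p : ∀ i : Fin 2, HasFDerivAt (fun z : Phase => z.2.1 i)
          ((ContinuousLinearMap.proj (R := ℝ) (φ := fun _ : Fin 2 => ℝ) i).comp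
            ((ContinuousLinearMap.fst ℝ (Fin 2 → ℝ) (ℝ × ℝ)).comp
            (ContinuousLinearMap.snd ℝ (Fin 4 → ℝ) _))) z := fun i =>
        ((ContinuousLinearMap.proj (R := ℝ) (φ := fun _ : Fin 2 => ℝ) i).comp
            ((ContinuousLinearMap.fst ℝ (Fin 2 → ℝ) (ℝ × ℝ)).comp
            (ContinuousLinearMap.snd ℝ (Fin 4 → ℝ) _))).hasFDerivAt
      have q : HasFDerivAt (fun z : Phase => z.2.2.1) ((ContinuousLinearMap.fst ℝ ℝ ℝ).comp
          ((ContinuousLinearMap.snd ℝ (Fin 2 → ℝ) (ℝ × ℝ)).comp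
            (ContinuousLinearMap.snd ℝ (Fin 4 → ℝ) _))) z := ((ContinuousLinearMap.fst ℝ ℝ ℝ).comp
          ((ContinuousLinearMap.snd ℝ (Fin 2 → ℝ) (ℝ × ℝ)).comp
            (ContinuousLinearMap.snd ℝ (Fin 4 → ℝ) _))).hasFDerivAt
      refine ((((p 1).pow 2).sub ((p 0).pow 2)).const_mul (L.m / 2)).add (q.mul_const L.Omega)
        |>.congr_fderiv ?_
      refine ContinuousLinearMap.ext fun v => ?_
      simp
    rw [dForm_system_γ, _root_.neg_apply, hd.fderiv]
    simp only [comp_vel, L.tet_orthonormal]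
    simp [system_vel, eta]
    field_simp
    ring
  -- M is cut out by conditions on u and μ alone, and these are constants of the motion.
  flow_mem z hz t := hz
  flow_zero z _ := by simp [system_flow]
  flow_add z _ s t := by
    simp only [system_flow]
    refine Prod.ext ?_ (Prod.ext rfl (Prod.ext rfl ?_))
    · simp only [add_smul]; abel
    · simp only []; ring
  flow_deriv z _ t := by
    simp only [system_flow, system_vel]
    have h1 : HasDerivAt (fun s : ℝ => z.1 + s • L.U z.2.1) (L.U z.2.1) t := by
      simpa using ((hasDerivAt_id t).smul_const (L.U z.2.1)).const_add z.1
    have h2 : HasDerivAt (fun s : ℝ => z.2.2.2 + s * (L.Omega / L.ε)) (L.Omega / L.ε) t := by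
      simpa using ((hasDerivAt_id t).mul_const (L.Omega / L.ε)).const_add z.2.2.2
    exact h1.prodMk ((hasDerivAt_const t z.2.1).prodMk ((hasDerivAt_const t z.2.2.1).prodMk h2))

end LocalWave

end OscCenter
end

/-! ### Harmonics of the wave and the inversion of the orbit derivative. -/

noncomputable section

namespace OscCenter

open Complex MeasureTheory
open scoped Real

namespace LocalWave

variable (L : LocalWave)

/-- The phase factor that a translation of `R` by `r` gives to the `σ`-th harmonic of the wave. -/
def phase (σ : ℤ) (r : Fin 4 → ℝ) : ℂ := exp (I * σ * mdot L.k r / L.ε)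

/-- `f` is a `σ`-th harmonic of the wave: a translation in `R` multiplies it by a phase factor, and
it is periodic in the gyrophase. -/
def IsWave (σ : ℤ) (f : Phase → ℂ) : Prop :=
  (∀ (r : Fin 4 → ℝ) (z : Phase), f (z + (r, 0, 0, 0)) = L.phase σ r * f z) ∧
    ∀ z : Phase, f (z + (0, 0, 0, 2 * π)) = f z

variable {L}

lemma IsWave.mul {σ τ : ℤ} {f g : Phase → ℂ} (hf : L.IsWave σ f) (hg : L.IsWave τ g) :
    L.IsWave (σ + τ) fun z => f z * g z := by
  refine ⟨fun r z => ?_, fun z => by simp only [hf.2, hg.2]⟩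
  have : L.phase (σ + τ) r = L.phase σ r * L.phase τ r := by
    rw [phase, phase, phase, ← exp_add]; congr 1; push_cast; ring
  simp only [hf.1, hg.1, this]
  ring

lemma IsWave.conj {σ : ℤ} {f : Phase → ℂ} (hf : L.IsWave σ f) :
    L.IsWave (-σ) fun z => starRingEnd ℂ (f z) := by
  refine ⟨fun r z => ?_, fun z => by simp only [hf.2]⟩
  have : starRingEnd ℂ (L.phase σ r) = L.phase (-σ) r := by
    rw [phase, phase, ← exp_conj]; congr 1
    simp only [map_div₀, map_mul, conj_I, conj_ofReal, map_intCast]; push_cast; ring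
  simp only [hf.1, map_mul, this]

lemma IsWave.add {σ : ℤ} {f g : Phase → ℂ} (hf : L.IsWave σ f) (hg : L.IsWave σ g) :
    L.IsWave σ fun z => f z + g z :=
  ⟨fun r z => by simp only [hf.1, hg.1]; ring, fun z => by simp only [hf.2, hg.2]⟩

lemma IsWave.const_mul {σ : ℤ} {f : Phase → ℂ} (hf : L.IsWave σ f) (a : ℂ) :
    L.IsWave σ fun z => a * f z :=
  ⟨fun r z => by simp only [hf.1]; ring, fun z => by simp only [hf.2]⟩

lemma IsWave.sub {σ : ℤ} {f g : Phase → ℂ} (hf : L.IsWave σ f) (hg : L.IsWave σ g) :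
    L.IsWave σ fun z => f z - g z :=
  ⟨fun r z => by simp only [hf.1, hg.1]; ring, fun z => by simp only [hf.2, hg.2]⟩

/-- Differentiation commutes with the translations that define a harmonic. -/
lemma IsWave.fderiv {σ : ℤ} {f : Phase → ℂ} (hf : L.IsWave σ f) (v : Phase) :
    L.IsWave σ fun z => fderiv ℝ f z v := by
  refine ⟨fun r z => ?_, fun z => ?_⟩
  · have h : (fun y : Phase => f (y + (r, 0, 0, 0))) = L.phase σ r • f := by
      funext y; exact hf.1 r y
    have h2 := congrArg (fun g => _root_.fderiv ℝ g z) h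
    simp only [fderiv_comp_add_right, fderiv_const_smul_field] at h2
    exact congrArg (fun φ : Phase →L[ℝ] ℂ => φ v) h2
  · have h : (fun y : Phase => f (y + (0, 0, 0, 2 * π))) = f := funext hf.2
    have h2 := congrArg (fun g => _root_.fderiv ℝ g z) h
    simp only [fderiv_comp_add_right] at h2
    exact congrArg (fun φ : Phase →L[ℝ] ℂ => φ v) h2

/-- A function of `u` and `μ` alone is a harmonic of order zero. -/
lemma isWave_of_action (a : (Fin 2 → ℝ) → ℝ → ℂ) : L.IsWave 0 fun z => a z.2.1 z.2.2.1 :=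
  ⟨fun r z => by simp [phase], fun z => by simp⟩

lemma IsWave.action_mul {σ : ℤ} {f : Phase → ℂ} (hf : L.IsWave σ f) (a : (Fin 2 → ℝ) → ℝ → ℂ) :
    L.IsWave σ fun z => a z.2.1 z.2.2.1 * f z := by
  simpa using (isWave_of_action a).mul hf

variable (L)

/-- The gyroperiod. -/
def period : ℝ := 2 * π * L.ε / L.Omega

/-- The period has the sign of Ω_B and is negative for a negative charge; only its nonvanishing
matters below. -/
lemma period_ne : L.period ≠ 0 :=
  div_ne_zero (by have := L.ε_pos; positivity) L.Omega_ne

/-- The phase that the `σ`-th harmonic of the wave gains along an orbit in a gyroperiod. -/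
def rot (σ : ℤ) (u : Fin 2 → ℝ) : ℂ := exp (((2 * π * (σ * L.kU u / L.Omega) : ℝ) : ℂ) * I)

lemma norm_rot (σ : ℤ) (u : Fin 2 → ℝ) : ‖L.rot σ u‖ = 1 := norm_exp_ofReal_mul_I _

lemma rot_zero (u : Fin 2 → ℝ) : L.rot 0 u = 1 := by simp [rot]

variable {L}

/-- rot = 1 would mean σk·U = nΩ_B. The second harmonic is the reason for the factor 2 in the
definition of M; the first is excluded by even multiples of Ω_B. -/
lemma rot_ne_one {σ : ℤ} (hσ : σ = 1 ∨ σ = 2) {z : Phase} (hz : z ∈ L.system.M) :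
    L.rot σ z.2.1 ≠ 1 := by
  intro h
  obtain ⟨n, hn⟩ := Complex.exp_eq_one_iff.1 h
  have h1 : ((2 * π * (σ * L.kU z.2.1 / L.Omega) : ℝ) : ℂ) = ((n * (2 * π) : ℝ) : ℂ) := by
    have := mul_right_cancel₀ I_ne_zero (hn.trans (by ring :
      (n : ℂ) * (2 * π * I) = (n * (2 * π)) * I))
    rw [this]; push_cast; ring
  have h2 : 2 * π * (σ * L.kU z.2.1 / L.Omega) = n * (2 * π) := by exact_mod_cast h1
  have h3 : σ * L.kU z.2.1 = n * L.Omega := by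
    have h4 : σ * L.kU z.2.1 / L.Omega = n := by
      have := Real.pi_pos
      have := mul_left_cancel₀ (by positivity : (2 * π) ≠ 0) (h2.trans (mul_comm _ _))
      exact this
    rwa [div_eq_iff L.Omega_ne] at h4
  rcases hσ with rfl | rfl
  · refine hz.2 (-2 * n) ?_
    rw [mdot_k_U]; push_cast at h3 ⊢; linarith
  · refine hz.2 (-n) ?_
    rw [mdot_k_U]; push_cast at h3 ⊢; linarith

lemma mdot_k_smul_U (t : ℝ) (u : Fin 2 → ℝ) : mdot L.k (t • L.U u) = t * L.kU u := by
  rw [mdot_smul_right, mdot_k_U]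

/-- One gyroperiod advances θ by 2π, which is invisible, and translates R along U, which multiplies
a harmonic by a phase. -/
lemma IsWave.flow_add_period {σ : ℤ} {f : Phase → ℂ} (hf : L.IsWave σ f) (z : Phase) (t : ℝ) :
    f (L.system.flow (t + L.period) z) = L.rot σ z.2.1 * f (L.system.flow t z) := by
  have hΩ := L.Omega_ne
  have hε := L.ε_pos.ne'
  have e : L.system.flow (t + L.period) z =
      (L.system.flow t z + (L.period • L.U z.2.1, 0, 0, 0)) + (0, 0, 0, 2 * π) := by
    simp only [system_flow]
    refine Prod.ext ?_ (Prod.ext ?_ (Prod.ext ?_ ?_))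
    · simp [add_smul, add_assoc]
    · simp
    · simp
    · simp only [Prod.snd_add, period]; field_simp; ring
  rw [e, hf.2, hf.1, phase, rot, mdot_k_smul_U]
  congr 2
  have := L.Omega_neC
  have := L.ε_neC
  simp only [period]
  push_cast
  field_simp

lemma continuous_comp_flow {f : Phase → ℂ} (hf : ContDiffOn ℝ ∞ f L.system.M) {z : Phase}
    (hz : z ∈ L.system.M) : Continuous fun t => f (L.system.flow t z) :=
  L.isHamiltonian_system.continuous_comp_orbit hf hz

lemma contDiffOn_comp_flow {f : Phase → ℂ} (hf : ContDiffOn ℝ ∞ f L.system.M) :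
    ContDiffOn ℝ ∞ (fun p : Phase × ℝ => f (L.system.flow p.2 p.1)) (L.system.M ×ˢ Set.univ) := by
  refine hf.comp (ContDiff.contDiffOn ?_) fun p hp => hp.1
  simp only [system_flow, U]
  fun_prop

lemma fderiv_vel_eq {F : Type*} [NormedAddCommGroup F] [NormedSpace ℝ F] {S : Phase → F}
    (hS : ContDiffOn ℝ ∞ S L.system.M) {z : Phase}
    (hz : z ∈ L.system.M) {a : F} (h : HasDerivAt (fun t => S (L.system.flow t z)) a 0) :
    fderiv ℝ S z (L.system.vel z) = a := by
  have hP := L.isHamiltonian_system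
  have h1 := hP.flow_deriv z hz 0
  have h2 : HasFDerivAt S (fderiv ℝ S z) (L.system.flow 0 z) := by
    rw [hP.flow_zero z hz]
    exact (differentiableAt_of_mem hP.isOpen hS hz).hasFDerivAt
  have h3 := h2.comp_hasDerivAt (0 : ℝ) h1
  rw [hP.flow_zero z hz] at h3
  exact h3.unique h

/-- Derivative along the orbits of a harmonic of nonzero order, inverted. -/
def solve (L : LocalWave) (σ : ℤ) (f : Phase → ℂ) (z : Phase) : ℂ :=
  (L.rot σ z.2.1 - 1)⁻¹ * ∫ s in (0 : ℝ)..L.period, f (L.system.flow s z)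

lemma contDiffOn_solve {σ : ℤ} (hσ : σ = 1 ∨ σ = 2) {f : Phase → ℂ}
    (hf : ContDiffOn ℝ ∞ f L.system.M) : ContDiffOn ℝ ∞ (L.solve σ f) L.system.M := by
  have h1 : ContDiffOn ℝ ∞ (fun z => (L.rot σ z.2.1 - 1)⁻¹) L.system.M := by
    refine ContDiffOn.inv (ContDiff.contDiffOn ?_) fun z hz => sub_ne_zero.2 (rot_ne_one hσ hz)
    have : ContDiff ℝ ∞ fun z : Phase => 2 * π * (σ * L.kU z.2.1 / L.Omega) := by
      unfold kU; fun_prop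
    exact (((ofRealCLM.contDiff.comp this).mul contDiff_const).cexp).sub contDiff_const
  exact h1.mul (contDiffOn_intervalIntegral L.isOpen_system_M 0 L.period (contDiffOn_comp_flow hf))

lemma flow_translate (s : ℝ) (z : Phase) (r : Fin 4 → ℝ) (x : ℝ) :
    L.system.flow s (z + (r, 0, 0, x)) = L.system.flow s z + (r, 0, 0, x) := by
  simp only [system_flow]
  refine Prod.ext ?_ (Prod.ext ?_ (Prod.ext ?_ ?_))
  · simp only [Prod.fst_add, Prod.snd_add, add_zero]; abel
  · simp
  · simp
  · simp only [Prod.snd_add]; ring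

lemma IsWave.integral {σ : ℤ} {f : Phase → ℂ} (hf : L.IsWave σ f) (w : ℝ → ℂ) :
    L.IsWave σ fun z => ∫ s in (0 : ℝ)..L.period, w s * f (L.system.flow s z) := by
  refine ⟨fun r z => ?_, fun z => ?_⟩
  · simp only [flow_translate, hf.1]
    rw [← intervalIntegral.integral_const_mul]
    exact intervalIntegral.integral_congr fun s _ => by ring
  · simp only [flow_translate, hf.2]

lemma IsWave.solve {σ : ℤ} {f : Phase → ℂ} (hf : L.IsWave σ f) : L.IsWave σ (L.solve σ f) := by
  have h := (hf.integral fun _ => 1).action_mul fun u _ => (L.rot σ u - 1)⁻¹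
  simp only [one_mul] at h
  exact h

lemma flow_flow (s t : ℝ) (z : Phase) :
    L.system.flow s (L.system.flow t z) = L.system.flow (s + t) z := by
  simp only [system_flow]
  refine Prod.ext ?_ (Prod.ext rfl (Prod.ext rfl ?_))
  · simp only [add_smul]; abel
  · simp only []; ring

lemma flow_zero' (z : Phase) : L.system.flow 0 z = z := by simp [system_flow]

/-- The derivative of the integral over a sliding window is the difference of the end values, here
(rot - 1)f, while rot is constant along the orbit. -/
lemma IsWave.dot_solve {σ : ℤ} (hσ : σ = 1 ∨ σ = 2) {f : Phase → ℂ} (hw : L.IsWave σ f)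
    (hf : ContDiffOn ℝ ∞ f L.system.M) {z : Phase} (hz : z ∈ L.system.M) :
    _root_.fderiv ℝ (L.solve σ f) z (L.system.vel z) = f z := by
  refine fderiv_vel_eq (contDiffOn_solve hσ hf) hz ?_
  have h1 := (hasDerivAt_integral_window (continuous_comp_flow hf hz) L.period).const_mul
    ((L.rot σ z.2.1 - 1)⁻¹)
  have h2 := hw.flow_add_period z 0
  rw [zero_add] at h2
  rw [h2, flow_zero'] at h1
  have h3 : (L.rot σ z.2.1 - 1)⁻¹ * (L.rot σ z.2.1 * f z - f z) = f z := by
    have := sub_ne_zero.2 (rot_ne_one hσ hz)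
    field_simp
  rw [h3] at h1
  refine h1.congr_of_eventuallyEq (Eventually.of_forall fun τ => ?_)
  change (L.rot σ z.2.1 - 1)⁻¹ * (∫ s in (0 : ℝ)..L.period,
    f (L.system.flow s (L.system.flow τ z))) = _
  simp only [flow_flow]

/-- The restriction of a function on phase space to the gyrocircle through `R = 0`, as a function
of `θ - α`. -/
def profile (L : LocalWave) (f : Phase → ℂ) (u : Fin 2 → ℝ) (μ ξ : ℝ) : ℂ := f (0, u, μ, L.α + ξ)

/-- The average over the gyrophase. -/
def mean (L : LocalWave) (f : Phase → ℂ) (u : Fin 2 → ℝ) (μ : ℝ) : ℂ :=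
  (1 / (2 * π) : ℂ) * ∫ ξ in (0 : ℝ)..2 * π, L.profile f u μ ξ

lemma base_mem {z : Phase} (hz : z ∈ L.system.M) (r : Fin 4 → ℝ) (x : ℝ) :
    ((r, z.2.1, z.2.2.1, x) : Phase) ∈ L.system.M := hz

lemma continuous_profile {f : Phase → ℂ} (hf : ContDiffOn ℝ ∞ f L.system.M) {z : Phase}
    (hz : z ∈ L.system.M) : Continuous (L.profile f z.2.1 z.2.2.1) :=
  hf.continuousOn.comp_continuous (by fun_prop) fun ξ => base_mem hz 0 (L.α + ξ)

lemma IsWave.profile_periodic {σ : ℤ} {f : Phase → ℂ} (hf : L.IsWave σ f) (u : Fin 2 → ℝ) (μ : ℝ) :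
    Function.Periodic (L.profile f u μ) (2 * π) := fun ξ => by
  have := hf.2 (0, u, μ, L.α + ξ)
  simpa [profile, add_assoc] using this

lemma IsWave.flow_eq_profile {f : Phase → ℂ} (hf : L.IsWave 0 f) (z : Phase) (t : ℝ) :
    f (L.system.flow t z) =
      L.profile f z.2.1 z.2.2.1 (L.Omega / L.ε * t + (z.2.2.2 - L.α)) := by
  have h := hf.1 (z.1 + t • L.U z.2.1)
    ((0, z.2.1, z.2.2.1, L.α + (L.Omega / L.ε * t + (z.2.2.2 - L.α))) : Phase)
  simp only [phase, Int.cast_zero, mul_zero, zero_mul, zero_div, Complex.exp_zero, one_mul] at h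
  rw [profile, ← h, system_flow]
  congr 1
  refine Prod.ext ?_ (Prod.ext ?_ (Prod.ext ?_ ?_))
  · simp
  · simp
  · simp
  · simp only [Prod.snd_add]; ring

lemma IsWave.integral_flow {f : Phase → ℂ} (hf : L.IsWave 0 f) (z : Phase) :
    ∫ s in (0 : ℝ)..L.period, f (L.system.flow s z) = L.period * L.mean f z.2.1 z.2.2.1 := by
  have hω : L.Omega / L.ε ≠ 0 := div_ne_zero L.Omega_ne L.ε_pos.ne'
  simp only [hf.flow_eq_profile]
  rw [intervalIntegral.integral_comp_mul_add _ hω]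
  have e : L.Omega / L.ε * L.period + (z.2.2.2 - L.α)
      = (L.Omega / L.ε * 0 + (z.2.2.2 - L.α)) + 2 * π := by
    have := L.Omega_ne
    have := L.ε_pos.ne'
    rw [period]; field_simp; ring
  rw [e, (hf.profile_periodic z.2.1 z.2.2.1).intervalIntegral_add_eq _ 0, zero_add, mean, period,
    real_smul]
  have := L.Omega_neC
  have := L.ε_neC
  have : (π : ℂ) ≠ 0 := by exact_mod_cast Real.pi_ne_zero
  push_cast
  field_simp

/-- A harmonic of order zero is periodic along the orbit, so its time average is the mean over one
gyroperiod, which is the gyrophase mean. -/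
lemma IsWave.hasOrbitAverage {f : Phase → ℂ} (hw : L.IsWave 0 f)
    (hf : ContDiffOn ℝ ∞ f L.system.M) {z : Phase} (hz : z ∈ L.system.M) :
    L.system.HasOrbitAverage f z (L.mean f z.2.1 z.2.2.1) := by
  have h := tendsto_average_of_periodic (continuous_comp_flow hf hz) L.period_ne fun t => by
    rw [hw.flow_add_period, rot_zero, one_mul]
  rw [hw.integral_flow, inv_mul_cancel_left₀ (by exact_mod_cast L.period_ne)] at h
  exact h

lemma hasOrbitAverage_re {f : Phase → ℂ} (hf : ContDiffOn ℝ ∞ f L.system.M) {z : Phase}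
    (hz : z ∈ L.system.M) {a : ℂ} (h : L.system.HasOrbitAverage f z a) :
    L.system.HasOrbitAverage (fun y => (f y).re) z a.re := by
  have h1 := (reCLM.continuous.tendsto a).comp h
  refine h1.congr fun t => ?_
  have h2 := reCLM.intervalIntegral_comp_comm
    ((continuous_comp_flow hf hz).intervalIntegrable (μ := volume) 0 t)
  simp only [Function.comp, map_smul, reCLM_apply] at h2 ⊢
  rw [h2]

lemma IsWave.bounded_orbit {σ : ℤ} {f : Phase → ℂ} (hw : L.IsWave σ f)
    (hf : ContDiffOn ℝ ∞ f L.system.M) {z : Phase} (hz : z ∈ L.system.M) :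
    ∃ C, ∀ t, |(f (L.system.flow t z)).re| ≤ C := by
  obtain ⟨C, hC⟩ := exists_bound_of_quasiPeriodic (continuous_comp_flow hf hz) L.period_ne
    (L.norm_rot σ z.2.1) (hw.flow_add_period z)
  exact ⟨C, fun t => (abs_re_le_norm _).trans (hC t)⟩

lemma IsWave.isOscillatory {σ : ℤ} (hσ : σ = 1 ∨ σ = 2) {f : Phase → ℂ} (hw : L.IsWave σ f)
    (hf : ContDiffOn ℝ ∞ f L.system.M) : L.system.IsOscillatory fun z => (f z).re :=
  fun z hz => ⟨hw.bounded_orbit hf hz, hasOrbitAverage_re hf hz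
    (tendsto_average_of_quasiPeriodic (continuous_comp_flow hf hz) L.period_ne (L.norm_rot σ z.2.1)
      (rot_ne_one hσ hz) (hw.flow_add_period z))⟩

/-- Linearly weighted average over a gyroperiod. -/
def weightedMean (L : LocalWave) (f : Phase → ℂ) (z : Phase) : ℂ :=
  (L.period : ℂ)⁻¹ * ∫ s in (0 : ℝ)..L.period, (s : ℂ) * f (L.system.flow s z)

lemma contDiffOn_weightedMean {f : Phase → ℂ} (hf : ContDiffOn ℝ ∞ f L.system.M) :
    ContDiffOn ℝ ∞ (L.weightedMean f) L.system.M := by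
  refine contDiffOn_const.mul (contDiffOn_intervalIntegral L.isOpen_system_M 0 L.period
    (f := fun p : Phase × ℝ => (p.2 : ℂ) * f (L.system.flow p.2 p.1)) ?_)
  refine ContDiffOn.mul (ContDiff.contDiffOn ?_) (contDiffOn_comp_flow hf)
  exact ofRealCLM.contDiff.comp contDiff_snd

lemma IsWave.weightedMean {f : Phase → ℂ} (hf : L.IsWave 0 f) : L.IsWave 0 (L.weightedMean f) :=
  (hf.integral fun s => (s : ℂ)).const_mul _

/-- For order zero the divisor rot - 1 vanishes; the linear weight replaces it and recovers f up to
its mean. -/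
lemma IsWave.dot_weightedMean {f : Phase → ℂ} (hw : L.IsWave 0 f)
    (hf : ContDiffOn ℝ ∞ f L.system.M) {z : Phase} (hz : z ∈ L.system.M) :
    _root_.fderiv ℝ (L.weightedMean f) z (L.system.vel z) = f z - L.mean f z.2.1 z.2.2.1 := by
  refine fderiv_vel_eq (contDiffOn_weightedMean hf) hz ?_
  have hp : ∀ t, f (L.system.flow (t + L.period) z) = f (L.system.flow t z) := fun t => by
    rw [hw.flow_add_period, rot_zero, one_mul]
  have hT : (L.period : ℂ) ≠ 0 := by exact_mod_cast L.period_ne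
  have h1 := (hasDerivAt_integral_window_weighted (continuous_comp_flow hf hz) hp).const_mul
      ((L.period : ℂ)⁻¹)
  rw [flow_zero', hw.integral_flow, ← mul_sub, inv_mul_cancel_left₀ hT] at h1
  refine h1.congr_of_eventuallyEq (Eventually.of_forall fun τ => ?_)
  simp only [LocalWave.weightedMean, flow_flow]

lemma contDiffOn_mean {f : Phase → ℂ} (hw : L.IsWave 0 f) (hf : ContDiffOn ℝ ∞ f L.system.M) :
    ContDiffOn ℝ ∞ (fun z => L.mean f z.2.1 z.2.2.1) L.system.M := by
  have h : (fun z : Phase => L.mean f z.2.1 z.2.2.1) = fun z =>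
      (L.period : ℂ)⁻¹ * ∫ s in (0 : ℝ)..L.period, f (L.system.flow s z) := by
    funext z
    rw [hw.integral_flow, inv_mul_cancel_left₀ (by exact_mod_cast L.period_ne)]
  rw [h]
  exact contDiffOn_const.mul (contDiffOn_intervalIntegral L.isOpen_system_M 0 L.period
    (contDiffOn_comp_flow hf))

/-- Derivative along the orbits of a harmonic of order zero and mean zero, inverted. -/
def solveZero (L : LocalWave) (f : Phase → ℂ) (z : Phase) : ℂ :=
  L.weightedMean f z - L.mean (L.weightedMean f) z.2.1 z.2.2.1

lemma IsWave.contDiffOn_solveZero {f : Phase → ℂ} (hw : L.IsWave 0 f)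
    (hf : ContDiffOn ℝ ∞ f L.system.M) : ContDiffOn ℝ ∞ (L.solveZero f) L.system.M :=
  (contDiffOn_weightedMean hf).sub (contDiffOn_mean hw.weightedMean (contDiffOn_weightedMean hf))

lemma IsWave.solveZero {f : Phase → ℂ} (hf : L.IsWave 0 f) : L.IsWave 0 (L.solveZero f) :=
  hf.weightedMean.sub (isWave_of_action _)

lemma IsWave.dot_solveZero {f : Phase → ℂ} (hw : L.IsWave 0 f)
    (hf : ContDiffOn ℝ ∞ f L.system.M) {z : Phase} (hz : z ∈ L.system.M) :
    _root_.fderiv ℝ (L.solveZero f) z (L.system.vel z) = f z - L.mean f z.2.1 z.2.2.1 := by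
  have h1 := contDiffOn_weightedMean hf
  have h2 := contDiffOn_mean hw.weightedMean h1
  have h3 := fderiv_vel_eq h2 hz (a := 0) (hasDerivAt_const (0 : ℝ) (L.mean (L.weightedMean f) z.2.1 z.2.2.1))
  have h4 := fderiv_fun_sub (differentiableAt_of_mem L.isOpen_system_M h1 hz)
    (differentiableAt_of_mem L.isOpen_system_M h2 hz)
  change _root_.fderiv ℝ (fun z => L.weightedMean f z - L.mean (L.weightedMean f) z.2.1 z.2.2.1) z
    (L.system.vel z) = _
  rw [h4, _root_.sub_apply, hw.dot_weightedMean hf hz, h3, sub_zero]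

/-- The subtracted mean is a function of u and μ alone: it removes the average without changing the
orbit derivative. -/
lemma IsWave.isOscillatory_solveZero {f : Phase → ℂ} (hw : L.IsWave 0 f)
    (hf : ContDiffOn ℝ ∞ f L.system.M) : L.system.IsOscillatory fun z => (L.solveZero f z).re := by
  intro z hz
  have hs := hw.contDiffOn_solveZero hf
  refine ⟨hw.solveZero.bounded_orbit hs hz, ?_⟩
  have h1 := hasOrbitAverage_re hs hz (hw.solveZero.hasOrbitAverage hs hz)
  have h2 : L.mean (L.solveZero f) z.2.1 z.2.2.1 = 0 := by
    have hc := (continuous_profile (contDiffOn_weightedMean hf) hz).intervalIntegrable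
      (μ := volume) 0 (2 * π)
    have hπ : (π : ℂ) ≠ 0 := by exact_mod_cast Real.pi_ne_zero
    set a := L.mean (L.weightedMean f) z.2.1 z.2.2.1 with ha
    have e : L.profile (L.solveZero f) z.2.1 z.2.2.1 =
      fun ξ => L.profile (L.weightedMean f) z.2.1 z.2.2.1 ξ - a := rfl
    rw [mean, e, intervalIntegral.integral_sub hc (by simp), mul_sub]
    change a - _ = 0
    rw [intervalIntegral.integral_const, real_smul]
    push_cast
    field_simp
    ring
  rwa [h2, zero_re] at h1

lemma integral_exp_int (n : ℤ) : (1 / (2 * π) : ℂ) * ∫ ξ in (0 : ℝ)..2 * π, exp (I * n * ξ)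
    = if n = 0 then 1 else 0 := by
  have hπ : (π : ℂ) ≠ 0 := by exact_mod_cast Real.pi_ne_zero
  split_ifs with h
  · simp [h]; field_simp
  · have hn : I * (n : ℂ) ≠ 0 := mul_ne_zero I_ne_zero (by exact_mod_cast h)
    rw [integral_exp_mul_complex hn]
    have := exp_int_two_pi (-n)
    push_cast at this ⊢
    rw [show I * (n : ℂ) * (2 * π) = -(I * -n * (2 * π)) by ring, this]
    simp

/-- The dependence on R cancels in the product, leaving exp(i(ℓ' - ℓ)(θ - α)), a harmonic of order
zero. -/
lemma hasOrbitAverage_expΨ {z : Phase} (hz : z ∈ L.system.M) (ℓ ℓ' : ℤ) :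
    L.system.HasOrbitAverage (fun y => starRingEnd ℂ (L.expΨ ℓ y) * L.expΨ ℓ' y) z
      (if ℓ = ℓ' then 1 else 0) := by
  set f : Phase → ℂ := fun y => exp (I * (ℓ' - ℓ : ℤ) * ((y.2.2.2 - L.α : ℝ) : ℂ)) with hfdef
  have e : (fun y => starRingEnd ℂ (L.expΨ ℓ y) * L.expΨ ℓ' y) = f := by
    funext y
    simp only [hfdef, expΨ, ← exp_conj, ← exp_add]
    congr 1
    simp only [map_div₀, map_mul, conj_I, conj_ofReal]
    have := L.ε_neC
    push_cast
    field_simp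
    ring
  have hw : L.IsWave 0 f := by
    refine ⟨fun r y => by simp [f, phase], fun y => ?_⟩
    have h := exp_int_two_pi (-(ℓ' - ℓ))
    simp only [hfdef, Prod.snd_add]
    rw [show I * ((ℓ' - ℓ : ℤ) : ℂ) * ((y.2.2.2 + 2 * π - L.α : ℝ) : ℂ) =
      I * ((ℓ' - ℓ : ℤ) : ℂ) * ((y.2.2.2 - L.α : ℝ) : ℂ)
        + -(I * ((-(ℓ' - ℓ) : ℤ) : ℂ) * ((2 * π : ℝ) : ℂ)) by push_cast; ring, exp_add, h, mul_one]
  have hs : ContDiff ℝ ∞ f := by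
    have : ContDiff ℝ ∞ fun y : Phase => y.2.2.2 - L.α := by fun_prop
    exact (contDiff_const.mul (ofRealCLM.contDiff.comp this)).cexp
  have h := hw.hasOrbitAverage hs.contDiffOn hz
  rw [e]
  convert h using 1
  have e2 : L.profile f z.2.1 z.2.2.1 = fun ξ : ℝ => exp (I * (ℓ' - ℓ : ℤ) * ξ) := by
    funext ξ; simp [profile, f]
  rw [mean, e2, integral_exp_int]
  simp only [sub_eq_zero, eq_comm]

end LocalWave

end OscCenter
end

/-! ### The wave one-form, its exterior derivative and the gauge function `S_T`. -/

noncomputable section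

namespace OscCenter

open Complex MeasureTheory
open scoped Real

namespace LocalWave

variable (L : LocalWave)

/-- The derivative of `â` with respect to the gyrophase. -/
def aHatDeriv (θ : ℝ) : Fin 4 → ℝ := -(Real.sin θ • L.tet 2 + Real.cos θ • L.tet 3)

lemma hasDerivAt_aHat (θ : ℝ) : HasDerivAt L.aHat (L.aHatDeriv θ) θ := by
  have h := ((Real.hasDerivAt_cos θ).smul_const (L.tet 2)).sub
    ((Real.hasDerivAt_sin θ).smul_const (L.tet 3))
  refine h.congr_deriv ?_
  rw [aHatDeriv, neg_smul]; abel

lemma contDiff_aHat : ContDiff ℝ ∞ L.aHat :=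
  (Real.contDiff_cos.smul contDiff_const).sub (Real.contDiff_sin.smul contDiff_const)

lemma contDiffOn_rho : ContDiffOn ℝ ∞ (fun z : Phase => L.rho z.2.2.1) L.system.M := by
  have hm := L.m_pos
  refine ContDiffOn.div_const (ContDiffOn.sqrt (ContDiff.contDiffOn (by fun_prop))
    fun z hz => ?_) _
  have := hz.1
  have h : 0 < 2 * z.2.2.1 * L.Omega / L.m := div_pos (by linarith) hm
  exact h.ne'

lemma contDiffOn_position : ContDiffOn ℝ ∞ L.position L.system.M := by
  refine contDiff_fst.contDiffOn.add ((contDiffOn_const.mul L.contDiffOn_rho).smul ?_)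
  exact (L.contDiff_aHat.comp (by fun_prop : ContDiff ℝ ∞ fun z : Phase => z.2.2.2)).contDiffOn

lemma fderiv_position {z : Phase} (hz : z ∈ L.system.M) (v : Phase) :
    fderiv ℝ L.position z v = v.1
      + (L.ε * (1 / (L.m * L.Omega * L.rho z.2.2.1)) * v.2.2.1) • L.aHat z.2.2.2
      + (L.ε * L.rho z.2.2.1 * v.2.2.2) • L.aHatDeriv z.2.2.2 := by
  have h1 := (L.hasDerivAt_rho hz.1).comp_hasFDerivAt z
    ((ContinuousLinearMap.fst ℝ ℝ ℝ).comp
          ((ContinuousLinearMap.snd ℝ (Fin 2 → ℝ) (ℝ × ℝ)).comp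
            (ContinuousLinearMap.snd ℝ (Fin 4 → ℝ) ((Fin 2 → ℝ) × ℝ × ℝ)))).hasFDerivAt
  have h2 := HasDerivAt.hasFDerivAt (L.hasDerivAt_aHat z.2.2.2) |>.comp z
    (f := fun z : Phase => z.2.2.2) dθ.hasFDerivAt
  have h3 := (ContinuousLinearMap.fst ℝ (Fin 4 → ℝ) ((Fin 2 → ℝ) × ℝ × ℝ)).hasFDerivAt (x := z)
    |>.add ((h1.const_mul L.ε).smul h2)
  have h4 : HasFDerivAt L.position _ z := h3
  rw [h4.fderiv]
  simp [dθ, smul_smul]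
  rw [add_assoc, add_comm (_ • L.aHatDeriv _)]

lemma position_add (z : Phase) (r : Fin 4 → ℝ) :
    L.position (z + (r, 0, 0, 0)) = L.position z + r := by
  simp only [position, Prod.fst_add, Prod.snd_add, add_zero]; abel

lemma aHat_add_two_pi (θ : ℝ) : L.aHat (θ + 2 * π) = L.aHat θ := by
  simp [aHat, Real.cos_add_two_pi, Real.sin_add_two_pi]

lemma position_add_two_pi (z : Phase) : L.position (z + (0, 0, 0, 2 * π)) = L.position z := by
  simp only [position, Prod.fst_add, Prod.snd_add, add_zero, aHat_add_two_pi]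

lemma fderiv_position_add (z : Phase) (r : Fin 4 → ℝ) :
    fderiv ℝ L.position (z + (r, 0, 0, 0)) = fderiv ℝ L.position z := by
  have h : (fun y => L.position (y + (r, 0, 0, 0))) = fun y => L.position y + r :=
    funext fun y => L.position_add y r
  have h2 := congrArg (fun g => fderiv ℝ g z) h
  simpa only [fderiv_comp_add_right, fderiv_add_const] using h2

lemma fderiv_position_add_two_pi (z : Phase) :
    fderiv ℝ L.position (z + (0, 0, 0, 2 * π)) = fderiv ℝ L.position z := by
  have h2 := congrArg (fun g => fderiv ℝ g z) (funext L.position_add_two_pi)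
  simpa only [fderiv_comp_add_right] using h2

/-- The eikonal factor at the particle position. -/
def eikonal (z : Phase) : ℂ := exp (I * mdot L.k (L.position z) / L.ε)

lemma isWave_eikonal : L.IsWave 1 L.eikonal := by
  refine ⟨fun r z => ?_, fun z => by rw [eikonal, position_add_two_pi, eikonal]⟩
  rw [eikonal, position_add, mdot_add_right, eikonal, phase, ← exp_add]
  congr 1
  push_cast
  ring

lemma mdot_eq_covR (v : Fin 4 → ℝ) : mdot L.k v = covR L.k v := (covR_apply _ _).symm

lemma contDiffOn_eikonal : ContDiffOn ℝ ∞ L.eikonal L.system.M := by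
  have h : ContDiffOn ℝ ∞ (fun z => mdot L.k (L.position z)) L.system.M := by
    simp only [mdot_eq_covR]
    exact (covR L.k).contDiff.comp_contDiffOn L.contDiffOn_position
  exact ((contDiffOn_const.mul (ofRealCLM.contDiff.comp_contDiffOn h)).div_const _).cexp

lemma fderiv_eikonal {z : Phase} (hz : z ∈ L.system.M) (v : Phase) :
    fderiv ℝ L.eikonal z v =
      I / L.ε * mdot L.k (fderiv ℝ L.position z v) * L.eikonal z := by
  have hp := (differentiableAt_of_mem L.isOpen_system_M L.contDiffOn_position hz).hasFDerivAt
  have h1 : HasFDerivAt (fun z => mdot L.k (L.position z))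
      ((covR L.k).comp (fderiv ℝ L.position z)) z := by
    simp only [mdot_eq_covR]
    exact (covR L.k).hasFDerivAt.comp z hp
  have h2 := (((ofRealCLM.hasFDerivAt.comp z h1).const_mul I).mul_const ((L.ε : ℂ)⁻¹)).cexp
  have h3 : HasFDerivAt L.eikonal _ z := h2.congr_of_eventuallyEq
    (Eventually.of_forall fun y => by simp [eikonal, div_eq_mul_inv])
  rw [h3.fderiv]
  simp [covR_apply, eikonal, div_eq_mul_inv]
  ring

/-- The complex one-form whose real part is the wave perturbation. -/
def γC (z : Phase) : Phase →L[ℝ] ℂ :=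
  (2 * (L.e / L.c) * L.eikonal z : ℂ) • (covC L.A).comp (fderiv ℝ L.position z)

lemma γw_eq (z : Phase) : L.γw z = reCLM.comp (L.γC z) := rfl

lemma γC_apply (z v : Phase) : L.γC z v =
    2 * (L.e / L.c) * L.eikonal z * cdot L.A (toC (fderiv ℝ L.position z v)) := by
  rw [← covC_apply]; rfl

lemma contDiffOn_γC : ContDiffOn ℝ ∞ L.γC L.system.M :=
  (contDiffOn_const.mul L.contDiffOn_eikonal).smul
    (contDiffOn_const.clm_comp (contDiffOn_fderiv L.isOpen_system_M L.contDiffOn_position))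

lemma contDiffOn_γw : ContDiffOn ℝ ∞ L.γw L.system.M :=
  contDiffOn_const.clm_comp L.contDiffOn_γC

lemma isWave_γC (v : Phase) : L.IsWave 1 fun z => L.γC z v := by
  refine ⟨fun r z => ?_, fun z => ?_⟩
  · simp only [γC_apply, fderiv_position_add, L.isWave_eikonal.1]; ring
  · simp only [γC_apply, fderiv_position_add_two_pi, L.isWave_eikonal.2]

lemma fderiv_γC {z : Phase} (hz : z ∈ L.system.M) (u v : Phase) : fderiv ℝ L.γC z u v =
    2 * (L.e / L.c) * (I / L.ε) * L.eikonal z * (mdot L.k (fderiv ℝ L.position z u)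
      * cdot L.A (toC (fderiv ℝ L.position z v)))
    + 2 * (L.e / L.c) * L.eikonal z * cdot L.A (toC (fderiv ℝ (fderiv ℝ L.position) z u v)) := by
  have h1 := (differentiableAt_of_mem L.isOpen_system_M L.contDiffOn_γC hz).hasFDerivAt.clm_apply
    (hasFDerivAt_const v z)
  have h2 := (differentiableAt_of_mem L.isOpen_system_M L.contDiffOn_eikonal hz).hasFDerivAt
  have h3 := (differentiableAt_of_mem L.isOpen_system_M
    (contDiffOn_fderiv L.isOpen_system_M L.contDiffOn_position) hz).hasFDerivAt.clm_apply
    (hasFDerivAt_const v z)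
  have h4 := (h2.const_mul (2 * (L.e / L.c) : ℂ)).mul ((covC L.A).hasFDerivAt.comp z h3)
  have h5 : HasFDerivAt (fun y => L.γC y v) _ z := h4.congr_of_eventuallyEq
    (Eventually.of_forall fun y => by simp [γC_apply, covC_apply])
  have h6 := congrArg (fun φ : Phase →L[ℝ] ℂ => φ u) (h1.unique h5)
  simp [covC_apply, fderiv_eikonal L hz] at h6
  rw [h6]
  ring

/-- The complex form of `i_v ω_w` contracted with the unperturbed phase velocity. -/
def chi (z v : Phase) : ℂ := 2 * (L.e / L.c) * (I / L.ε) * L.eikonal z *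
  (mdot L.k (fderiv ℝ L.position z v)
      * cdot L.A (toC (fderiv ℝ L.position z (L.system.vel z)))
    - mdot L.k (fderiv ℝ L.position z (L.system.vel z))
      * cdot L.A (toC (fderiv ℝ L.position z v)))

/-- Second derivatives of the particle position are symmetric and drop out of ω_w; only the
derivative of the eikonal phase contributes. -/
lemma fderiv_γC_sub {z : Phase} (hz : z ∈ L.system.M) (v : Phase) :
    fderiv ℝ L.γC z v (L.system.vel z) - fderiv ℝ L.γC z (L.system.vel z) v = L.chi z v := by
  have hs := (contDiffAt_of_mem L.isOpen_system_M L.contDiffOn_position hz).isSymmSndFDerivAt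
    (by simpa using ENat.LEInfty.out)
  rw [fderiv_γC L hz, fderiv_γC L hz, hs v (L.system.vel z), chi]
  ring

lemma dForm_γw {z : Phase} (hz : z ∈ L.system.M) (v : Phase) :
    dForm L.γw z v (L.system.vel z) = (L.chi z v).re := by
  have h : HasFDerivAt L.γw _ z :=
    ((ContinuousLinearMap.compL ℝ Phase ℂ ℝ reCLM).hasFDerivAt.comp z
      (differentiableAt_of_mem L.isOpen_system_M L.contDiffOn_γC hz).hasFDerivAt)
  rw [dForm_apply, h.fderiv, ← L.fderiv_γC_sub hz]
  simp

lemma fderiv_position_vel {z : Phase} (hz : z ∈ L.system.M) :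
    fderiv ℝ L.position z (L.system.vel z) =
      L.U z.2.1 + (L.rho z.2.2.1 * L.Omega) • L.aHatDeriv z.2.2.2 := by
  have := L.ε_pos.ne'
  rw [fderiv_position L hz, system_vel]
  simp only [mul_zero, zero_smul, add_zero]
  congr 2
  field_simp

/-- The integral has no exceptional point, so it gives smoothness across x = 0. -/
lemma expQuot_eq_integral (x : ℝ) : expQuot x = ∫ s in (0 : ℝ)..1, exp (I * x * s) := by
  rw [expQuot]
  split_ifs with h
  · simp [h]
  · rw [integral_exp_mul_complex (mul_ne_zero I_ne_zero (by exact_mod_cast h))]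
    simp

lemma contDiff_expQuot : ContDiff ℝ ∞ expQuot := by
  have h : expQuot = fun x : ℝ => ∫ s in (0 : ℝ)..1, exp (I * x * s) := funext expQuot_eq_integral
  rw [h, ← contDiffOn_univ]
  refine contDiffOn_intervalIntegral isOpen_univ 0 1
    (f := fun p : ℝ × ℝ => exp (I * p.1 * p.2)) (ContDiff.contDiffOn ?_)
  exact ((contDiff_const.mul (ofRealCLM.contDiff.comp contDiff_fst)).mul
    (ofRealCLM.contDiff.comp contDiff_snd)).cexp

/-- The complex function whose real part is `S_T`. -/
def gaugeC (z : Phase) : ℂ := 2 * (-(L.ε * L.e / L.c) * L.rho z.2.2.1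
    * cdot (toC (L.aHat z.2.2.2)) L.A
    * expQuot (L.rho z.2.2.1 * mdot (L.aHat z.2.2.2) L.k)
    * Complex.exp (Complex.I * mdot L.k z.1 / L.ε))

lemma S_T_eq : L.S_T = fun z => (L.gaugeC z).re := by
  funext z
  rw [S_T, addCC, gaugeC]
  exact (re_ofReal_mul 2 _).symm

lemma isWave_gaugeC : L.IsWave 1 L.gaugeC := by
  refine ⟨fun r z => ?_, fun z => ?_⟩
  · have h : exp (I * mdot L.k (z.1 + r) / L.ε) =
        L.phase 1 r * exp (I * mdot L.k z.1 / L.ε) := by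
      rw [phase, ← exp_add, mdot_add_right]; congr 1; push_cast; ring
    simp only [gaugeC, Prod.fst_add, Prod.snd_add, add_zero, h]
    ring
  · simp only [gaugeC, Prod.fst_add, Prod.snd_add, add_zero, aHat_add_two_pi]

lemma contDiffOn_gaugeC : ContDiffOn ℝ ∞ L.gaugeC L.system.M := by
  have ha : ContDiff ℝ ∞ fun z : Phase => L.aHat z.2.2.2 :=
    L.contDiff_aHat.comp (by fun_prop : ContDiff ℝ ∞ fun z : Phase => z.2.2.2)
  have h1 : ContDiff ℝ ∞ fun z : Phase => cdot (toC (L.aHat z.2.2.2)) L.A := by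
    simp only [cdot_comm _ L.A, ← covC_apply]
    exact (covC L.A).contDiff.comp ha
  have h2 : ContDiff ℝ ∞ fun z : Phase => mdot (L.aHat z.2.2.2) L.k := by
    simp only [mdot_comm _ L.k, ← covR_apply]
    exact (covR L.k).contDiff.comp ha
  have h3 : ContDiff ℝ ∞ fun z : Phase => mdot L.k z.1 := by
    simp only [← covR_apply]
    exact (covR L.k).contDiff.comp contDiff_fst
  have hr := L.contDiffOn_rho
  refine contDiffOn_const.mul (((((contDiffOn_const.mul
    (ofRealCLM.contDiff.comp_contDiffOn hr)).mul h1.contDiffOn)).mul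
    (contDiff_expQuot.comp_contDiffOn (hr.mul h2.contDiffOn))).mul (ContDiff.contDiffOn ?_))
  exact ((contDiff_const.mul (ofRealCLM.contDiff.comp h3)).div_const _).cexp

lemma contDiffOn_S_T : ContDiffOn ℝ ∞ L.S_T L.system.M := by
  rw [S_T_eq]
  exact reCLM.contDiff.comp_contDiffOn L.contDiffOn_gaugeC

lemma isOscillatory_S_T : L.system.IsOscillatory L.S_T := by
  rw [S_T_eq]
  exact L.isWave_gaugeC.isOscillatory (Or.inl rfl) L.contDiffOn_gaugeC

end LocalWave

end OscCenter
end

/-! ### Construction of `S₁`, `g₁` and `S₂`. -/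

noncomputable section

namespace OscCenter

open Complex MeasureTheory
open scoped Real

namespace LocalWave

variable (L : LocalWave)

lemma vel_eq (z : Phase) : L.system.vel z =
    z.2.1 0 • L.eR 0 + z.2.1 1 • L.eR 1 + (L.Omega / L.ε) • eθ := by
  rw [system_vel, U]
  refine Prod.ext ?_ (Prod.ext ?_ (Prod.ext ?_ ?_)) <;> simp [eR, eθ]

/-- The derivative of the unperturbed phase velocity. -/
def velDeriv (v : Phase) : Phase := (L.U v.2.1, 0, 0, 0)

lemma velDeriv_eq (v : Phase) : L.velDeriv v = v.2.1 0 • L.eR 0 + v.2.1 1 • L.eR 1 := by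
  rw [velDeriv, U]
  refine Prod.ext ?_ (Prod.ext ?_ (Prod.ext ?_ ?_)) <;> simp [eR]

lemma fderiv_vel (z v : Phase) : fderiv ℝ L.system.vel z v = L.velDeriv v := by
  let D : Phase →ₗ[ℝ] Phase :=
    { toFun := L.velDeriv
      map_add' := fun v w => by
        rw [velDeriv_eq, velDeriv_eq, velDeriv_eq]
        simp only [Prod.snd_add, Prod.fst_add, Pi.add_apply, add_smul]
        abel
      map_smul' := fun r v => by simp [velDeriv_eq, smul_smul] }
  have h : L.system.vel = fun z => LinearMap.toContinuousLinearMap D z + (0, 0, 0, L.Omega / L.ε) := by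
    funext z
    change _ = L.velDeriv z + _
    rw [system_vel, velDeriv]; simp
  rw [h, fderiv_add_const, ContinuousLinearMap.fderiv]
  rfl

lemma contDiffOn_vel : ContDiffOn ℝ ∞ L.system.vel L.system.M :=
  have := FiniteDimensional.complete ℝ Phase
  L.isHamiltonian_system.smooth_vel

/-- The first-order gauge function in complex form. -/
def s₁ : Phase → ℂ := L.solve 1 fun z => -L.γC z (L.system.vel z)

lemma isWave_γC_vel : L.IsWave 1 fun z => -L.γC z (L.system.vel z) := by
  have h := ((((L.isWave_γC (L.eR 0)).action_mul fun u _ => (u 0 : ℂ)).add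
    ((L.isWave_γC (L.eR 1)).action_mul fun u _ => (u 1 : ℂ))).add
    ((L.isWave_γC eθ).const_mul (L.Omega / L.ε : ℝ))).const_mul (-1)
  refine cast (congrArg (L.IsWave 1) (funext fun z => ?_)) h
  rw [vel_eq]
  simp only [map_add, map_smul, real_smul]
  ring

lemma contDiffOn_γC_vel : ContDiffOn ℝ ∞ (fun z => -L.γC z (L.system.vel z)) L.system.M :=
  (L.contDiffOn_γC.clm_apply L.contDiffOn_vel).neg

lemma contDiffOn_s₁ : ContDiffOn ℝ ∞ L.s₁ L.system.M :=
  contDiffOn_solve (Or.inl rfl) L.contDiffOn_γC_vel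

lemma isWave_s₁ : L.IsWave 1 L.s₁ := L.isWave_γC_vel.solve

lemma dot_s₁ {z : Phase} (hz : z ∈ L.system.M) :
    fderiv ℝ L.s₁ z (L.system.vel z) = -L.γC z (L.system.vel z) :=
  L.isWave_γC_vel.dot_solve (Or.inl rfl) L.contDiffOn_γC_vel hz

/-- The complex form of the one-form `γ_w + dS₁`. -/
def b (z : Phase) : Phase →L[ℝ] ℂ := L.γC z + fderiv ℝ L.s₁ z

lemma contDiffOn_b : ContDiffOn ℝ ∞ L.b L.system.M :=
  L.contDiffOn_γC.add (contDiffOn_fderiv L.isOpen_system_M L.contDiffOn_s₁)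

lemma isWave_b (v : Phase) : L.IsWave 1 fun z => L.b z v :=
  (L.isWave_γC v).add (L.isWave_s₁.fderiv v)

lemma b_vel {z : Phase} (hz : z ∈ L.system.M) : L.b z (L.system.vel z) = 0 := by
  rw [b, _root_.add_apply, L.dot_s₁ hz, add_neg_cancel]

/-- Differentiate i₀b = 0 in the direction v and exchange the two arguments of the derivative of b.
The exact part ds₁ does not contribute to the antisymmetric difference, which is therefore chi. -/
lemma fderiv_b_vel {z : Phase} (hz : z ∈ L.system.M) (v : Phase) :
    fderiv ℝ L.b z (L.system.vel z) v = -L.chi z v - L.b z (L.velDeriv v) := by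
  have hO := L.isOpen_system_M
  have h1 : fderiv ℝ L.b z v (L.system.vel z) + L.b z (L.velDeriv v) = 0 := by
    have h2 := (differentiableAt_of_mem hO L.contDiffOn_b hz).hasFDerivAt.clm_apply
      (differentiableAt_of_mem hO L.contDiffOn_vel hz).hasFDerivAt
    have h3 := fderiv_eq_of_eqOn hO (f := fun y => L.b y (L.system.vel y)) (g := fun _ => 0)
      (fun y hy => L.b_vel hy) hz
    rw [h2.fderiv] at h3
    have h4 := congrArg (fun φ : Phase →L[ℝ] ℂ => φ v) h3
    simp [fderiv_vel] at h4
    rw [← h4, add_comm]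
  have h5 : ∀ u w, fderiv ℝ L.b z u w = fderiv ℝ L.γC z u w + fderiv ℝ (fderiv ℝ L.s₁) z u w := by
    intro u w
    have : L.b = fun y => L.γC y + fderiv ℝ L.s₁ y := rfl
    rw [this, fderiv_fun_add (differentiableAt_of_mem hO L.contDiffOn_γC hz)
      (differentiableAt_of_mem hO (contDiffOn_fderiv hO L.contDiffOn_s₁) hz)]
    rfl
  have hs := (contDiffAt_of_mem hO L.contDiffOn_s₁ hz).isSymmSndFDerivAt
    (by simpa using ENat.LEInfty.out) v (L.system.vel z)
  have h6 := L.fderiv_γC_sub hz v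
  rw [h5] at h1 ⊢
  linear_combination h1 - h6 - hs

lemma fderiv_b_apply {z : Phase} (hz : z ∈ L.system.M) (v : Phase) :
    fderiv ℝ (fun y => L.b y v) z (L.system.vel z) = -L.chi z v - L.b z (L.velDeriv v) := by
  rw [← L.fderiv_b_vel hz]
  have h2 := (differentiableAt_of_mem L.isOpen_system_M L.contDiffOn_b hz).hasFDerivAt.clm_apply
      (hasFDerivAt_const v z)
  rw [h2.fderiv]
  simp

/-- The first-order gauge function. -/
def S₁ (z : Phase) : ℝ := (L.s₁ z).re

lemma contDiffOn_S₁ : ContDiffOn ℝ ∞ L.S₁ L.system.M :=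
  reCLM.contDiff.comp_contDiffOn L.contDiffOn_s₁

lemma isOscillatory_S₁ : L.system.IsOscillatory L.S₁ :=
  L.isWave_s₁.isOscillatory (Or.inl rfl) L.contDiffOn_s₁

lemma fderiv_S₁ {z : Phase} (hz : z ∈ L.system.M) :
    fderiv ℝ L.S₁ z = reCLM.comp (fderiv ℝ L.s₁ z) :=
  (reCLM.hasFDerivAt.comp z
    (differentiableAt_of_mem L.isOpen_system_M L.contDiffOn_s₁ hz).hasFDerivAt).fderiv

lemma dot_S₁ {z : Phase} (hz : z ∈ L.system.M) :
    L.system.dot L.S₁ z = -L.γw z (L.system.vel z) := by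
  rw [PhaseSystem.dot, L.fderiv_S₁ hz, γw_eq]
  simp [L.dot_s₁ hz]

/-- The first-order generator. -/
def g₁ (z : Phase) : Phase := L.sharp (reCLM.comp (L.b z))

lemma dForm_g₁ {z : Phase} (hz : z ∈ L.system.M) :
    dForm L.system.γ z (L.g₁ z) = L.γw z + fderiv ℝ L.S₁ z := by
  rw [g₁, dForm_sharp, L.fderiv_S₁ hz, γw_eq]
  refine ContinuousLinearMap.ext fun v => ?_
  simp [b]

/-- The particle position does not depend on u; hence no u-components of chi enter `pairing`. -/
lemma chi_eu {z : Phase} (hz : z ∈ L.system.M) (i : Fin 2) : L.chi z (eu i) = 0 := by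
  have : fderiv ℝ L.position z (eu i) = 0 := by rw [L.fderiv_position hz]; simp [eu]
  have h0 : toC 0 = 0 := by funext i; simp [toC]
  rw [chi, this, h0, mdot_zero_right]
  simp [cdot]

lemma isWave_chi (v : Phase) : L.IsWave 1 fun z => L.chi z v := by
  have hv : ∀ (r : Fin 4 → ℝ) (x : ℝ) (z : Phase),
      L.system.vel (z + (r, 0, 0, x)) = L.system.vel z := fun r x z => by simp [system_vel]
  refine ⟨fun r z => ?_, fun z => ?_⟩
  · simp only [chi, fderiv_position_add, L.isWave_eikonal.1, hv]; ring
  · simp only [chi, fderiv_position_add_two_pi, L.isWave_eikonal.2, hv]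

lemma contDiffOn_chi (v : Phase) : ContDiffOn ℝ ∞ (fun z => L.chi z v) L.system.M := by
  have hd := contDiffOn_fderiv L.isOpen_system_M L.contDiffOn_position
  have h1 := hd.clm_apply (contDiffOn_const (c := v))
  have h2 := hd.clm_apply L.contDiffOn_vel
  have hk : ∀ {f : Phase → Fin 4 → ℝ}, ContDiffOn ℝ ∞ f L.system.M →
      ContDiffOn ℝ ∞ (fun z => (mdot L.k (f z) : ℂ)) L.system.M := fun hf => by
    simp only [mdot_eq_covR]
    exact ofRealCLM.contDiff.comp_contDiffOn ((covR L.k).contDiff.comp_contDiffOn hf)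
  have hA : ∀ {f : Phase → Fin 4 → ℝ}, ContDiffOn ℝ ∞ f L.system.M →
      ContDiffOn ℝ ∞ (fun z => cdot L.A (toC (f z))) L.system.M := fun hf => by
    simp only [← covC_apply]
    exact (covC L.A).contDiff.comp_contDiffOn hf
  exact (contDiffOn_const.mul L.contDiffOn_eikonal).mul
    (((hk h1).mul (hA h2)).sub ((hk h2).mul (hA h1)))

/-- The complex Poisson pairing of the one-forms with components `x` and `y`. -/
def pairing (xR : Fin 4 → ℂ) (xμ xθ : ℂ) (yR : Fin 4 → ℂ) (yu : Fin 2 → ℂ) (yμ yθ : ℂ) : ℂ :=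
  ((1 / (4 * L.m) : ℝ) : ℂ) * (yu 0 * xR 0 - yu 1 * xR 1)
    + ((L.ε / (4 * L.m * L.Omega) : ℝ) : ℂ) * (yR 3 * xR 2 - yR 2 * xR 3)
    + ((1 / (4 * L.ε) : ℝ) : ℂ) * (yθ * xμ - yμ * xθ)

/-- The part of `½ i₀ i₁ ω_w` of harmonic order zero, in complex form. -/
def F0 (z : Phase) : ℂ :=
  L.pairing (fun a => L.chi z (L.eR a)) (L.chi z eμ) (L.chi z eθ)
    (fun a => starRingEnd ℂ (L.b z (L.eR a))) (fun i => starRingEnd ℂ (L.b z (eu i)))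
    (starRingEnd ℂ (L.b z eμ)) (starRingEnd ℂ (L.b z eθ))

/-- The part of `½ i₀ i₁ ω_w` of harmonic order two, in complex form. -/
def F2 (z : Phase) : ℂ :=
  L.pairing (fun a => L.chi z (L.eR a)) (L.chi z eμ) (L.chi z eθ)
    (fun a => L.b z (L.eR a)) (fun i => L.b z (eu i)) (L.b z eμ) (L.b z eθ)

lemma contDiffOn_b_apply (v : Phase) : ContDiffOn ℝ ∞ (fun z => L.b z v) L.system.M :=
  L.contDiffOn_b.clm_apply contDiffOn_const

lemma contDiffOn_conj_b (v : Phase) :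
    ContDiffOn ℝ ∞ (fun z => starRingEnd ℂ (L.b z v)) L.system.M :=
  conjCLE.contDiff.comp_contDiffOn (L.contDiffOn_b_apply v)

lemma contDiffOn_F0 : ContDiffOn ℝ ∞ L.F0 L.system.M := by
  have c := L.contDiffOn_chi
  have d := L.contDiffOn_conj_b
  exact ((contDiffOn_const.mul (((d _).mul (c _)).sub ((d _).mul (c _)))).add
    (contDiffOn_const.mul (((d _).mul (c _)).sub ((d _).mul (c _))))).add
    (contDiffOn_const.mul (((d _).mul (c _)).sub ((d _).mul (c _))))

lemma contDiffOn_F2 : ContDiffOn ℝ ∞ L.F2 L.system.M := by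
  have c := L.contDiffOn_chi
  have d := L.contDiffOn_b_apply
  exact ((contDiffOn_const.mul (((d _).mul (c _)).sub ((d _).mul (c _)))).add
    (contDiffOn_const.mul (((d _).mul (c _)).sub ((d _).mul (c _))))).add
    (contDiffOn_const.mul (((d _).mul (c _)).sub ((d _).mul (c _))))

lemma isWave_F0 : L.IsWave 0 L.F0 := by
  have m : ∀ v w, L.IsWave 0 fun z => starRingEnd ℂ (L.b z v) * L.chi z w := fun v w =>
    (L.isWave_b v).conj.mul (L.isWave_chi w)
  exact ((((m _ _).sub (m _ _)).const_mul _).add (((m _ _).sub (m _ _)).const_mul _)).add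
    (((m _ _).sub (m _ _)).const_mul _)

lemma isWave_F2 : L.IsWave 2 L.F2 := by
  have m : ∀ v w, L.IsWave 2 fun z => L.b z v * L.chi z w := fun v w =>
    (L.isWave_b v).mul (L.isWave_chi w)
  exact ((((m _ _).sub (m _ _)).const_mul _).add (((m _ _).sub (m _ _)).const_mul _)).add
    (((m _ _).sub (m _ _)).const_mul _)

/-- Both factors of the Poisson pairing are real parts of first harmonics, and a product of two such
real parts contains harmonics of order 0 and 2 only. -/
lemma halfI0I1_eq {z : Phase} (hz : z ∈ L.system.M) :
    L.system.halfI0I1 L.γw L.g₁ z = (L.F0 z).re + (L.F2 z).re := by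
  have h1 : ∀ v, ((dForm L.γw z).flip (L.system.vel z)) v = (L.chi z v).re := fun v =>
    L.dForm_γw hz v
  have h2 := L.map_sharp ((dForm L.γw z).flip (L.system.vel z)) (reCLM.comp (L.b z))
  have key : ∀ x y : ℂ, y.re * x.re = 1 / 2 * ((starRingEnd ℂ y * x).re + (y * x).re) :=
    fun x y => by simp [mul_re]; ring
  simp only [h1, chi_eu L hz, ContinuousLinearMap.comp_apply, reCLM_apply, zero_re, mul_zero,
    sub_zero, zero_div, add_zero, key] at h2
  have h3 : L.system.halfI0I1 L.γw L.g₁ z = 1 / 2 * (L.chi z (L.g₁ z)).re := by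
    rw [PhaseSystem.halfI0I1, L.dForm_γw hz]
  rw [h3, g₁, h2, F0, F2]
  have := L.m_pos.ne'
  have := L.Omega_ne
  have := L.ε_pos.ne'
  simp only [pairing, add_re, re_ofReal_mul, sub_re]
  field_simp
  ring

/-- The second-order gauge function. -/
def S₂ (z : Phase) : ℝ := (L.solveZero L.F0 z).re - (-1 * L.solve 2 L.F2 z).re

lemma contDiffOn_S₂ : ContDiffOn ℝ ∞ L.S₂ L.system.M :=
  (reCLM.contDiff.comp_contDiffOn (L.isWave_F0.contDiffOn_solveZero L.contDiffOn_F0)).sub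
    (reCLM.contDiff.comp_contDiffOn
      (contDiffOn_const.mul (contDiffOn_solve (Or.inr rfl) L.contDiffOn_F2)))

lemma isOscillatory_S₂ : L.system.IsOscillatory L.S₂ := by
  have h2 := contDiffOn_solve (Or.inr rfl) L.contDiffOn_F2
  have o0 := L.isWave_F0.isOscillatory_solveZero L.contDiffOn_F0
  have o2 := (L.isWave_F2.solve.const_mul (-1)).isOscillatory (Or.inr rfl)
    (contDiffOn_const.mul h2)
  -- The second harmonic is written with the factor -1 so that S₂ is a difference of oscillatory
  -- functions.
  exact PhaseSystem.IsOscillatory.sub L.isHamiltonian_system o0 o2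
    (reCLM.contDiff.comp_contDiffOn (L.isWave_F0.contDiffOn_solveZero L.contDiffOn_F0))
    (reCLM.contDiff.comp_contDiffOn (contDiffOn_const.mul h2))

lemma dot_S₂ {z : Phase} (hz : z ∈ L.system.M) : L.system.dot L.S₂ z =
    L.system.halfI0I1 L.γw L.g₁ z - (L.mean L.F0 z.2.1 z.2.2.1).re := by
  have h0 := differentiableAt_of_mem L.isOpen_system_M
    (L.isWave_F0.contDiffOn_solveZero L.contDiffOn_F0) hz
  have h2 := differentiableAt_of_mem L.isOpen_system_M
    (contDiffOn_solve (Or.inr rfl) L.contDiffOn_F2) hz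
  have h : HasFDerivAt L.S₂ _ z := (reCLM.hasFDerivAt.comp z h0.hasFDerivAt).sub
    (reCLM.hasFDerivAt.comp z (h2.hasFDerivAt.const_mul (-1)))
  rw [PhaseSystem.dot, h.fderiv, L.halfI0I1_eq hz]
  simp [L.isWave_F0.dot_solveZero L.contDiffOn_F0 hz,
    L.isWave_F2.dot_solve (Or.inr rfl) L.contDiffOn_F2 hz]
  ring

lemma hasOrbitAverage_halfI0I1 {z : Phase} (hz : z ∈ L.system.M) :
    L.system.HasOrbitAverage (L.system.halfI0I1 L.γw L.g₁) z
      (L.mean L.F0 z.2.1 z.2.2.1).re := by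
  have hP := L.isHamiltonian_system
  have h0 := hasOrbitAverage_re L.contDiffOn_F0 hz (L.isWave_F0.hasOrbitAverage L.contDiffOn_F0 hz)
  have h2 := (L.isWave_F2.isOscillatory (Or.inr rfl) L.contDiffOn_F2 z hz).2
  have h := h0.add h2
    (hP.continuous_comp_orbit (reCLM.contDiff.comp_contDiffOn L.contDiffOn_F0) hz)
    (hP.continuous_comp_orbit (reCLM.contDiff.comp_contDiffOn L.contDiffOn_F2) hz)
  rw [add_zero] at h
  exact h.congr hP hz fun y hy => L.halfI0I1_eq hy |>.symm

end LocalWave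

end OscCenter
end

/-! ### Fourier components of the wave on a gyrocircle. -/

noncomputable section

namespace OscCenter

open Complex MeasureTheory
open scoped Real

namespace LocalWave

variable (L : LocalWave)

/-- Measuring the gyrophase from α makes k·â = k_⊥ sin ξ, so the eikonal factor on the gyrocircle is
the Bessel generating function. -/
lemma mdot_k_aHat (ξ : ℝ) : mdot L.k (L.aHat (L.α + ξ)) = L.kperp * Real.sin ξ := by
  have h2 : L.kT 2 = -(L.kperp * Real.sin L.α) := L.k_tet2
  have h3 : L.kT 3 = -(L.kperp * Real.cos L.α) := L.k_tet3
  rw [kT, mdot_comm] at h2 h3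
  rw [aHat, mdot_sub_right, mdot_smul_right, mdot_smul_right, h2, h3, Real.cos_add, Real.sin_add]
  linear_combination L.kperp * Real.sin ξ * Real.sin_sq_add_cos_sq L.α

lemma mdot_k_aHatDeriv (ξ : ℝ) : mdot L.k (L.aHatDeriv (L.α + ξ)) = L.kperp * Real.cos ξ := by
  have h2 : L.kT 2 = -(L.kperp * Real.sin L.α) := L.k_tet2
  have h3 : L.kT 3 = -(L.kperp * Real.cos L.α) := L.k_tet3
  rw [kT, mdot_comm] at h2 h3
  rw [aHatDeriv, ← neg_one_smul ℝ, mdot_smul_right, mdot_add_right, mdot_smul_right,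
    mdot_smul_right, h2, h3, Real.cos_add, Real.sin_add]
  linear_combination L.kperp * Real.cos ξ * Real.sin_sq_add_cos_sq L.α

lemma exp_gyrophase (ξ : ℝ) : exp ((L.α + ξ : ℂ) * I) = exp (I * L.α) * exp (I * ξ) ∧
    exp (-(L.α + ξ : ℂ) * I) = exp (-(I * L.α)) * exp (-(I * ξ)) := by
  constructor <;> rw [← exp_add] <;> congr 1 <;> ring

lemma cdot_A_aHat (ξ : ℝ) : cdot L.A (toC (L.aHat (L.α + ξ))) =
    (L.aPlus * exp (I * ξ) + L.aMinus * exp (-(I * ξ))) / Real.sqrt 2 := by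
  have h : cdot L.A (toC (L.aHat (L.α + ξ))) = Complex.cos (L.α + ξ) * L.AT 2
      - Complex.sin (L.α + ξ) * L.AT 3 := by
    rw [aHat, sub_eq_add_neg, ← neg_smul, toC_add, toC_smul, toC_smul, cdot_comm, cdot_add_left,
      cdot_smul_left, cdot_smul_left]
    simp only [AT, tC]; push_cast; ring
  obtain ⟨e1, e2⟩ := L.exp_gyrophase ξ
  rw [h, Complex.cos, Complex.sin, e1, e2, aPlus, aMinus]
  set p := exp (I * L.α) * exp (I * ξ)
  set q := exp (-(I * L.α)) * exp (-(I * ξ))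
  linear_combination (-(p * (L.AT 2 + I * L.AT 3) + q * (L.AT 2 - I * L.AT 3))) * inv_sqrt2C_sq

lemma cdot_A_aHatDeriv (ξ : ℝ) : cdot L.A (toC (L.aHatDeriv (L.α + ξ))) =
    I * (L.aPlus * exp (I * ξ) - L.aMinus * exp (-(I * ξ))) / Real.sqrt 2 := by
  have h : cdot L.A (toC (L.aHatDeriv (L.α + ξ))) = -(Complex.sin (L.α + ξ) * L.AT 2
      + Complex.cos (L.α + ξ) * L.AT 3) := by
    rw [aHatDeriv, ← neg_one_smul ℝ, toC_smul, toC_add, toC_smul, toC_smul, cdot_comm,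
      cdot_smul_left, cdot_add_left, cdot_smul_left, cdot_smul_left]
    simp only [AT, tC]; push_cast; ring
  obtain ⟨e1, e2⟩ := L.exp_gyrophase ξ
  rw [h, Complex.cos, Complex.sin, e1, e2, aPlus, aMinus]
  set p := exp (I * L.α) * exp (I * ξ)
  set q := exp (-(I * L.α)) * exp (-(I * ξ))
  linear_combination (-(I * (p * (L.AT 2 + I * L.AT 3) - q * (L.AT 2 - I * L.AT 3)))) *
    inv_sqrt2C_sq - (p + q) * L.AT 3 / 2 * I_sq

lemma profile_eikonal (u : Fin 2 → ℝ) (μ ξ : ℝ) :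
    L.profile L.eikonal u μ ξ = besselGen (L.kperp * L.rho μ) ξ := by
  have := L.ε_neC
  rw [profile, eikonal, position, besselGen, mdot_add_right, mdot_smul_right, mdot_k_aHat,
    mdot_zero_right]
  congr 1
  push_cast
  field_simp
  ring

lemma fourierC_bessel_comb (μ : ℝ) (a p q : ℂ) (ℓ : ℤ) :
    fourierC (fun ξ => besselGen (L.kperp * L.rho μ) ξ *
      (a + p * exp (I * ξ) + q * exp (-(I * ξ)))) ℓ =
      a * L.J ℓ μ + p * L.J (ℓ - 1) μ + q * L.J (ℓ + 1) μ := by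
  set G := besselGen (L.kperp * L.rho μ) with hG
  have hc : Continuous G := continuous_besselGen _
  have e : (fun ξ : ℝ => G ξ * (a + p * exp (I * ξ) + q * exp (-(I * ξ)))) = fun ξ =>
      (a * G ξ + p * (G ξ * exp (I * (1 : ℤ) * ξ))) + q * (G ξ * exp (I * (-1 : ℤ) * ξ)) := by
    funext ξ
    have e2 : I * ((-1 : ℤ) : ℂ) * (ξ : ℂ) = -(I * ξ) := by push_cast; ring
    rw [e2]
    push_cast
    rw [mul_one]
    ring
  rw [e, fourierC_add (by fun_prop) (by fun_prop), fourierC_add (by fun_prop) (by fun_prop),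
    fourierC_const_mul, fourierC_const_mul, fourierC_const_mul, fourierC_mul_exp,
    fourierC_mul_exp, sub_neg_eq_add]
  simp only [J, besselJ_eq_fourierC]
  rfl

variable {L}

/-- The profile of `Ã · ṙ`. -/
lemma cdot_A_velocity {z : Phase} (hz : z ∈ L.system.M) (ξ : ℝ) :
    cdot L.A (toC (fderiv ℝ L.position ((0, z.2.1, z.2.2.1, L.α + ξ) : Phase)
      (L.system.vel ((0, z.2.1, z.2.2.1, L.α + ξ) : Phase)))) =
    L.UA z.2.1 + L.rho z.2.2.1 * L.Omega *
      (I * (L.aPlus * exp (I * ξ) - L.aMinus * exp (-(I * ξ))) / Real.sqrt 2) := by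
  rw [fderiv_position_vel L (base_mem hz 0 (L.α + ξ)), toC_add, toC_smul, cdot_add_right,
    cdot_smul_right, cdot_A_aHatDeriv, cdot_comm, cdot_U_A]
  push_cast
  ring

/-- The profile of `k · ṙ`. -/
lemma mdot_k_velocity {z : Phase} (hz : z ∈ L.system.M) (ξ : ℝ) :
    mdot L.k (fderiv ℝ L.position ((0, z.2.1, z.2.2.1, L.α + ξ) : Phase)
      (L.system.vel ((0, z.2.1, z.2.2.1, L.α + ξ) : Phase))) =
    L.kU z.2.1 + L.rho z.2.2.1 * L.Omega * (L.kperp * Real.cos ξ) := by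
  rw [fderiv_position_vel L (base_mem hz 0 (L.α + ξ)), mdot_add_right, mdot_smul_right,
    mdot_k_aHatDeriv, mdot_k_U]

/-- The profile is the generating function times a trigonometric polynomial of degree one, and the
recurrence turns the cos ξ in k·ṙ into ℓΩ_BJ_ℓ, completing D_ℓ. -/
lemma fourierC_chi_eR {z : Phase} (hz : z ∈ L.system.M) (a : Fin 4) (ℓ : ℤ) :
    fourierC (L.profile (fun y => L.chi y (L.eR a)) z.2.1 z.2.2.1) ℓ =
      -(2 * I / L.ε) * L.Q ℓ z.2.1 z.2.2.1 a := by
  set u := z.2.1 with hu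
  set μ := z.2.2.1 with hμ
  have hk : mdot L.k (L.tet a) = L.kT a := mdot_comm _ _
  have hA : cdot L.A (toC (L.tet a)) = L.AT a := cdot_comm _ _
  have e : L.profile (fun y => L.chi y (L.eR a)) u μ = fun ξ =>
      besselGen (L.kperp * L.rho μ) ξ *
        (2 * (L.e / L.c) * (I / L.ε) * (L.kT a * L.UA u - L.kU u * L.AT a)
        + 2 * (L.e / L.c) * (I / L.ε) * (L.kT a * (L.rho μ * L.Omega * (I * L.aPlus / Real.sqrt 2))
          - L.rho μ * L.Omega * L.kperp / 2 * L.AT a) * exp (I * ξ)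
        + 2 * (L.e / L.c) * (I / L.ε) * (-(L.kT a * (L.rho μ * L.Omega * (I * L.aMinus /
          Real.sqrt 2))) - L.rho μ * L.Omega * L.kperp / 2 * L.AT a) * exp (-(I * ξ))) := by
    funext ξ
    have hd : fderiv ℝ L.position ((0, u, μ, L.α + ξ) : Phase) (L.eR a) = L.tet a := by
      rw [L.fderiv_position (base_mem hz 0 (L.α + ξ))]; simp [eR]
    have he := L.profile_eikonal u μ ξ
    rw [profile] at he
    have hcos : ((Real.cos ξ : ℝ) : ℂ) = (exp (I * ξ) + exp (-(I * ξ))) / 2 := by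
      rw [ofReal_cos, Complex.cos]; ring_nf
    rw [profile, chi, he, hd, cdot_A_velocity hz, mdot_k_velocity hz, hk, hA]
    push_cast [-ofReal_cos]
    rw [hcos]
    ring
  rw [e, fourierC_bessel_comb, Q, H1_eq, D_eq]
  push_cast
  linear_combination -(L.e / L.c * (I / L.ε) * L.Omega * L.AT a) * L.J_recurrence ℓ μ

lemma fourierC_chi_eμ {z : Phase} (hz : z ∈ L.system.M) (ℓ : ℤ) :
    fourierC (L.profile (fun y => L.chi y eμ) z.2.1 z.2.2.1) ℓ =
      2 * I * L.e / (L.c * L.m * L.Omega * L.rho z.2.2.1) * L.X ℓ z.2.1 z.2.2.1 := by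
  set u := z.2.1 with hu
  set μ := z.2.2.1 with hμ
  set K : ℂ := 2 * I * L.e / (L.c * L.m * L.Omega * L.rho μ) with hK
  have hε := L.ε_neC
  have e : L.profile (fun y => L.chi y eμ) u μ = fun ξ =>
      besselGen (L.kperp * L.rho μ) ξ *
        (-(K * (L.rho μ * L.Omega * L.kperp / Real.sqrt 2 * (L.aPlus + L.aMinus)))
        + K * (-(I * L.kperp / 2) * L.UA u - L.kU u / Real.sqrt 2 * L.aPlus) * exp (I * ξ)
        + K * (I * L.kperp / 2 * L.UA u - L.kU u / Real.sqrt 2 * L.aMinus) * exp (-(I * ξ))) := by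
    funext ξ
    have hd : fderiv ℝ L.position ((0, u, μ, L.α + ξ) : Phase) eμ =
        (L.ε * (1 / (L.m * L.Omega * L.rho μ))) • L.aHat (L.α + ξ) := by
      rw [L.fderiv_position (base_mem hz 0 (L.α + ξ))]; simp [eμ, μ]
    have he := L.profile_eikonal u μ ξ
    rw [profile] at he
    have hcos : ((Real.cos ξ : ℝ) : ℂ) = (exp (I * ξ) + exp (-(I * ξ))) / 2 := by
      rw [ofReal_cos, Complex.cos]; ring_nf
    have hsin : ((Real.sin ξ : ℝ) : ℂ) = -I * (exp (I * ξ) - exp (-(I * ξ))) / 2 := by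
      rw [ofReal_sin, Complex.sin]; ring_nf
    have hpq : exp (I * ξ) * exp (-(I * ξ)) = 1 := by rw [← exp_add]; simp
    rw [profile, chi, he, hd, cdot_A_velocity hz, mdot_k_velocity hz, mdot_smul_right, toC_smul,
      cdot_smul_right, mdot_k_aHat, cdot_A_aHat]
    push_cast [-ofReal_cos, -ofReal_sin]
    rw [hcos, hsin, hK]
    set p := exp (I * ξ)
    set q := exp (-(I * ξ))
    set G := besselGen (L.kperp * L.rho μ) ξ
    have hC : (2 * (L.e / L.c) * (I / L.ε) : ℂ) * (L.ε * (1 / (L.m * L.Omega * L.rho μ))) =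
        2 * I * L.e / (L.c * L.m * L.Omega * L.rho μ) := by
      field_simp
    rw [← hC]
    -- In k·â Ã·ṙ - k·ṙ Ã·â the gyration terms in e^{±2iξ} cancel, and a constant remains.
    linear_combination ((2 * (L.e / L.c) * (I / L.ε) : ℂ) * (L.ε * (1 / (L.m * L.Omega * L.rho μ))))
      * G * L.rho μ * L.Omega * L.kperp / Real.sqrt 2 *
      (-(p - q) * (L.aPlus * p - L.aMinus * q) / 2 * I_sq - (L.aPlus + L.aMinus) * hpq)
  rw [e, fourierC_bessel_comb, X]
  ring

/-- Derivative of a harmonic along a translation of `R`. -/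
lemma IsWave.fderiv_translation {σ : ℤ} {f : Phase → ℂ} (hw : L.IsWave σ f)
    (hf : ContDiffOn ℝ ∞ f L.system.M) {z : Phase} (hz : z ∈ L.system.M) (r : Fin 4 → ℝ) :
    _root_.fderiv ℝ f z (r, 0, 0, 0) = I * σ * mdot L.k r / L.ε * f z := by
  have h1 : HasDerivAt (fun t : ℝ => z + t • ((r, 0, 0, 0) : Phase)) (r, 0, 0, 0) 0 := by
    simpa using ((hasDerivAt_id (0 : ℝ)).smul_const ((r, 0, 0, 0) : Phase)).const_add z
  have h2 : HasFDerivAt f (_root_.fderiv ℝ f z) (z + (0 : ℝ) • ((r, 0, 0, 0) : Phase)) := by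
    rw [zero_smul, add_zero]
    exact (differentiableAt_of_mem L.isOpen_system_M hf hz).hasFDerivAt
  have h3 := h2.comp_hasDerivAt (0 : ℝ) h1
  have h4 : f ∘ (fun t : ℝ => z + t • ((r, 0, 0, 0) : Phase)) =
      fun t : ℝ => exp ((t : ℂ) * (I * σ * mdot L.k r / L.ε)) * f z := by
    funext t
    have : t • ((r, 0, 0, 0) : Phase) = (t • r, 0, 0, 0) := by simp
    simp only [Function.comp, this, hw.1, phase, mdot_smul_right]
    congr 2
    push_cast; ring
  rw [h4] at h3
  have h5 := ((hasDerivAt_id (0 : ℝ)).ofReal_comp.mul_const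
    (I * σ * mdot L.k r / L.ε : ℂ)).cexp.mul_const (f z)
  have h6 := h3.unique h5
  simpa using h6

/-- ∂_θ is ε/Ω_B times (ż - U·∂_R), and U·∂_R multiplies a σ-th harmonic by iσk·U/ε. -/
lemma IsWave.hasDerivAt_profile {σ : ℤ} {f : Phase → ℂ} (hw : L.IsWave σ f)
    (hf : ContDiffOn ℝ ∞ f L.system.M) {z : Phase} (hz : z ∈ L.system.M) (ξ : ℝ) :
    HasDerivAt (L.profile f z.2.1 z.2.2.1)
      (L.ε / L.Omega * L.profile (fun y => _root_.fderiv ℝ f y (L.system.vel y)) z.2.1 z.2.2.1 ξ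
        - I * σ * L.kU z.2.1 / L.Omega * L.profile f z.2.1 z.2.2.1 ξ) ξ := by
  have hy := base_mem hz 0 (L.α + ξ)
  have h1 : HasDerivAt (fun ξ : ℝ => ((0, z.2.1, z.2.2.1, L.α + ξ) : Phase)) eθ ξ :=
    (hasDerivAt_const ξ _).prodMk ((hasDerivAt_const ξ _).prodMk
      ((hasDerivAt_const ξ _).prodMk ((hasDerivAt_id ξ).const_add L.α)))
  have h2 := (differentiableAt_of_mem L.isOpen_system_M hf hy).hasFDerivAt.comp_hasDerivAt ξ h1
  refine h2.congr_deriv ?_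
  have h3 : L.system.vel ((0, z.2.1, z.2.2.1, L.α + ξ) : Phase) =
      (L.U z.2.1, 0, 0, 0) + (L.Omega / L.ε) • eθ := by
    rw [system_vel]
    refine Prod.ext ?_ (Prod.ext ?_ (Prod.ext ?_ ?_)) <;> simp [eθ]
  have hΩ := L.Omega_neC
  have hε := L.ε_neC
  rw [profile, profile, h3, map_add, map_smul, hw.fderiv_translation hf hy, mdot_k_U, real_smul]
  push_cast
  field_simp
  ring

/-- Along the unperturbed orbits the Fourier components of the wave oscillate with the frequencies
`D_ℓ / ε`. -/
lemma IsWave.fourierC_dot {f : Phase → ℂ} (hw : L.IsWave 1 f)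
    (hf : ContDiffOn ℝ ∞ f L.system.M) {z : Phase} (hz : z ∈ L.system.M) (ℓ : ℤ) :
    fourierC (L.profile (fun y => _root_.fderiv ℝ f y (L.system.vel y)) z.2.1 z.2.2.1) ℓ =
      I * L.D ℓ z.2.1 / L.ε * fourierC (L.profile f z.2.1 z.2.2.1) ℓ := by
  have hd : ContDiffOn ℝ ∞ (fun y => _root_.fderiv ℝ f y (L.system.vel y)) L.system.M :=
    (contDiffOn_fderiv L.isOpen_system_M hf).clm_apply L.contDiffOn_vel
  set p := L.profile f z.2.1 z.2.2.1 with hp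
  set q := L.profile (fun y => _root_.fderiv ℝ f y (L.system.vel y)) z.2.1 z.2.2.1 with hq
  have hpc : Continuous p := continuous_profile hf hz
  have hqc : Continuous q := continuous_profile hd hz
  have hper : p (2 * π) = p 0 := by
    have := hw.profile_periodic z.2.1 z.2.2.1 0
    rwa [zero_add] at this
  have h := fourierC_deriv (fun ξ => hw.hasDerivAt_profile hf hz ξ)
    ((continuous_const.mul hqc).sub (continuous_const.mul hpc)) hper ℓ
  have e : (fun ξ => (L.ε / L.Omega * q ξ - I * (1 : ℤ) * L.kU z.2.1 / L.Omega * p ξ : ℂ)) =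
      fun ξ => (L.ε / L.Omega : ℂ) * q ξ + (-(I * (1 : ℤ) * L.kU z.2.1 / L.Omega) : ℂ) * p ξ := by
    funext ξ; ring
  rw [e, fourierC_add (by fun_prop) (by fun_prop), fourierC_const_mul, fourierC_const_mul] at h
  have hΩ := L.Omega_neC
  have hε := L.ε_neC
  rw [D_eq]
  push_cast at h ⊢
  field_simp at h ⊢
  linear_combination h

/-- The Fourier components of the form `γ_w + dS₁`. -/
lemma fourierC_b {z : Phase} (hz : z ∈ L.system.M) (ℓ : ℤ) (v : Phase) :
    I * L.D ℓ z.2.1 / L.ε * fourierC (L.profile (fun y => L.b y v) z.2.1 z.2.2.1) ℓ =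
      -fourierC (L.profile (fun y => L.chi y v) z.2.1 z.2.2.1) ℓ
        - fourierC (L.profile (fun y => L.b y (L.velDeriv v)) z.2.1 z.2.2.1) ℓ := by
  rw [← (L.isWave_b v).fourierC_dot (L.contDiffOn_b_apply v) hz]
  have e : L.profile (fun y => fderiv ℝ (fun x => L.b x v) y (L.system.vel y)) z.2.1 z.2.2.1 =
      fun ξ => (-1) * L.profile (fun y => L.chi y v) z.2.1 z.2.2.1 ξ
        + (-1) * L.profile (fun y => L.b y (L.velDeriv v)) z.2.1 z.2.2.1 ξ := by
    funext ξ
    have := L.fderiv_b_apply (base_mem hz 0 (L.α + ξ)) v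
    simp only [profile] at this ⊢
    rw [this]; ring
  have h1 := continuous_profile (L.contDiffOn_chi v) hz
  have h2 := continuous_profile (L.contDiffOn_b_apply (L.velDeriv v)) hz
  rw [e, fourierC_add (by fun_prop) (by fun_prop), fourierC_const_mul, fourierC_const_mul]
  ring

end LocalWave

end OscCenter
end

/-! ### Parseval's identity for the ponderomotive Hamiltonian. -/

noncomputable section

namespace OscCenter

open Complex MeasureTheory
open scoped Real

namespace LocalWave

variable {L : LocalWave}

/-- Antisymmetry makes chi vanish on ż, so its θ-component is determined by its R-components along
ê₀ and ê₁. -/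
lemma chi_eq_zero_of_vel {z : Phase} (hz : z ∈ L.system.M) :
    z.2.1 0 * L.chi z (L.eR 0) + z.2.1 1 * L.chi z (L.eR 1) + L.Omega / L.ε * L.chi z eθ = 0 := by
  have h : L.chi z (L.system.vel z) = 0 := by rw [chi]; ring
  obtain ⟨Φ, hl⟩ : ∃ Φ : Phase →L[ℝ] ℂ, ∀ v, L.chi z v = Φ v :=
    ⟨(fderiv ℝ L.γC z).flip (L.system.vel z) - fderiv ℝ L.γC z (L.system.vel z),
      fun v => (L.fderiv_γC_sub hz v).symm⟩
  rw [hl, vel_eq] at h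
  simpa only [hl, map_add, map_smul, real_smul, ofReal_div] using h

lemma b_eq_zero_of_vel {z : Phase} (hz : z ∈ L.system.M) :
    z.2.1 0 * L.b z (L.eR 0) + z.2.1 1 * L.b z (L.eR 1) + L.Omega / L.ε * L.b z eθ = 0 := by
  have h := L.b_vel hz
  rw [vel_eq] at h
  simpa only [map_add, map_smul, real_smul, ofReal_div] using h

/-- The Fourier components on the gyrocircle of `R`-constant phase. -/
def hat (L : LocalWave) (f : Phase → ℂ) (z : Phase) (ℓ : ℤ) : ℂ :=
  fourierC (L.profile f z.2.1 z.2.2.1) ℓ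

/-- Applies to both chi and b; this is where the combination U·Q_ℓ of form (B) comes from. -/
lemma hat_eθ {f : Phase → Phase → ℂ} (hf : ∀ v, ContDiffOn ℝ ∞ (fun y => f y v) L.system.M)
    (h0 : ∀ z ∈ L.system.M,
      z.2.1 0 * f z (L.eR 0) + z.2.1 1 * f z (L.eR 1) + L.Omega / L.ε * f z eθ = 0)
    {z : Phase} (hz : z ∈ L.system.M) (ℓ : ℤ) : L.hat (fun y => f y eθ) z ℓ =
      -(L.ε / L.Omega) * (z.2.1 0 * L.hat (fun y => f y (L.eR 0)) z ℓ
        + z.2.1 1 * L.hat (fun y => f y (L.eR 1)) z ℓ) := by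
  have hΩ := L.Omega_neC
  have hε := L.ε_neC
  have c0 := continuous_profile (hf (L.eR 0)) hz
  have c1 := continuous_profile (hf (L.eR 1)) hz
  have e : L.profile (fun y => f y eθ) z.2.1 z.2.2.1 = fun ξ =>
      (-(L.ε / L.Omega) * z.2.1 0 : ℂ) * L.profile (fun y => f y (L.eR 0)) z.2.1 z.2.2.1 ξ
      + (-(L.ε / L.Omega) * z.2.1 1 : ℂ) * L.profile (fun y => f y (L.eR 1)) z.2.1 z.2.2.1 ξ := by
    funext ξ
    have h := h0 _ (base_mem hz 0 (L.α + ξ))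
    simp only [profile]
    field_simp at h ⊢
    linear_combination h
  rw [hat, e, fourierC_add (by fun_prop) (by fun_prop), fourierC_const_mul, fourierC_const_mul]
  simp only [hat]
  ring

lemma fourierC_zero (ℓ : ℤ) : fourierC (fun _ => 0) ℓ = 0 := by simp [fourierC]

lemma hat_b_eR {z : Phase} (hz : z ∈ L.system.M) {ℓ : ℤ} (hD : L.D ℓ z.2.1 ≠ 0) (a : Fin 4) :
    L.hat (fun y => L.b y (L.eR a)) z ℓ = 2 / L.D ℓ z.2.1 * L.Q ℓ z.2.1 z.2.2.1 a := by
  have h := L.fourierC_b hz ℓ (L.eR a)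
  have hv : L.velDeriv (L.eR a) = 0 := by rw [velDeriv_eq]; simp [eR]
  have e : L.profile (fun y => L.b y 0) z.2.1 z.2.2.1 = fun _ => 0 := by
    funext ξ; simp [profile]
  rw [hv, e, fourierC_zero, sub_zero, fourierC_chi_eR hz] at h
  have hD' : (L.D ℓ z.2.1 : ℂ) ≠ 0 := by exact_mod_cast hD
  have hε := L.ε_neC
  have hI := I_ne_zero
  rw [hat]
  field_simp at h ⊢
  linear_combination h

/-- A variation of u changes the orbit velocity, so the u-component of b is driven by its
R-component. Dividing by D_ℓ a second time creates the double poles of K₂. -/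
lemma hat_b_eu {z : Phase} (hz : z ∈ L.system.M) {ℓ : ℤ} (hD : L.D ℓ z.2.1 ≠ 0) {i : Fin 2}
    {a : Fin 4} (hv : L.velDeriv (eu i) = L.eR a) :
    L.hat (fun y => L.b y (eu i)) z ℓ =
      2 * I * L.ε / L.D ℓ z.2.1 ^ 2 * L.Q ℓ z.2.1 z.2.2.1 a := by
  have h := L.fourierC_b hz ℓ (eu i)
  have e : L.profile (fun y => L.chi y (eu i)) z.2.1 z.2.2.1 = fun _ => 0 := by
    funext ξ; exact L.chi_eu (base_mem hz 0 (L.α + ξ)) i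
  have hR := hat_b_eR hz hD a
  rw [hat] at hR
  rw [hv, e, fourierC_zero, neg_zero, zero_sub, hR] at h
  have hD' : (L.D ℓ z.2.1 : ℂ) ≠ 0 := by exact_mod_cast hD
  have hε := L.ε_neC
  rw [hat]
  set x := fourierC (L.profile (fun y => L.b y (eu i)) z.2.1 z.2.2.1) ℓ
  field_simp at h ⊢
  linear_combination -I * h + L.D ℓ z.2.1 ^ 2 * x * I_sq

lemma hat_b_eμ {z : Phase} (hz : z ∈ L.system.M) {ℓ : ℤ} (hD : L.D ℓ z.2.1 ≠ 0) :
    L.hat (fun y => L.b y eμ) z ℓ = -(2 * L.ε * L.e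
      / (L.c * L.m * L.Omega * L.rho z.2.2.1 * L.D ℓ z.2.1)) * L.X ℓ z.2.1 z.2.2.1 := by
  have h := L.fourierC_b hz ℓ eμ
  have hv : L.velDeriv eμ = 0 := by rw [velDeriv_eq]; simp [eμ]
  have e : L.profile (fun y => L.b y 0) z.2.1 z.2.2.1 = fun _ => 0 := by
    funext ξ; simp [profile]
  rw [hv, e, fourierC_zero, sub_zero, fourierC_chi_eμ hz] at h
  have hD' : (L.D ℓ z.2.1 : ℂ) ≠ 0 := by exact_mod_cast hD
  have hε := L.ε_neC
  have hρ := L.rho_neC hz.1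
  have hΩ := L.Omega_neC
  have hm := L.m_neC
  have hc := L.c_neC
  have hI := I_ne_zero
  rw [hat]
  set x := fourierC (L.profile (fun y => L.b y eμ) z.2.1 z.2.2.1) ℓ
  field_simp at h ⊢
  linear_combination h

lemma D_ne {z : Phase} (hz : z ∈ L.system.M) (ℓ : ℤ) : L.D ℓ z.2.1 ≠ 0 := by
  intro h
  refine hz.2 (2 * ℓ) ?_
  rw [D] at h
  push_cast
  linear_combination 2 * h

lemma integral_comb {p q r s t w : ℝ → ℂ} (hp : Continuous p) (hq : Continuous q)
    (hr : Continuous r) (hs : Continuous s) (ht : Continuous t) (hw : Continuous w)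
    (k c₁ c₂ c₃ : ℂ) (a b : ℝ) :
    k * ∫ ξ in a..b, (c₁ * (p ξ - q ξ) + c₂ * (r ξ - s ξ) + c₃ * (t ξ - w ξ)) =
      c₁ * (k * (∫ ξ in a..b, p ξ) - k * ∫ ξ in a..b, q ξ)
      + c₂ * (k * (∫ ξ in a..b, r ξ) - k * ∫ ξ in a..b, s ξ)
      + c₃ * (k * (∫ ξ in a..b, t ξ) - k * ∫ ξ in a..b, w ξ) := by
  have i : ∀ {f : ℝ → ℂ}, Continuous f → IntervalIntegrable f volume a b :=
    fun hf => hf.intervalIntegrable _ _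
  rw [intervalIntegral.integral_add (i (by fun_prop)) (i (by fun_prop)),
    intervalIntegral.integral_add (i (by fun_prop)) (i (by fun_prop)),
    intervalIntegral.integral_const_mul, intervalIntegral.integral_const_mul,
    intervalIntegral.integral_const_mul, intervalIntegral.integral_sub (i hp) (i hq),
    intervalIntegral.integral_sub (i hr) (i hs), intervalIntegral.integral_sub (i ht) (i hw)]
  ring

/-- Parseval's identity for the average of `½ i₀ i₁ ω_w`. -/
lemma hasSum_pairing_hat {z : Phase} (hz : z ∈ L.system.M) :
    HasSum (fun ℓ => L.pairing (fun a => L.hat (fun y => L.chi y (L.eR a)) z ℓ)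
      (L.hat (fun y => L.chi y eμ) z ℓ) (L.hat (fun y => L.chi y eθ) z ℓ)
      (fun a => starRingEnd ℂ (L.hat (fun y => L.b y (L.eR a)) z ℓ))
      (fun i => starRingEnd ℂ (L.hat (fun y => L.b y (eu i)) z ℓ))
      (starRingEnd ℂ (L.hat (fun y => L.b y eμ) z ℓ))
      (starRingEnd ℂ (L.hat (fun y => L.b y eθ) z ℓ))) (L.mean L.F0 z.2.1 z.2.2.1) := by
  have cb := fun v => continuous_profile (L.contDiffOn_b_apply v) hz
  have cc := fun v => continuous_profile (L.contDiffOn_chi v) hz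
  have cm : ∀ v w, Continuous fun ξ =>
      starRingEnd ℂ (L.profile (fun y => L.b y v) z.2.1 z.2.2.1 ξ)
        * L.profile (fun y => L.chi y w) z.2.1 z.2.2.1 ξ := fun v w =>
    (continuous_conj.comp (cb v)).mul (cc w)
  have hS := fun v w => hasSum_conj_mul_fourierC (cb v) (cc w)
  have h := ((((hS (eu 0) (L.eR 0)).sub (hS (eu 1) (L.eR 1))).mul_left
      ((1 / (4 * L.m) : ℝ) : ℂ)).add
    (((hS (L.eR 3) (L.eR 2)).sub (hS (L.eR 2) (L.eR 3))).mul_left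
      ((L.ε / (4 * L.m * L.Omega) : ℝ) : ℂ))).add
    (((hS eθ eμ).sub (hS eμ eθ)).mul_left ((1 / (4 * L.ε) : ℝ) : ℂ))
  rw [← integral_comb (cm _ _) (cm _ _) (cm _ _) (cm _ _) (cm _ _) (cm _ _)] at h
  exact h

/-- The R–u pairs give the P_∥ term with D_ℓ⁻², the ê₂–ê₃ pair gives the F₀ term, and the μ–θ pair
gives the term with X_ℓ. -/
lemma pairing_hat_re {z : Phase} (hz : z ∈ L.system.M) (ℓ : ℤ) :
    (L.pairing (fun a => L.hat (fun y => L.chi y (L.eR a)) z ℓ)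
      (L.hat (fun y => L.chi y eμ) z ℓ) (L.hat (fun y => L.chi y eθ) z ℓ)
      (fun a => starRingEnd ℂ (L.hat (fun y => L.b y (L.eR a)) z ℓ))
      (fun i => starRingEnd ℂ (L.hat (fun y => L.b y (eu i)) z ℓ))
      (starRingEnd ℂ (L.hat (fun y => L.b y eμ) z ℓ))
      (starRingEnd ℂ (L.hat (fun y => L.b y eθ) z ℓ))).re = L.K2TermF ℓ z.2.1 z.2.2.1 := by
  have hD := D_ne hz ℓ
  have hD' : (L.D ℓ z.2.1 : ℂ) ≠ 0 := by exact_mod_cast hD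
  have hε := L.ε_neC
  have hρ := L.rho_neC hz.1
  have hΩ := L.Omega_neC
  have hm := L.m_neC
  have hc := L.c_neC
  have v0 : L.velDeriv (eu 0) = L.eR 0 := by rw [velDeriv_eq]; simp [eu]
  have v1 : L.velDeriv (eu 1) = L.eR 1 := by rw [velDeriv_eq]; simp [eu]
  have cR : ∀ a, L.hat (fun y => L.chi y (L.eR a)) z ℓ = _ := fun a => fourierC_chi_eR hz a ℓ
  have cμ : L.hat (fun y => L.chi y eμ) z ℓ = _ := fourierC_chi_eμ hz ℓ
  have cθ := hat_eθ (f := fun y v => L.chi y v) L.contDiffOn_chi (fun z hz => chi_eq_zero_of_vel hz)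
    hz ℓ
  have bθ := hat_eθ (f := fun y v => L.b y v) L.contDiffOn_b_apply (fun z hz => b_eq_zero_of_vel hz)
    hz ℓ
  rw [K2TermF_eq L hz.1 hD, cθ, bθ, pairing, QU]
  simp only [hat_b_eR hz hD, hat_b_eu hz hD v0, hat_b_eu hz hD v1, hat_b_eμ hz hD, cR, cμ]
  simp only [map_mul, map_neg, map_add, map_div₀, map_pow, conj_I, conj_ofReal, map_ofNat]
  generalize L.Q ℓ z.2.1 z.2.2.1 0 = q0
  generalize L.Q ℓ z.2.1 z.2.2.1 1 = q1
  generalize L.Q ℓ z.2.1 z.2.2.1 2 = q2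
  generalize L.Q ℓ z.2.1 z.2.2.1 3 = q3
  generalize L.X ℓ z.2.1 z.2.2.1 = x
  -- The μ–θ pair yields w plus its conjugate, the other pairs yield 2y; only the real part of the
  -- total has to agree with y + w + c.c.
  set w : ℂ := I * L.e / (L.m * L.c * L.rho z.2.2.1 * L.Omega ^ 2 * L.D ℓ z.2.1)
          * ((z.2.1 0 * q0 + z.2.1 1 * q1) * starRingEnd ℂ x) with hw
  have hcw : starRingEnd ℂ w = -I * L.e / (L.m * L.c * L.rho z.2.2.1 * L.Omega ^ 2 * L.D ℓ z.2.1)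
          * ((z.2.1 0 * starRingEnd ℂ q0 + z.2.1 1 * starRingEnd ℂ q1) * x) := by
    rw [hw]
    simp only [map_mul, map_add, map_div₀, map_pow, conj_I, conj_ofReal, conj_conj]
  set y : ℂ := (q1 * starRingEnd ℂ q1 - q0 * starRingEnd ℂ q0) / (2 * L.m * L.D ℓ z.2.1 ^ 2)
        - I * (q2 * starRingEnd ℂ q3 - q3 * starRingEnd ℂ q2) / (2 * L.m * L.Omega * L.D ℓ z.2.1)
    with hy
  have key : ∀ t : ℂ, t = 2 * y + w + starRingEnd ℂ w → t.re = addCC (y + w) := by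
    rintro t rfl
    simp [addCC]; ring
  refine key _ ?_
  rw [hcw, hw, hy]
  push_cast
  field_simp
  ring_nf
  simp only [I_sq]
  ring

/-- Parseval's identity delivers the series (B), whose sum is already known to be form (A). -/
lemma mean_F0 {z : Phase} (hz : z ∈ L.system.M) :
    (L.mean L.F0 z.2.1 z.2.2.1).re = L.K2FormA z.2.1 z.2.2.1 := by
  have h1 := reCLM.hasSum (hasSum_pairing_hat hz)
  have h2 := L.hasSum_K2TermF hz.1 (D_ne hz)
  refine HasSum.unique (h1.congr_fun fun ℓ => ?_) h2
  exact (pairing_hat_re hz ℓ).symm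

end LocalWave

end OscCenter
end

/-! ### Existence of the transform, and the theorem. -/

noncomputable section

namespace OscCenter

namespace LocalWave

variable (L : LocalWave)

/-- The oscillation-center transform of a guiding center in a wave. -/
lemma exists_transform : ∃ g₂ : Phase → Phase,
    L.system.IsOscillationCenterTransform L.γw L.g₁ g₂ L.S₁ L.S₂
      (fun z => L.K2FormA z.2.1 z.2.2.1) ∧
    L.system.IsOscillationCenterTransform (PhaseSystem.gaugeShift L.γw L.S_T) L.g₁ g₂
      (L.S₁ - L.S_T) L.S₂ (fun z => L.K2FormF z.2.1 z.2.2.1) := by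
  have := FiniteDimensional.complete ℝ Phase
  have hP := L.isHamiltonian_system
  obtain ⟨g₂, h⟩ := PhaseSystem.exists_isOscillationCenterTransform hP L.contDiffOn_γw
    (g₁ := L.g₁) (K₂ := fun z => L.K2FormA z.2.1 z.2.2.1) L.contDiffOn_S₁ L.contDiffOn_S₂
    L.isOscillatory_S₁ L.isOscillatory_S₂ (fun z hz => L.dot_S₁ hz) (fun z hz => L.dForm_g₁ hz)
    (fun z hz => by rw [← mean_F0 hz]; exact L.hasOrbitAverage_halfI0I1 hz)
    (fun z hz => by rw [← mean_F0 hz]; exact L.dot_S₂ hz)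
  have h' := h.gaugeShift hP L.contDiffOn_γw L.contDiffOn_S_T L.isOscillatory_S_T
  refine ⟨g₂, h, h'.congr_K₂ hP fun z hz => ?_⟩
  have := (L.explicit_forms hz.1 (D_ne hz)).2.2.2.2.1
  exact this.symm

end LocalWave

end OscCenter
end
theorem mainTheorem5 {E : Type*} [NormedAddCommGroup E] [NormedSpace ℝ E] [FiniteDimensional ℝ E]
    (P : OscCenter.PhaseSystem E) (hP : P.IsHamiltonian)
    (γw : E → (E →L[ℝ] ℝ)) (hγw : ContDiffOn ℝ ∞ γw P.M)
    (L : OscCenter.LocalWave) :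
    -- the transform yields `K₂ = ⟨½ i₀ i₁ ω_w⟩`
    (∀ (g₁ g₂ : E → E) (S₁ S₂ K₂ : E → ℝ),
      P.IsOscillationCenterTransform γw g₁ g₂ S₁ S₂ K₂ →
      ∀ z ∈ P.M,
        OscCenter.dForm P.γ z (g₁ z) = γw z + fderiv ℝ S₁ z ∧
        OscCenter.dForm P.γ z (g₂ z)
          = -(1 / 2 : ℝ) • OscCenter.dForm γw z (g₁ z) + fderiv ℝ S₂ z ∧
        P.dot S₁ z = -γw z (P.vel z) ∧
        K₂ z = P.halfI0I1 γw g₁ z - P.dot S₂ z ∧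
        P.HasOrbitAverage (P.halfI0I1 γw g₁) z (K₂ z)) ∧
    -- the transform exists as soon as the two equations for `S₁` and `S₂` can be integrated
    (∀ (g₁ : E → E) (S₁ S₂ K₂ : E → ℝ),
      ContDiffOn ℝ ∞ S₁ P.M → ContDiffOn ℝ ∞ S₂ P.M →
      P.IsOscillatory S₁ → P.IsOscillatory S₂ →
      (∀ z ∈ P.M, P.dot S₁ z = -γw z (P.vel z)) →
      (∀ z ∈ P.M, OscCenter.dForm P.γ z (g₁ z) = γw z + fderiv ℝ S₁ z) →
      (∀ z ∈ P.M, P.HasOrbitAverage (P.halfI0I1 γw g₁) z (K₂ z)) →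
      (∀ z ∈ P.M, P.dot S₂ z = P.halfI0I1 γw g₁ z - K₂ z) →
      ∃ g₂ : E → E, P.IsOscillationCenterTransform γw g₁ g₂ S₁ S₂ K₂) ∧
    -- gauge transformations
    (∀ S_T : E → ℝ, ContDiffOn ℝ ∞ S_T P.M →
      (∀ (g₁ g₂ : E → E) (S₁ S₂ K₂ : E → ℝ),
        P.IsLieTransform γw g₁ g₂ S₁ S₂ K₂ ↔
          P.IsLieTransform (OscCenter.PhaseSystem.gaugeShift γw S_T) g₁ g₂ (S₁ - S_T) S₂ K₂) ∧
      (P.IsOscillatory S_T →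
        ∀ (g₁ g₂ g₁' g₂' : E → E) (S₁ S₂ K₂ S₁' S₂' K₂' : E → ℝ),
          P.IsOscillationCenterTransform γw g₁ g₂ S₁ S₂ K₂ →
          (P.IsOscillationCenterTransform (OscCenter.PhaseSystem.gaugeShift γw S_T)
              g₁ g₂ (S₁ - S_T) S₂ K₂) ∧
          (P.IsOscillationCenterTransform (OscCenter.PhaseSystem.gaugeShift γw S_T)
              g₁' g₂' S₁' S₂' K₂' →
            ∀ z ∈ P.M, S₁' z = S₁ z - S_T z ∧ g₁' z = g₁ z ∧ S₂' z = S₂ z ∧ g₂' z = g₂ z ∧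
              K₂' z = K₂ z))) ∧
    -- the explicit forms are equal
    (∀ (u : Fin 2 → ℝ) (μ : ℝ), 0 < μ * L.Omega → (∀ ℓ : ℤ, L.D ℓ u ≠ 0) →
      (∀ ℓ : ℤ, DifferentiableAt ℝ (fun p : (Fin 2 → ℝ) × ℝ => L.W ℓ p.1 p.2) (u, μ)) ∧
      Summable (fun ℓ : ℤ => L.K2TermA ℓ u μ) ∧
      Summable (fun ℓ : ℤ => L.K2TermF ℓ u μ) ∧
      Summable (fun ℓ : ℤ => L.K2TermC ℓ u μ) ∧
      L.K2FormF u μ = L.K2FormA u μ ∧ L.K2FormC u μ = L.K2FormA u μ) ∧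
    -- and they are the ponderomotive Hamiltonian of the guiding center in the wave
    (L.system.IsHamiltonian ∧
      ContDiffOn ℝ ∞ L.γw L.system.M ∧
      ContDiffOn ℝ ∞ L.S_T L.system.M ∧
      L.system.IsOscillatory L.S_T ∧
      (∀ z ∈ L.system.M, ∀ ℓ ℓ' : ℤ,
        L.system.HasOrbitAverage (fun y => starRingEnd ℂ (L.expΨ ℓ y) * L.expΨ ℓ' y) z
          (if ℓ = ℓ' then 1 else 0)) ∧
      ∃ (g₁ g₂ : OscCenter.LocalWave.Phase → OscCenter.LocalWave.Phase)
        (S₁ S₂ : OscCenter.LocalWave.Phase → ℝ),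
        L.system.IsOscillationCenterTransform L.γw g₁ g₂ S₁ S₂
            (fun z => L.K2FormA z.2.1 z.2.2.1) ∧
        L.system.IsOscillationCenterTransform
            (OscCenter.PhaseSystem.gaugeShift L.γw L.S_T) g₁ g₂ (S₁ - L.S_T) S₂
            (fun z => L.K2FormF z.2.1 z.2.2.1)) := by
  have := FiniteDimensional.complete ℝ E
  refine ⟨fun g₁ g₂ S₁ S₂ K₂ h z hz =>
      OscCenter.PhaseSystem.isOscillationCenterTransform_spec hP hγw h hz,
    fun g₁ S₁ S₂ K₂ hS₁ hS₂ o₁ o₂ e3 e1 ha e4 =>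
      OscCenter.PhaseSystem.exists_isOscillationCenterTransform hP hγw hS₁ hS₂ o₁ o₂ e3 e1 ha e4,
    fun S_T hS => ⟨fun g₁ g₂ S₁ S₂ K₂ =>
      OscCenter.PhaseSystem.isLieTransform_gaugeShift_iff hP hγw hS, ?_⟩,
    fun u μ hμ hD => L.explicit_forms hμ hD,
    L.isHamiltonian_system, L.contDiffOn_γw, L.contDiffOn_S_T, L.isOscillatory_S_T,
    fun z hz ℓ ℓ' => OscCenter.LocalWave.hasOrbitAverage_expΨ hz ℓ ℓ',
    L.g₁, ?_⟩
  · intro ho g₁ g₂ g₁' g₂' S₁ S₂ K₂ S₁' S₂' K₂' h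
    have hg := h.gaugeShift hP hγw hS ho
    exact ⟨hg, fun h' => hg.unique hP (OscCenter.PhaseSystem.contDiffOn_gaugeShift hP hγw hS) h'⟩
  · obtain ⟨g₂, h, h'⟩ := L.exists_transform
    exact ⟨g₂, L.S₁, L.S₂, h, h'⟩
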